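/- Let $d\ge 1$ and let $D$, $0<\beta_{\min}\le\beta_{\max}$, $\kappa,\gamma$ be positive constants. There is a constant $C>0$, depending only on $d,D,\beta_{\min},\beta_{\max},\kappa,\gamma$, such that the following holds. Let $\Omega\subset\mathbb R^d$ be a bounded polyhedral domain with Lipschitz boundary and diameter at most $D$, and let $\beta:\Omega\to\mathbb R$ be measurable with $\beta_{\min}\le\beta\le\beta_{\max}$ almost everywhere. Let $\mathcal T_H$ be a conforming mesh of $\Omega$ consisting either of (closed) simplices or of axis-parallel squares/cubes. For $e\in\mathcal T_H$ let $H_e$ be its diameter and $\rho_e$ the diameter of the largest ball contained in $e$; put $H=\max_e H_e$ and assume $\max_e H_e\le\kappa\min_e H_e$ and $\max_e H_e/\rho_e\le\gamma$. Let $U_e$ be the space of polynomials of total degree at most $1$ (simplices), respectively of degree at most $1$ in each variable (cubes), and let $$U^D_{H,1}=\{u\in L^2(\Omega): u|_e\in U_e\ \ \forall e\in\mathcal T_H\},\qquad U_H=U^D_{H,1}\cap H^1_0(\Omega).$$ Let $I_e$ denote the interpolation operator that maps a continuous function on $e$ to the element of $U_e$ with the same values at the vertices of $e$, and define $$b(u,w)=\int_\Omega\beta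 uw\,dx\quad (u,w\in L^2(\Omega)),\qquad b_H'(u,w)=\sum_{e\in\mathcal T_H}\int_e\beta\, I_e(u|_e\, w|_e)\,dx\quad (u,w\in U^D_{H,1}).$$ Let $\Pi^D_{H,1}:L^2(\Omega)\to U^D_{H,1}$ and $\Pi_H^{\mathrm{av}}:U^D_{H,1}\to U_H$ be the operators determined by $$b(\Pi^D_{H,1}u,w)=b(u,w)\ \ \forall w\in U^D_{H,1},\qquad b_H'(\Pi_H^{\mathrm{av}}u,w)=b_H'(u,w)\ \ \forall w\in U_H,$$ and let $\Pi_H=\Pi_H^{\mathrm{av}}\circ\Pi^D_{H,1}$ and $r_H(u,w)=b(u,w)-b_H'(\Pi_Hu,\Pi_Hw)$. Then $$|r_H(u,w)|\le C H^2\,\|u\|_{1}\,\|w\|_{1}\qquad\text{for all }u,w\in H^1_0(\Omega),$$ where $\|\cdot\|_1$ is the norm of $H^1(\Omega)$. In particular $C$ does not depend on $H$ or on the scale on which $\beta$ oscillates. -/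

import Mathlib

open MeasureTheory

noncomputable section

namespace MassLump

/-- The Euclidean space `ℝ^d`. -/
abbrev Sp (d : ℕ) : Type := EuclideanSpace ℝ (Fin d)

/-! ### Domains -/

/-- `Ω` is a bounded domain (open, connected, non-empty) with Lipschitz boundary: near every
boundary point, `Ω` is the set of points strictly above the graph of a Lipschitz function over the
hyperplane orthogonal to some unit vector `n`. -/
structure IsLipschitzDomain {d : ℕ} (Ω : Set (Sp d)) : Prop where
  isOpen : IsOpen Ω
  isConnected : IsConnected Ω
  isBounded : Bornology.IsBounded Ω
  lipschitz_boundary : ∀ z ∈ frontier Ω, ∃ (r : ℝ) (n : Sp d) (L : NNReal) (g : Sp d → ℝ),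
    0 < r ∧ ‖n‖ = 1 ∧ LipschitzWith L g ∧
      ∀ x ∈ Metric.ball z r, x ∈ Ω ↔ g (x - inner ℝ n x • n) < inner ℝ n x

/-! ### Sobolev spaces -/

/-- Test functions `C_c^∞(Ω)`. -/
def IsTestFun {d : ℕ} (Ω : Set (Sp d)) (φ : Sp d → ℝ) : Prop :=
  ContDiff ℝ (⊤ : ℕ∞) φ ∧ HasCompactSupport φ ∧ tsupport φ ⊆ Ω

/-- `G` is a square-integrable weak gradient of `u` on `Ω`. -/
def HasWeakGrad {d : ℕ} (Ω : Set (Sp d)) (u : Sp d → ℝ) (G : Sp d → Sp d) : Prop :=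
  MemLp G 2 (volume.restrict Ω) ∧
    ∀ φ : Sp d → ℝ, IsTestFun Ω φ → ∀ i : Fin d,
      ∫ x in Ω, u x * fderiv ℝ φ x (EuclideanSpace.single i 1) = - ∫ x in Ω, G x i * φ x

/-- `u ∈ H¹(Ω)`; functions are representatives of their classes modulo null sets. -/
def MemH1 {d : ℕ} (Ω : Set (Sp d)) (u : Sp d → ℝ) : Prop :=
  MemLp u 2 (volume.restrict Ω) ∧ ∃ G, HasWeakGrad Ω u G

/-- The weak gradient of `u ∈ H¹(Ω)` (unique up to a null set when `Ω` is open). -/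
def weakGrad {d : ℕ} (Ω : Set (Sp d)) (u : Sp d → ℝ) : Sp d → Sp d :=
  Classical.epsilon (HasWeakGrad Ω u)

/-- The norm `‖u‖₁` of `H¹(Ω)`. -/
def normH1 {d : ℕ} (Ω : Set (Sp d)) (u : Sp d → ℝ) : ℝ :=
  Real.sqrt ((∫ x in Ω, u x ^ 2) + ∫ x in Ω, ‖weakGrad Ω u x‖ ^ 2)

/-- `u ∈ H¹₀(Ω)`, the closure of `C_c^∞(Ω)` in `H¹(Ω)`; on a bounded Lipschitz domain these are
exactly the functions of `H¹(Ω)` with zero trace. -/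
def MemH10 {d : ℕ} (Ω : Set (Sp d)) (u : Sp d → ℝ) : Prop :=
  MemH1 Ω u ∧ ∀ ε : ℝ, 0 < ε → ∃ φ : Sp d → ℝ, IsTestFun Ω φ ∧
    (∫ x in Ω, (u x - φ x) ^ 2) + ∫ x in Ω, ‖weakGrad Ω u x - gradient φ x‖ ^ 2 < ε

/-! ### Meshes -/

/-- The two kinds of meshes: simplicial ones, and ones made of axis-parallel cubes
(squares for `d = 2`). -/
inductive MeshKind
  | simplicial
  | cubic

/-- `s` is the vertex set of an element of the given kind: the `d + 1` vertices of a
non-degenerate simplex, or the `2 ^ d` vertices of an axis-parallel cube. -/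
def IsElement {d : ℕ} : MeshKind → Finset (Sp d) → Prop
  | .simplicial, s => s.card = d + 1 ∧ AffineIndependent ℝ (fun v : s => (v : Sp d))
  | .cubic, s => ∃ (a : Sp d) (h : ℝ), 0 < h ∧
      (s : Set (Sp d)) = {x | ∀ i, x i = a i ∨ x i = a i + h}

/-- The (closed) element with vertex set `s`. -/
def elem {d : ℕ} (s : Finset (Sp d)) : Set (Sp d) := convexHull ℝ (s : Set (Sp d))

/-- `T` (the finite set of the vertex sets of the elements) is a regular, that is conforming, mesh
of `Ω`: its elements cover `closure Ω`, and two elements meet exactly in the convex hull of their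
common vertices (so there are no overlaps and no hanging nodes). -/
structure IsMesh {d : ℕ} (kind : MeshKind) (Ω : Set (Sp d)) (T : Finset (Finset (Sp d))) :
    Prop where
  isElement : ∀ s ∈ T, IsElement kind s
  cover : ⋃ s ∈ T, elem s = closure Ω
  conforming : ∀ s ∈ T, ∀ t ∈ T,
    elem s ∩ elem t = convexHull ℝ ((s : Set (Sp d)) ∩ (t : Set (Sp d)))

/-- `H_e`: the diameter of an element. -/
def elemDiam {d : ℕ} (s : Finset (Sp d)) : ℝ := Metric.diam (elem s)

/-- `ρ_e`: the diameter of the largest ball contained in an element. -/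
def elemInDiam {d : ℕ} (s : Finset (Sp d)) : ℝ :=
  sSup {δ : ℝ | 0 ≤ δ ∧ ∃ x, Metric.closedBall x (δ / 2) ⊆ elem s}

/-- The mesh width `H`: the largest diameter of an element. -/
def meshWidth {d : ℕ} (T : Finset (Finset (Sp d))) : ℝ :=
  sSup (elemDiam '' (T : Set (Finset (Sp d))))

/-- The mesh has quasi-uniformity constant `κ` and shape-regularity constant `γ`. -/
def IsRegularMesh {d : ℕ} (κ γ : ℝ) (T : Finset (Finset (Sp d))) : Prop :=
  (∀ s ∈ T, ∀ t ∈ T, elemDiam s ≤ κ * elemDiam t) ∧ ∀ s ∈ T, elemDiam s ≤ γ * elemInDiam s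

/-! ### Discrete spaces -/

/-- The polynomial spaces `P_k` (total degree at most `k`) and `Q_k` (degree at most `k` in each
variable). -/
def polySpace (d : ℕ) : MeshKind → ℕ → Submodule ℝ (MvPolynomial (Fin d) ℝ)
  | .simplicial, k => MvPolynomial.restrictTotalDegree (Fin d) ℝ k
  | .cubic, k => MvPolynomial.restrictDegree (Fin d) ℝ k

/-- The value of a polynomial at a point. -/
def pval {d : ℕ} (p : MvPolynomial (Fin d) ℝ) (x : Sp d) : ℝ :=
  MvPolynomial.eval (fun i => x i) p

/-- The discontinuous piecewise polynomial space `U^D_{H,k}`. -/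
def UD {d : ℕ} (kind : MeshKind) (Ω : Set (Sp d)) (T : Finset (Finset (Sp d))) (k : ℕ) :
    Set (Sp d → ℝ) :=
  {u | MemLp u 2 (volume.restrict Ω) ∧
    ∀ s ∈ T, ∃ p ∈ polySpace d kind k, u =ᵐ[volume.restrict (elem s)] pval p}

/-- The finite element space `U_H = U^D_{H,1} ∩ H¹₀(Ω)`. -/
def UH {d : ℕ} (kind : MeshKind) (Ω : Set (Sp d)) (T : Finset (Finset (Sp d))) :
    Set (Sp d → ℝ) :=
  {u | u ∈ UD kind Ω T 1 ∧ MemH10 Ω u}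

/-! ### Bilinear forms and operators

The objects below that are introduced by `Classical.epsilon` are those characterized by the stated
property; they exist and are unique (functions being identified when they agree almost everywhere)
for every conforming mesh and every `β` between two positive constants. -/

/-- `b(u,w) = ∫_Ω β u w`. -/
def bform {d : ℕ} (Ω : Set (Sp d)) (β u w : Sp d → ℝ) : ℝ :=
  ∫ x in Ω, β x * (u x * w x)

/-- The polynomial in `U_e` that `u ∈ U^D_{H,1}` coincides with on the element `e`. -/
def elemPoly {d : ℕ} (kind : MeshKind) (s : Finset (Sp d)) (u : Sp d → ℝ) :
    MvPolynomial (Fin d) ℝ :=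
  Classical.epsilon fun p => p ∈ polySpace d kind 1 ∧ u =ᵐ[volume.restrict (elem s)] pval p

/-- The interpolation operator `I_e`: the polynomial in `U_e` with the same values as `f` at the
vertices of the element. -/
def interp {d : ℕ} (kind : MeshKind) (s : Finset (Sp d)) (f : Sp d → ℝ) :
    MvPolynomial (Fin d) ℝ :=
  Classical.epsilon fun p => p ∈ polySpace d kind 1 ∧ ∀ v ∈ s, pval p v = f v

/-- The lumped form `b_H'(u,w) = ∑_e ∫_e β I_e(u w)` for `u, w ∈ U^D_{H,1}`, where `u w` is taken
on the closed element, that is as the product of the polynomials `u|_e` and `w|_e`. -/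
def bH {d : ℕ} (kind : MeshKind) (T : Finset (Finset (Sp d))) (β u w : Sp d → ℝ) : ℝ :=
  ∑ s ∈ T, ∫ x in elem s,
    β x * pval (interp kind s fun v => pval (elemPoly kind s u) v * pval (elemPoly kind s w) v) x

/-- The weighted `L²` projection `Π^D_{H,k} : L²(Ω) → U^D_{H,k}`. -/
def PiD {d : ℕ} (kind : MeshKind) (Ω : Set (Sp d)) (T : Finset (Finset (Sp d))) (β : Sp d → ℝ)
    (k : ℕ) (u : Sp d → ℝ) : Sp d → ℝ :=
  Classical.epsilon fun v => v ∈ UD kind Ω T k ∧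
    ∀ w ∈ UD kind Ω T k, bform Ω β v w = bform Ω β u w

/-- The averaging operator `Π_H^av : U^D_{H,1} → U_H`. -/
def PiAv {d : ℕ} (kind : MeshKind) (Ω : Set (Sp d)) (T : Finset (Finset (Sp d))) (β : Sp d → ℝ)
    (u : Sp d → ℝ) : Sp d → ℝ :=
  Classical.epsilon fun v => v ∈ UH kind Ω T ∧
    ∀ w ∈ UH kind Ω T, bH kind T β v w = bH kind T β u w

/-- `Π_H = Π_H^av ∘ Π^D_{H,1}`. -/
def PiH {d : ℕ} (kind : MeshKind) (Ω : Set (Sp d)) (T : Finset (Finset (Sp d))) (β : Sp d → ℝ)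
    (u : Sp d → ℝ) : Sp d → ℝ :=
  PiAv kind Ω T β (PiD kind Ω T β 1 u)

/-- The consistency error `r_H(u,w) = b(u,w) - b_H'(Π_H u, Π_H w)`. -/
def rH {d : ℕ} (kind : MeshKind) (Ω : Set (Sp d)) (T : Finset (Finset (Sp d))) (β : Sp d → ℝ)
    (u w : Sp d → ℝ) : ℝ :=
  bform Ω β u w - bH kind T β (PiH kind Ω T β u) (PiH kind Ω T β w)

end MassLump

end

open MassLump

noncomputable section

namespace MassLump

open Filter Topology

/-! ### Weak gradients and the vector space H¹₀. -/

section

variable {d : ℕ} {Ω : Set (Sp d)}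

/-! Write p_i for the b-projections of u_1 = u, u_2 = w onto the discontinuous space, and a_i for
the b'-projections of p_i onto U_H. Orthogonality makes both projection steps quadratic in the
error: b(u_1,u_2) - b(p_1,p_2) = b(u_1-p_1, u_2-p_2), and likewise b'(p_1,p_2) - b'(a_1,a_2) =
b'(p_1-a_1, p_2-a_2). The quadrature error is quadratic as well: vertex interpolation is exact on
products with piecewise constants, so b and b' agree as soon as one argument is constant on each
element, whence (b-b')(p_1,p_2) = (b-b')(p_1-c_1, p_2-c_2) for arbitrary piecewise constants c_i.
Every term is then a product of two errors of order H, and β enters only through its bounds. This is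
`consistency_error_le`, pure algebra of semidefinite forms; the forms are only semidefinite because
elements of the spaces are functions, not classes modulo null sets.

Three estimates feed it. First, b' ≤ K b on the discontinuous space, because a vertex value of a
polynomial is controlled by its L² mean (`exists_vertex_bound`, `IsSetting.bH_self_le`). Second,
piecewise averages approximate to order H by the Poincaré inequality on convex sets
(`poincare_convex`). Third, U_H itself approximates H¹₀ to order H (`quasi_error`): a
quasi-interpolant takes as nodal values averages over balls of radius H, and zero at vertices whose
nodal function is nonzero somewhere outside Ω.

The third estimate carries the geometry. The quasi-interpolant must lie in H¹₀, which holds because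
it is Lipschitz and vanishes outside Ω (`memH10_of_lipschitz`). At a vertex where the value is set
to zero, the mean of a test function must be small; a boundary facet nearby contains a flat disc of
radius comparable to H outside Ω (`IsMesh.exists_exterior_disc`), and a Friedrichs inequality on
balls around that disc (`friedrichs_disc`) gives the bound. All is proved for test functions first
and passes to H¹₀ by density. -/

lemma integrable_mul_of_memLp {α : Type*} [MeasurableSpace α] {μ : Measure α} {f g : α → ℝ}
    (hf : MemLp f 2 μ) (hg : MemLp g 2 μ) : Integrable (fun x => f x * g x) μ :=
  hf.integrable_mul hg

lemma gradient_apply (f : Sp d → ℝ) (x : Sp d) (i : Fin d) :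
    gradient f x i = fderiv ℝ f x (EuclideanSpace.single i 1) := by
  have h : inner ℝ (gradient f x) (EuclideanSpace.single i (1 : ℝ))
      = fderiv ℝ f x (EuclideanSpace.single i 1) := by
    simp [gradient]
  rw [← h, EuclideanSpace.inner_single_right]
  simp

lemma norm_gradient (f : Sp d → ℝ) (x : Sp d) : ‖gradient f x‖ = ‖fderiv ℝ f x‖ := by
  simp [gradient]

lemma norm_gradient_sub (f g : Sp d → ℝ) (x : Sp d) :
    ‖gradient f x - gradient g x‖ = ‖fderiv ℝ f x - fderiv ℝ g x‖ := by
  simp only [gradient, ← map_sub, LinearIsometryEquiv.norm_map]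

lemma measurable_gradient (f : Sp d → ℝ) : Measurable (gradient f) :=
  (InnerProductSpace.toDual ℝ (Sp d)).symm.continuous.measurable.comp (measurable_fderiv ℝ f)

lemma continuous_gradient {f : Sp d → ℝ} (hf : ContDiff ℝ 1 f) : Continuous (gradient f) :=
  (InnerProductSpace.toDual ℝ (Sp d)).symm.continuous.comp (hf.continuous_fderiv one_ne_zero)

lemma IsTestFun.contDiff_one {φ : Sp d → ℝ} (h : IsTestFun Ω φ) : ContDiff ℝ 1 φ :=
  h.1.of_le (by exact_mod_cast le_top)

lemma IsTestFun.eq_zero {φ : Sp d → ℝ} (h : IsTestFun Ω φ) {x : Sp d} (hx : x ∉ Ω) : φ x = 0 :=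
  image_eq_zero_of_notMem_tsupport fun hx' => hx (h.2.2 hx')

lemma IsTestFun.fderiv_eq_zero {φ : Sp d → ℝ} (h : IsTestFun Ω φ) {x : Sp d} (hx : x ∉ Ω) :
    fderiv ℝ φ x = 0 :=
  image_eq_zero_of_notMem_tsupport fun hx' => hx (h.2.2 (tsupport_fderiv_subset ℝ hx'))

lemma IsTestFun.gradient_eq_zero {φ : Sp d → ℝ} (h : IsTestFun Ω φ) {x : Sp d} (hx : x ∉ Ω) :
    gradient φ x = 0 := by
  simp [gradient, h.fderiv_eq_zero hx]

lemma IsTestFun.hasCompactSupport_gradient {φ : Sp d → ℝ} (h : IsTestFun Ω φ) :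
    HasCompactSupport (gradient φ) := by
  have : HasCompactSupport (fderiv ℝ φ) := h.2.1.fderiv ℝ
  exact this.comp_left (g := (InnerProductSpace.toDual ℝ (Sp d)).symm) (map_zero _)

lemma IsTestFun.memLp {φ : Sp d → ℝ} (h : IsTestFun Ω φ) (μ : Measure (Sp d))
    [IsFiniteMeasureOnCompacts μ] : MemLp φ 2 μ :=
  h.1.continuous.memLp_of_hasCompactSupport h.2.1

lemma IsTestFun.memLp_gradient {φ : Sp d → ℝ} (h : IsTestFun Ω φ) (μ : Measure (Sp d))
    [IsFiniteMeasureOnCompacts μ] : MemLp (gradient φ) 2 μ :=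
  (continuous_gradient h.contDiff_one).memLp_of_hasCompactSupport h.hasCompactSupport_gradient

lemma IsTestFun.memLp_fderiv {φ : Sp d → ℝ} (h : IsTestFun Ω φ) (μ : Measure (Sp d))
    [IsFiniteMeasureOnCompacts μ] (y : Sp d) : MemLp (fun x => fderiv ℝ φ x y) 2 μ :=
  ((h.contDiff_one.continuous_fderiv one_ne_zero).clm_apply
    continuous_const).memLp_of_hasCompactSupport (h.2.1.fderiv_apply ℝ y)

lemma memLp_coord {μ : Measure (Sp d)} {G : Sp d → Sp d} (hG : MemLp G 2 μ) (i : Fin d) :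
    MemLp (fun x => G x i) 2 μ :=
  hG.of_le ((EuclideanSpace.proj (𝕜 := ℝ) i).continuous.comp_aestronglyMeasurable hG.1)
    (Eventually.of_forall fun x => PiLp.norm_apply_le (G x) i)

/-- The fundamental lemma of the calculus of variations, applied to each component of the
difference. It ties the arbitrary choice in `weakGrad` to any gradient computed by hand. -/
lemma HasWeakGrad.ae_unique (hΩ : IsOpen Ω) {u : Sp d → ℝ} {G G' : Sp d → Sp d}
    (h : HasWeakGrad Ω u G) (h' : HasWeakGrad Ω u G') : G =ᵐ[volume.restrict Ω] G' := by
  have key : ∀ i : Fin d, ∀ᵐ x ∂(volume.restrict Ω), G x i - G' x i = 0 := by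
    intro i
    have hm : MemLp (fun x => G x i - G' x i) 2 (volume.restrict Ω) :=
      (memLp_coord h.1 i).sub (memLp_coord h'.1 i)
    rw [ae_restrict_iff' hΩ.measurableSet]
    refine hΩ.ae_eq_zero_of_integral_contDiff_smul_eq_zero
      (locallyIntegrableOn_of_locallyIntegrable_restrict (hm.locallyIntegrable (by norm_num))) ?_
    intro φ h1 h2 h3
    have ht : IsTestFun Ω φ := ⟨h1, h2, h3⟩
    have e1 := h.2 φ ht i
    have e2 := h'.2 φ ht i
    rw [← setIntegral_eq_integral_of_forall_compl_eq_zero (s := Ω)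
      (fun x hx => by simp [ht.eq_zero hx])]
    have i1 := integrable_mul_of_memLp (memLp_coord h.1 i) (ht.memLp _)
    have i2 := integrable_mul_of_memLp (memLp_coord h'.1 i) (ht.memLp _)
    have : ∫ x in Ω, φ x • (G x i - G' x i) = (∫ x in Ω, G x i * φ x) - ∫ x in Ω, G' x i * φ x := by
      rw [← integral_sub i1 i2]
      congr 1; ext x; simp; ring
    rw [this]
    linarith
  filter_upwards [ae_all_iff.2 key] with x hx
  ext i
  linarith [hx i]

lemma MemH1.hasWeakGrad {u : Sp d → ℝ} (h : MemH1 Ω u) : HasWeakGrad Ω u (weakGrad Ω u) :=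
  Classical.epsilon_spec h.2

lemma HasWeakGrad.add {u v : Sp d → ℝ} {F G : Sp d → Sp d} (hu : MemLp u 2 (volume.restrict Ω))
    (hv : MemLp v 2 (volume.restrict Ω)) (hF : HasWeakGrad Ω u F) (hG : HasWeakGrad Ω v G) :
    HasWeakGrad Ω (u + v) (F + G) := by
  refine ⟨hF.1.add hG.1, fun φ hφ i => ?_⟩
  have e1 := hF.2 φ hφ i
  have e2 := hG.2 φ hφ i
  have : ∫ x in Ω, (F + G) x i * φ x = (∫ x in Ω, F x i * φ x) + ∫ x in Ω, G x i * φ x := by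
    rw [← integral_add (integrable_mul_of_memLp (memLp_coord hF.1 i) (hφ.memLp _))
      (integrable_mul_of_memLp (memLp_coord hG.1 i) (hφ.memLp _))]
    congr 1; ext x; simp; ring
  rw [this, neg_add, ← e1, ← e2, ← integral_add
    (integrable_mul_of_memLp hu (hφ.memLp_fderiv _ _)) (integrable_mul_of_memLp hv (hφ.memLp_fderiv _ _))]
  congr 1; ext x; simp; ring

lemma HasWeakGrad.smul {u : Sp d → ℝ} {F : Sp d → Sp d} (c : ℝ) (hF : HasWeakGrad Ω u F) :
    HasWeakGrad Ω (c • u) (c • F) := by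
  refine ⟨hF.1.const_smul c, fun φ hφ i => ?_⟩
  have e1 := hF.2 φ hφ i
  simp only [Pi.smul_apply, smul_eq_mul, PiLp.smul_apply, mul_assoc, integral_const_mul, e1]
  ring

/-- The squared norm of `L² × L²`. -/
def prodSq (Ω : Set (Sp d)) (f : Sp d → ℝ) (F : Sp d → Sp d) : ℝ :=
  (∫ x in Ω, f x ^ 2) + ∫ x in Ω, ‖F x‖ ^ 2

lemma prodSq_add_le {f g : Sp d → ℝ} {F G : Sp d → Sp d} (hf : MemLp f 2 (volume.restrict Ω))
    (hg : MemLp g 2 (volume.restrict Ω)) (hF : MemLp F 2 (volume.restrict Ω))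
    (hG : MemLp G 2 (volume.restrict Ω)) :
    prodSq Ω (f + g) (F + G) ≤ 2 * prodSq Ω f F + 2 * prodSq Ω g G := by
  have a1 : ∫ x in Ω, (f + g) x ^ 2 ≤ 2 * (∫ x in Ω, f x ^ 2) + 2 * ∫ x in Ω, g x ^ 2 := by
    rw [← integral_const_mul, ← integral_const_mul, ← integral_add
      (hf.integrable_sq.const_mul 2) (hg.integrable_sq.const_mul 2)]
    refine integral_mono (hf.add hg).integrable_sq
      ((hf.integrable_sq.const_mul 2).add (hg.integrable_sq.const_mul 2)) fun x => ?_
    simp only [Pi.add_apply]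
    nlinarith [sq_nonneg (f x - g x)]
  have a2 : ∫ x in Ω, ‖(F + G) x‖ ^ 2 ≤ 2 * (∫ x in Ω, ‖F x‖ ^ 2) + 2 * ∫ x in Ω, ‖G x‖ ^ 2 := by
    have i1 : Integrable (fun x => ‖F x‖ ^ 2) (volume.restrict Ω) := hF.norm.integrable_sq
    have i2 : Integrable (fun x => ‖G x‖ ^ 2) (volume.restrict Ω) := hG.norm.integrable_sq
    have i3 : Integrable (fun x => ‖(F + G) x‖ ^ 2) (volume.restrict Ω) :=
      (hF.add hG).norm.integrable_sq
    rw [← integral_const_mul, ← integral_const_mul, ← integral_add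
      (i1.const_mul 2) (i2.const_mul 2)]
    refine integral_mono i3 ((i1.const_mul 2).add (i2.const_mul 2)) fun x => ?_
    have := norm_add_le (F x) (G x)
    simp only [Pi.add_apply]
    nlinarith [sq_nonneg (‖F x‖ - ‖G x‖), norm_nonneg (F x + G x)]
  unfold prodSq
  linarith

lemma prodSq_smul (c : ℝ) (f : Sp d → ℝ) (F : Sp d → Sp d) :
    prodSq Ω (c • f) (c • F) = c ^ 2 * prodSq Ω f F := by
  simp [prodSq, mul_pow, norm_smul, integral_const_mul, mul_add]

lemma prodSq_congr {f : Sp d → ℝ} {F G : Sp d → Sp d} (h : F =ᵐ[volume.restrict Ω] G) :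
    prodSq Ω f F = prodSq Ω f G := by
  unfold prodSq
  congr 1
  exact integral_congr_ae (h.mono fun x hx => by simp [hx])

/-- By uniqueness, density may be tested with any convenient weak gradient instead of the chosen
one. -/
lemma memH10_of_hasWeakGrad (hΩ : IsOpen Ω) {u : Sp d → ℝ} {G : Sp d → Sp d}
    (hu : MemLp u 2 (volume.restrict Ω)) (hG : HasWeakGrad Ω u G)
    (h : ∀ ε : ℝ, 0 < ε → ∃ φ, IsTestFun Ω φ ∧ prodSq Ω (u - φ) (G - gradient φ) < ε) :
    MemH10 Ω u := by
  have h1 : MemH1 Ω u := ⟨hu, G, hG⟩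
  refine ⟨h1, fun ε hε => ?_⟩
  obtain ⟨φ, hφ, hlt⟩ := h ε hε
  refine ⟨φ, hφ, ?_⟩
  have : prodSq Ω (u - φ) (weakGrad Ω u - gradient φ) < ε := by
    rwa [prodSq_congr (G := G - gradient φ)]
    exact (h1.hasWeakGrad.ae_unique hΩ hG).mono fun x hx => by simp [hx]
  exact this

lemma IsTestFun.add {φ ψ : Sp d → ℝ} (h : IsTestFun Ω φ) (h' : IsTestFun Ω ψ) :
    IsTestFun Ω (φ + ψ) :=
  ⟨h.1.add h'.1, h.2.1.add h'.2.1, (tsupport_add φ ψ).trans (Set.union_subset h.2.2 h'.2.2)⟩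

lemma IsTestFun.smul {φ : Sp d → ℝ} (c : ℝ) (h : IsTestFun Ω φ) : IsTestFun Ω (c • φ) :=
  ⟨h.1.const_smul c, h.2.1.smul_left (f := fun _ => c),
    (tsupport_smul_subset_right (fun _ => c) φ).trans h.2.2⟩

lemma isTestFun_zero : IsTestFun Ω (0 : Sp d → ℝ) :=
  ⟨contDiff_const, HasCompactSupport.zero, by simp [tsupport]⟩

lemma gradient_add' {φ ψ : Sp d → ℝ} (h : ContDiff ℝ 1 φ) (h' : ContDiff ℝ 1 ψ) :
    gradient (φ + ψ) = gradient φ + gradient ψ := by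
  ext1 x
  simp only [gradient, Pi.add_apply]
  rw [fderiv_add (h.differentiable one_ne_zero x) (h'.differentiable one_ne_zero x), map_add]

lemma gradient_smul' (c : ℝ) {φ : Sp d → ℝ} (h : ContDiff ℝ 1 φ) :
    gradient (c • φ) = c • gradient φ := by
  ext1 x
  simp only [gradient, Pi.smul_apply]
  rw [fderiv_const_smul (h.differentiable one_ne_zero x)]
  simp

/-- `H¹₀(Ω)` as a space of functions. -/
def H10 (hΩ : IsOpen Ω) : Submodule ℝ (Sp d → ℝ) where
  carrier := {u | MemH10 Ω u}
  zero_mem' := by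
    refine memH10_of_hasWeakGrad hΩ (G := 0) MemLp.zero ⟨MemLp.zero, fun φ _ i => by simp⟩ ?_
    intro ε hε
    refine ⟨0, isTestFun_zero, ?_⟩
    have : gradient (0 : Sp d → ℝ) = 0 := by
      ext1 x; simp [gradient]
    simpa [prodSq, this] using hε
  add_mem' := by
    intro u v hu hv
    refine memH10_of_hasWeakGrad hΩ (hu.1.1.add hv.1.1)
      (hu.1.hasWeakGrad.add hu.1.1 hv.1.1 hv.1.hasWeakGrad) ?_
    intro ε hε
    obtain ⟨φ, hφ, h1⟩ := hu.2 (ε / 4) (by positivity)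
    obtain ⟨ψ, hψ, h2⟩ := hv.2 (ε / 4) (by positivity)
    refine ⟨φ + ψ, hφ.add hψ, ?_⟩
    rw [gradient_add' hφ.contDiff_one hψ.contDiff_one, add_sub_add_comm, add_sub_add_comm]
    refine (prodSq_add_le (hu.1.1.sub (hφ.memLp _)) (hv.1.1.sub (hψ.memLp _))
      (hu.1.hasWeakGrad.1.sub (hφ.memLp_gradient _))
      (hv.1.hasWeakGrad.1.sub (hψ.memLp_gradient _))).trans_lt ?_
    have h1' : prodSq Ω (u - φ) (weakGrad Ω u - gradient φ) < ε / 4 := h1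
    have h2' : prodSq Ω (v - ψ) (weakGrad Ω v - gradient ψ) < ε / 4 := h2
    linarith
  smul_mem' := by
    intro c u hu
    refine memH10_of_hasWeakGrad hΩ (hu.1.1.const_smul c) (hu.1.hasWeakGrad.smul c) ?_
    intro ε hε
    obtain ⟨φ, hφ, h1⟩ := hu.2 (ε / (c ^ 2 + 1)) (by positivity)
    refine ⟨c • φ, hφ.smul c, ?_⟩
    rw [gradient_smul' c hφ.contDiff_one, ← smul_sub, ← smul_sub, prodSq_smul]
    have h1' : prodSq Ω (u - φ) (weakGrad Ω u - gradient φ) < ε / (c ^ 2 + 1) := h1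
    rw [lt_div_iff₀ (by positivity)] at h1'
    have h0 : 0 ≤ prodSq Ω (u - φ) (weakGrad Ω u - gradient φ) := by unfold prodSq; positivity
    nlinarith

end

/-! ### Lipschitz functions that vanish outside Ω belong to H¹₀. -/

section

variable {d : ℕ} {Ω : Set (Sp d)}

lemma norm_gradient_le_of_lipschitz {v : Sp d → ℝ} {L : NNReal} (hv : LipschitzWith L v)
    (x : Sp d) : ‖gradient v x‖ ≤ L := by
  rw [norm_gradient]
  exact norm_fderiv_le_of_lipschitz ℝ hv

lemma isFiniteMeasure_restrict (hb : Bornology.IsBounded Ω) :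
    IsFiniteMeasure (volume.restrict Ω) :=
  ⟨by simpa using hb.measure_lt_top⟩

lemma memLp_gradient_of_lipschitz (hb : Bornology.IsBounded Ω) {v : Sp d → ℝ} {L : NNReal}
    (hv : LipschitzWith L v) : MemLp (gradient v) 2 (volume.restrict Ω) := by
  have := isFiniteMeasure_restrict hb
  exact MemLp.of_bound (measurable_gradient v).aestronglyMeasurable L
    (Eventually.of_forall fun x => norm_gradient_le_of_lipschitz hv x)

lemma memLp_of_lipschitz (hΩ : IsOpen Ω) (hb : Bornology.IsBounded Ω) {v : Sp d → ℝ} {L : NNReal}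
    (hv : LipschitzWith L v) : MemLp v 2 (volume.restrict Ω) := by
  have := isFiniteMeasure_restrict hb
  obtain ⟨R, hR⟩ := hb.subset_closedBall 0
  refine MemLp.of_bound hv.continuous.aestronglyMeasurable (|v 0| + L * R) ?_
  refine ae_restrict_of_forall_mem hΩ.measurableSet (fun x hx => ?_)
  have h1 := hv.dist_le_mul x 0
  have h2 : dist x 0 ≤ R := hR hx
  rw [Real.dist_eq] at h1
  have h3 := abs_sub_abs_le_abs_sub (v x) (v 0)
  have h4 : (L : ℝ) * dist x 0 ≤ L * R := by gcongr
  rw [Real.norm_eq_abs]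
  linarith

/-- Rademacher's theorem together with integration by parts for line derivatives of Lipschitz
functions. The test function vanishes outside Ω, so the integrals over Ω are integrals over the
whole space. -/
lemma hasWeakGrad_of_lipschitz (hb : Bornology.IsBounded Ω) {v : Sp d → ℝ} {L : NNReal}
    (hv : LipschitzWith L v) : HasWeakGrad Ω v (gradient v) := by
  refine ⟨memLp_gradient_of_lipschitz hb hv, fun φ hφ i => ?_⟩
  rw [setIntegral_eq_integral_of_forall_compl_eq_zero (fun x hx => by
      simp [hφ.fderiv_eq_zero hx]),
    setIntegral_eq_integral_of_forall_compl_eq_zero (fun x hx => by simp [hφ.eq_zero hx])]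
  obtain ⟨C, hC⟩ := hφ.contDiff_one.lipschitzWith_of_hasCompactSupport hφ.2.1 one_ne_zero
  have h := hv.integral_lineDeriv_mul_eq (μ := volume) hC hφ.2.1 (EuclideanSpace.single i (1 : ℝ))
  have e1 : ∫ x, gradient v x i * φ x
      = ∫ x, lineDeriv ℝ v x (EuclideanSpace.single i (1 : ℝ)) * φ x := by
    refine integral_congr_ae ?_
    filter_upwards [hv.ae_differentiableAt (μ := volume)] with x hx
    rw [gradient_apply, hx.lineDeriv_eq_fderiv]
  rw [e1, h, ← integral_neg]
  congr 1; ext x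
  rw [(hφ.contDiff_one.differentiable one_ne_zero x).lineDeriv_eq_fderiv]
  simp; ring

lemma tendsto_setIntegral_sq_of_bounded (hb : Bornology.IsBounded Ω) {E : Type*}
    [NormedAddCommGroup E] {F : ℕ → Sp d → E} {M : ℝ}
    (hF : ∀ n, AEStronglyMeasurable (F n) (volume.restrict Ω))
    (hM : ∀ᶠ n in atTop, ∀ᵐ x ∂(volume.restrict Ω), ‖F n x‖ ≤ M)
    (h0 : ∀ᵐ x ∂(volume.restrict Ω), Tendsto (fun n => F n x) atTop (𝓝 0)) :
    Tendsto (fun n => ∫ x in Ω, ‖F n x‖ ^ 2) atTop (𝓝 0) := by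
  have := isFiniteMeasure_restrict hb
  have : (0 : ℝ) = ∫ x in Ω, (0 : ℝ) := by simp
  rw [this]
  refine tendsto_integral_filter_of_dominated_convergence (fun _ => M ^ 2) ?_ ?_
    (integrable_const _) ?_
  · exact Eventually.of_forall fun n => (hF n).norm.pow 2
  · filter_upwards [hM] with n hn
    filter_upwards [hn] with x hx
    rw [norm_pow, norm_norm]
    gcongr
  · filter_upwards [h0] with x hx
    simpa using hx.norm.pow 2

/-- A Lipschitz function with compact support in `Ω` is approximated by test functions. -/
lemma exists_testFun_of_lipschitz_of_compact (hΩ : IsOpen Ω) (hb : Bornology.IsBounded Ω)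
    {w : Sp d → ℝ} {L : NNReal} (hw : LipschitzWith L w) (hc : HasCompactSupport w)
    (hs : tsupport w ⊆ Ω) {ε : ℝ} (hε : 0 < ε) :
    ∃ φ, IsTestFun Ω φ ∧ prodSq Ω (w - φ) (gradient w - gradient φ) < ε := by
  obtain ⟨δ, hδ, hδΩ⟩ := hc.isCompact.exists_cthickening_subset_open hΩ hs
  let ρ : ℕ → ContDiffBump (0 : Sp d) := fun n =>
    ⟨1 / (2 * ((n : ℝ) + 1)), 1 / ((n : ℝ) + 1), by positivity, by
      apply one_div_lt_one_div_of_lt <;> linarith [n.cast_nonneg (α := ℝ)]⟩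
  have hρ : Tendsto (fun n => (ρ n).rOut) atTop (𝓝 0) := tendsto_one_div_add_atTop_nhds_zero_nat
  -- Comparable inner and outer radii are what the Lebesgue differentiation theorem for these
  -- mollifiers asks for; it yields a.e. convergence of the mollified derivative.
  have hρ2 : ∀ n, (ρ n).rOut ≤ 2 * (ρ n).rIn := fun n => by
    change 1 / ((n : ℝ) + 1) ≤ 2 * (1 / (2 * ((n : ℝ) + 1)))
    apply le_of_eq; field_simp
  let φ : ℕ → Sp d → ℝ := fun n =>
    convolution ((ρ n).normed volume) w (ContinuousLinearMap.lsmul ℝ ℝ) volume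
  let Φ : ℕ → Sp d → (Sp d →L[ℝ] ℝ) := fun n =>
    convolution ((ρ n).normed volume) (fderiv ℝ w) (ContinuousLinearMap.lsmul ℝ ℝ) volume
  have hwli : LocallyIntegrable w volume := hw.continuous.locallyIntegrable
  have hdb : ∀ x, ‖fderiv ℝ w x‖ ≤ L := fun x => norm_fderiv_le_of_lipschitz ℝ hw
  have hdm : AEStronglyMeasurable (fderiv ℝ w) volume :=
    (measurable_fderiv ℝ w).aestronglyMeasurable
  have hdli : LocallyIntegrable (fderiv ℝ w) volume :=
    (memLp_top_of_bound hdm L (Eventually.of_forall hdb)).locallyIntegrable le_top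
  have hρint : ∀ n, Integrable ((ρ n).normed volume) volume := fun n =>
    (ρ n).continuous_normed.integrable_of_hasCompactSupport (ρ n).hasCompactSupport_normed
  have hsm : ∀ n, ContDiff ℝ (⊤ : ℕ∞) (φ n) := fun n =>
    (ρ n).hasCompactSupport_normed.contDiff_convolution_left _ (ρ n).contDiff_normed hwli
  -- support
  have htest : ∀ᶠ n in atTop, IsTestFun Ω (φ n) := by
    filter_upwards [(tendsto_order.1 hρ).2 δ hδ] with n hn
    refine ⟨hsm n, (ρ n).hasCompactSupport_normed.convolution _ hc, ?_⟩
    refine Set.Subset.trans ?_ hδΩ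
    refine closure_minimal ?_ Metric.isClosed_cthickening
    intro x hx
    obtain ⟨a, ha, b, hb', rfl⟩ := support_convolution_subset _ hx
    rw [(ρ n).support_normed_eq, mem_ball_zero_iff] at ha
    refine Metric.mem_cthickening_of_dist_le _ b _ _ (subset_tsupport _ hb') ?_
    simpa using (ha.trans hn).le
  -- derivative
  have hder : ∀ n x, HasFDerivAt (φ n) (Φ n x) x := by
    intro n x
    have hdiff : ∀ᵐ t : Sp d, DifferentiableAt ℝ w (x - t) := by
      have := hw.ae_differentiableAt (μ := (volume : Measure (Sp d)))
      exact (quasiMeasurePreserving_sub_left volume x).ae this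
    -- Differentiation under the integral: for fixed `x`, `w` is differentiable at `x - t` for
    -- almost every `t`, and its Lipschitz constant dominates the difference quotients.
    refine (hasFDerivAt_integral_of_dominated_loc_of_lip (𝕜 := ℝ) (μ := (volume : Measure (Sp d)))
      (F := fun x t => (ContinuousLinearMap.lsmul ℝ ℝ) ((ρ n).normed volume t) (w (x - t)))
      (F' := fun t => (ContinuousLinearMap.lsmul ℝ ℝ) ((ρ n).normed volume t) (fderiv ℝ w (x - t)))
      (bound := fun t => (ρ n).normed volume t * L)
      (s := Set.univ) univ_mem ?_ ?_ ?_ ?_ ?_ ?_).2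
    · refine Eventually.of_forall fun y => ?_
      exact (((ρ n).continuous_normed).smul
        (hw.continuous.comp (continuous_const.sub continuous_id))).aestronglyMeasurable
    · refine Continuous.integrable_of_hasCompactSupport (((ρ n).continuous_normed).smul
        (hw.continuous.comp (continuous_const.sub continuous_id))) ?_
      exact (ρ n).hasCompactSupport_normed.smul_right
    · refine ((ρ n).continuous_normed.aestronglyMeasurable).smul ?_
      exact ((measurable_fderiv ℝ w).comp (measurable_const.sub measurable_id)).aestronglyMeasurable
    · refine Eventually.of_forall fun t => ?_
      refine LipschitzWith.lipschitzOnWith (LipschitzWith.of_dist_le_mul fun y z => ?_)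
      have h1 := hw.dist_le_mul (y - t) (z - t)
      rw [dist_sub_right] at h1
      have h0 : 0 ≤ (ρ n).normed volume t := (ρ n).nonneg_normed t
      simp only [ContinuousLinearMap.lsmul_apply, dist_smul₀, Real.norm_eq_abs, abs_of_nonneg h0,
        Real.coe_nnabs, abs_mul, NNReal.abs_eq, mul_assoc]
      gcongr
    · exact (hρint n).mul_const _
    · filter_upwards [hdiff] with t ht
      have h1 : HasFDerivAt (fun y => w (y - t)) (fderiv ℝ w (x - t)) x := by
        have := HasFDerivAt.comp x (g := w) (f := fun y => y - t) ht.hasFDerivAt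
          ((hasFDerivAt_id x).sub_const t)
        rwa [ContinuousLinearMap.comp_id] at this
      exact h1.const_smul ((ρ n).normed volume t)
  have hval : ∀ n x, ‖(w - φ n) x‖ ≤ L * (ρ n).rOut := by
    intro n x
    rw [Pi.sub_apply, ← dist_eq_norm, dist_comm]
    refine (ρ n).dist_normed_convolution_le hw.continuous.aestronglyMeasurable fun y hy => ?_
    refine (hw.dist_le_mul y x).trans ?_
    have : dist y x ≤ (ρ n).rOut := (Metric.mem_ball.1 hy).le
    gcongr
  have hΦb : ∀ n x, ‖Φ n x‖ ≤ L := by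
    intro n x
    have : ‖Φ n x‖ ≤ ∫ t, (ρ n).normed volume t * L := by
      refine norm_integral_le_of_norm_le ((hρint n).mul_const _) (Eventually.of_forall fun t => ?_)
      have h0 : 0 ≤ (ρ n).normed volume t := (ρ n).nonneg_normed t
      rw [ContinuousLinearMap.lsmul_apply, norm_smul, Real.norm_eq_abs, abs_of_nonneg h0]
      exact mul_le_mul_of_nonneg_left (hdb _) h0
    rwa [integral_mul_const, (ρ n).integral_normed, one_mul] at this
  have hae := ContDiffBump.ae_convolution_tendsto_right_of_locallyIntegrable hρ
    (Eventually.of_forall hρ2) hdli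
  have hrle : ∀ n, (ρ n).rOut ≤ 1 := fun n => by
    change 1 / ((n : ℝ) + 1) ≤ 1
    rw [div_le_one (by positivity)]; linarith [n.cast_nonneg (α := ℝ)]
  have t1 : Tendsto (fun n => ∫ x in Ω, ‖(w - φ n) x‖ ^ 2) atTop (𝓝 0) := by
    refine tendsto_setIntegral_sq_of_bounded hb (M := L)
      (fun n => (hw.continuous.sub (hsm n).continuous).aestronglyMeasurable)
      (Eventually.of_forall fun n => Eventually.of_forall fun x => ?_)
      (Eventually.of_forall fun x => ?_)
    · exact (hval n x).trans (mul_le_of_le_one_right L.2 (hrle n))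
    · refine squeeze_zero_norm (fun n => hval n x) ?_
      simpa using hρ.const_mul (L : ℝ)
  have t2 : Tendsto (fun n => ∫ x in Ω, ‖gradient w x - gradient (φ n) x‖ ^ 2) atTop (𝓝 0) := by
    refine tendsto_setIntegral_sq_of_bounded hb (M := L + L)
      (fun n => ((measurable_gradient w).sub (measurable_gradient _)).aestronglyMeasurable)
      (Eventually.of_forall fun n => Eventually.of_forall fun x => ?_)
      (ae_restrict_of_ae ?_)
    · rw [norm_gradient_sub, (hder n x).fderiv]
      exact (norm_sub_le _ _).trans (add_le_add (hdb x) (hΦb n x))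
    · filter_upwards [hae] with x hx
      rw [tendsto_zero_iff_norm_tendsto_zero]
      simp only [norm_gradient_sub, (hder _ x).fderiv]
      rw [← tendsto_zero_iff_norm_tendsto_zero]
      simpa using (tendsto_const_nhds (x := fderiv ℝ w x)).sub hx
  have t3 := t1.add t2
  rw [add_zero] at t3
  obtain ⟨n, hn1, hn2⟩ := (htest.and ((tendsto_order.1 t3).2 ε hε)).exists
  refine ⟨φ n, hn1, ?_⟩
  simpa [prodSq, Real.norm_eq_abs, sq_abs] using hn2

/-- A smooth cut-off of the identity of the real line. -/
lemma exists_cutoff_id : ∃ (ψ : ℝ → ℝ) (M : NNReal), ContDiff ℝ 1 ψ ∧ LipschitzWith M ψ ∧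
    (∀ s, |ψ s| ≤ M) ∧ (∀ s, |s| ≤ 1 → ψ s = s) ∧ HasCompactSupport ψ := by
  let χ : ContDiffBump (0 : ℝ) := ⟨1, 2, one_pos, one_lt_two⟩
  have h1 : ContDiff ℝ 1 (fun s => s * χ s) := contDiff_id.mul χ.contDiff
  have h2 : HasCompactSupport (fun s => s * χ s) := χ.hasCompactSupport.mul_left
  obtain ⟨C, hC⟩ := h1.lipschitzWith_of_hasCompactSupport h2 one_ne_zero
  obtain ⟨K, hK⟩ := h2.exists_bound_of_continuous h1.continuous
  refine ⟨_, C + K.toNNReal, h1, hC.weaken le_self_add, fun s => ?_, fun s hs => ?_, h2⟩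
  · refine (hK s).trans ?_
    push_cast
    linarith [Real.le_coe_toNNReal K, C.2]
  · have : χ s = 1 := χ.one_of_mem_closedBall (by simpa [χ] using hs)
    simp [this]

/-- A Lipschitz function on the whole space that vanishes outside a bounded open set `Ω`
belongs to `H¹₀(Ω)`. -/
theorem memH10_of_lipschitz (hΩ : IsOpen Ω) (hb : Bornology.IsBounded Ω)
    {v : Sp d → ℝ} {L : NNReal} (hv : LipschitzWith L v) (h0 : ∀ x ∉ Ω, v x = 0) :
    MemH10 Ω v := by
  obtain ⟨ψ, M, hψ, hψL, hψM, hψ1, hψc⟩ := exists_cutoff_id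
  let κ : ℕ → ℝ := fun n => (n : ℝ) + 1
  have hκ : ∀ n, 0 < κ n := fun n => by positivity
  have hκt : Tendsto κ atTop atTop := tendsto_natCast_atTop_atTop.atTop_add tendsto_const_nhds
  -- A smooth truncation: `θ n` equals `v` where |v| ≤ 1/κ n and is everywhere at most M/κ n. Hence
  -- `v - θ n` is supported where |v| ≥ 1/κ n, a compact subset of Ω, and `θ n` is the part to be
  -- shown small in H¹.
  let θ : ℕ → Sp d → ℝ := fun n x => (κ n)⁻¹ * ψ (κ n * v x)
  have hθL : ∀ n, LipschitzWith (M * L) (θ n) := by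
    intro n
    refine LipschitzWith.of_dist_le_mul fun x y => ?_
    have h1 := hψL.dist_le_mul (κ n * v x) (κ n * v y)
    have h2 := hv.dist_le_mul x y
    simp only [θ, Real.dist_eq, ← mul_sub, abs_mul, abs_of_pos (hκ n), abs_inv] at h1 ⊢
    rw [Real.dist_eq] at h2
    push_cast
    calc (κ n)⁻¹ * |ψ (κ n * v x) - ψ (κ n * v y)|
        ≤ (κ n)⁻¹ * (M * (κ n * |v x - v y|)) := by
          have := (hκ n).le
          gcongr
      _ = M * |v x - v y| := by field_simp [(hκ n).ne']
      _ ≤ M * (L * dist x y) := by gcongr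
      _ = _ := by ring
  have hθd : ∀ n x, DifferentiableAt ℝ v x →
      fderiv ℝ (θ n) x = deriv ψ (κ n * v x) • fderiv ℝ v x := by
    intro n x hx
    have hd : HasDerivAt ψ (deriv ψ (κ n * v x)) (κ n * v x) :=
      (hψ.differentiable one_ne_zero _).hasDerivAt
    have h2 : HasFDerivAt (fun y => κ n * v y) (κ n • fderiv ℝ v x) x :=
      hx.hasFDerivAt.const_mul (κ n)
    have h3 := (hd.comp_hasFDerivAt x h2).const_mul (κ n)⁻¹
    rw [show fderiv ℝ (θ n) x = _ from h3.fderiv]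
    ext y
    simp
    field_simp [(hκ n).ne']
  have hd1 : deriv ψ 0 = 1 := by
    have : ψ =ᶠ[𝓝 0] id := by
      filter_upwards [Metric.ball_mem_nhds (0 : ℝ) one_pos] with s hs
      exact hψ1 s (by simpa using (mem_ball_zero_iff.1 hs).le)
    rw [this.deriv_eq, deriv_id]
  have hdM : ∀ s, |deriv ψ s| ≤ M := fun s => by
    have := norm_deriv_le_of_lipschitz (x₀ := s) hψL
    simpa using this
  -- Consequently the gradients of `θ n` converge a.e. to the gradient of `v` restricted to the zero
  -- set of `v`.
  have hdt : ∀ t : ℝ, Tendsto (fun n => deriv ψ (κ n * t)) atTop (𝓝 (if t = 0 then 1 else 0)) := by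
    intro t
    split_ifs with ht
    · simp [ht, hd1]
    · obtain ⟨R, hR⟩ := hψc.deriv.isCompact.isBounded.subset_closedBall 0
      refine tendsto_const_nhds.congr' ?_
      have h1 : Tendsto (fun n => κ n * |t|) atTop atTop := hκt.atTop_mul_const (abs_pos.2 ht)
      filter_upwards [h1.eventually_gt_atTop R] with n hn
      refine (image_eq_zero_of_notMem_tsupport fun h => ?_).symm
      have := hR h
      rw [mem_closedBall_zero_iff, Real.norm_eq_abs, abs_mul, abs_of_pos (hκ n)] at this
      linarith
  have := isFiniteMeasure_restrict hb
  have hae : ∀ᵐ x ∂(volume.restrict Ω), DifferentiableAt ℝ v x :=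
    ae_restrict_of_ae hv.ae_differentiableAt
  have hθb : ∀ n x, ‖θ n x‖ ≤ M * (κ n)⁻¹ := fun n x => by
    rw [Real.norm_eq_abs, abs_mul, abs_of_pos (inv_pos.2 (hκ n)), mul_comm]
    exact mul_le_mul_of_nonneg_right (hψM _) (inv_pos.2 (hκ n)).le
  have hκi : Tendsto (fun n => M * (κ n)⁻¹) atTop (𝓝 0) := by
    simpa using (tendsto_inv_atTop_zero.comp hκt).const_mul (M : ℝ)
  have hκ1 : ∀ n, (κ n)⁻¹ ≤ 1 := fun n => inv_le_one_of_one_le₀ (by simp [κ])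
  have hθ0 : ∀ x, Tendsto (fun n => θ n x) atTop (𝓝 0) := fun x =>
    squeeze_zero_norm (fun n => hθb n x) hκi
  have hθ1 : ∀ n x, ‖θ n x‖ ≤ M := fun n x =>
    (hθb n x).trans (mul_le_of_le_one_right M.2 (hκ1 n))
  -- the gradient vanishes almost everywhere on the zero set
  have hzero : ∀ᵐ x ∂(volume.restrict Ω), v x = 0 → gradient v x = 0 := by
    have hmz : MeasurableSet {x | v x = 0} := hv.continuous.measurable (measurableSet_singleton 0)
    -- Passing to the limit in the weak formulation for `θ n`: the functions tend to 0, so the limit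
    -- of their gradients is a weak gradient of 0, and uniqueness makes it vanish.
    have hG : HasWeakGrad Ω (0 : Sp d → ℝ) (({x | v x = 0}).indicator (gradient v)) := by
      refine ⟨(memLp_gradient_of_lipschitz hb hv).indicator hmz, fun φ hφ i => ?_⟩
      have hφi : Integrable φ (volume.restrict Ω) := (hφ.memLp _).integrable (by norm_num)
      have hφi' : Integrable (fun x => fderiv ℝ φ x (EuclideanSpace.single i 1))
          (volume.restrict Ω) := (hφ.memLp_fderiv _ _).integrable (by norm_num)
      have l1 : Tendsto (fun n => ∫ x in Ω, gradient (θ n) x i * φ x) atTop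
          (𝓝 (∫ x in Ω, ({x | v x = 0}).indicator (gradient v) x i * φ x)) := by
        refine tendsto_integral_of_dominated_convergence (fun x => (M * L : NNReal) * ‖φ x‖) ?_
          (hφi.norm.const_mul _) ?_ ?_
        · exact fun n => (memLp_coord (memLp_gradient_of_lipschitz hb (hθL n)) i).1.mul hφi.1
        · refine fun n => Eventually.of_forall fun x => ?_
          rw [norm_mul]
          gcongr
          exact (PiLp.norm_apply_le _ i).trans (norm_gradient_le_of_lipschitz (hθL n) x)
        · filter_upwards [hae] with x hx
          refine Tendsto.mul_const _ ?_
          have := (hdt (v x)).mul_const (gradient v x i)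
          convert this using 2
          · rw [gradient_apply, hθd _ _ hx, gradient_apply]; simp
          · by_cases h : v x = 0 <;> simp [h]
      have l2 : Tendsto (fun n => ∫ x in Ω, θ n x * fderiv ℝ φ x (EuclideanSpace.single i 1)) atTop
          (𝓝 (∫ x in Ω, (0 : ℝ) * fderiv ℝ φ x (EuclideanSpace.single i 1))) := by
        refine tendsto_integral_of_dominated_convergence
          (fun x => M * ‖fderiv ℝ φ x (EuclideanSpace.single i 1)‖) ?_
          (hφi'.norm.const_mul _) ?_ ?_
        · exact fun n => (hθL n).continuous.aestronglyMeasurable.mul hφi'.1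
        · refine fun n => Eventually.of_forall fun x => ?_
          rw [norm_mul]
          gcongr
          exact hθ1 n x
        · exact Eventually.of_forall fun x => (hθ0 x).mul_const _
      have l3 := l1.neg
      have : ∀ n, ∫ x in Ω, θ n x * fderiv ℝ φ x (EuclideanSpace.single i 1)
          = - ∫ x in Ω, gradient (θ n) x i * φ x := fun n =>
        (hasWeakGrad_of_lipschitz hb (hθL n)).2 φ hφ i
      simp only [this] at l2
      exact tendsto_nhds_unique l2 l3
    have hZ : HasWeakGrad Ω (0 : Sp d → ℝ) 0 := ⟨MemLp.zero, fun φ _ i => by simp⟩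
    filter_upwards [hG.ae_unique hΩ hZ] with x hx h
    have hx' : ({x | v x = 0}).indicator (gradient v) x = gradient v x :=
      Set.indicator_of_mem (s := {x | v x = 0}) h _
    rw [← hx', hx]; rfl
  -- truncation
  refine memH10_of_hasWeakGrad hΩ (memLp_of_lipschitz hΩ hb hv) (hasWeakGrad_of_lipschitz hb hv) ?_
  intro ε hε
  have t1 : Tendsto (fun n => ∫ x in Ω, ‖θ n x‖ ^ 2) atTop (𝓝 0) :=
    tendsto_setIntegral_sq_of_bounded hb (M := M)
      (fun n => (hθL n).continuous.aestronglyMeasurable)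
      (Eventually.of_forall fun n => Eventually.of_forall fun x => hθ1 n x)
      (Eventually.of_forall hθ0)
  have t2 : Tendsto (fun n => ∫ x in Ω, ‖gradient (θ n) x‖ ^ 2) atTop (𝓝 0) := by
    refine tendsto_setIntegral_sq_of_bounded hb (M := (M * L : NNReal))
      (fun n => (measurable_gradient _).aestronglyMeasurable)
      (Eventually.of_forall fun n => Eventually.of_forall fun x =>
        norm_gradient_le_of_lipschitz (hθL n) x) ?_
    filter_upwards [hae, hzero] with x hx hx0
    have e : ∀ n, gradient (θ n) x = deriv ψ (κ n * v x) • gradient v x := fun n => by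
      simp only [gradient, hθd n x hx]; simp
    simp only [e]
    have := (hdt (v x)).smul_const (gradient v x)
    have h2 : (if v x = 0 then (1 : ℝ) else 0) • gradient v x = 0 := by
      split_ifs with h
      · rw [hx0 h, smul_zero]
      · rw [zero_smul]
    rwa [h2] at this
  have t3 := t1.add t2
  rw [add_zero] at t3
  obtain ⟨n, hn⟩ := ((tendsto_order.1 t3).2 (ε / 4) (by positivity)).exists
  have hwL : LipschitzWith (L + M * L) (v - θ n) := hv.sub (hθL n)
  have hts : tsupport (v - θ n) ⊆ {x | 1 ≤ |κ n * v x|} := by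
    refine closure_minimal (fun x hx => ?_)
      (isClosed_le continuous_const (continuous_const.mul hv.continuous).abs)
    by_contra hlt
    rw [Set.mem_ofPred_eq, not_le] at hlt
    refine hx ?_
    simp only [Pi.sub_apply, θ, hψ1 _ hlt.le]
    field_simp [(hκ n).ne']
    ring
  have htsΩ : tsupport (v - θ n) ⊆ Ω := by
    intro x hx
    by_contra hxΩ
    have := hts hx
    simp only [Set.mem_ofPred_eq, h0 x hxΩ, mul_zero, abs_zero] at this
    linarith
  have hcs : HasCompactSupport (v - θ n) :=
    Metric.isCompact_of_isClosed_isBounded (isClosed_tsupport _) (hb.subset htsΩ)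
  -- The compactly supported part is mollified; ε/4 for each of the two parts compensates the factor
  -- 2 in `prodSq_add_le`.
  obtain ⟨φ, hφ, hlt⟩ := exists_testFun_of_lipschitz_of_compact hΩ hb hwL hcs htsΩ
    (ε := ε / 4) (by positivity)
  refine ⟨φ, hφ, ?_⟩
  have hgrad : gradient v =ᵐ[volume.restrict Ω] gradient (θ n) + gradient (v - θ n) := by
    have hae' : ∀ᵐ x ∂(volume.restrict Ω), DifferentiableAt ℝ (θ n) x :=
      ae_restrict_of_ae (hθL n).ae_differentiableAt
    filter_upwards [hae, hae'] with x hx hx'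
    simp only [gradient, Pi.add_apply, fderiv_sub hx hx', map_sub]
    abel
  have e1 : v - φ = θ n + (v - θ n - φ) := by abel
  have e2 : prodSq Ω (v - φ) (gradient v - gradient φ)
      = prodSq Ω (θ n + (v - θ n - φ)) (gradient (θ n) + (gradient (v - θ n) - gradient φ)) := by
    rw [← e1]
    refine prodSq_congr ?_
    filter_upwards [hgrad] with x hx
    simp only [Pi.sub_apply, Pi.add_apply, hx]
    abel
  rw [e2]
  refine (prodSq_add_le (memLp_of_lipschitz hΩ hb (hθL n))
    ((memLp_of_lipschitz hΩ hb hwL).sub (hφ.memLp _))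
    (memLp_gradient_of_lipschitz hb (hθL n))
    ((memLp_gradient_of_lipschitz hb hwL).sub (hφ.memLp_gradient _))).trans_lt ?_
  have h1 : prodSq Ω (θ n) (gradient (θ n)) < ε / 4 := by
    simpa [prodSq, Real.norm_eq_abs, sq_abs] using hn
  linarith

end

/-! ### Poincaré and Friedrichs inequalities with explicit constants. -/

section

variable {d : ℕ}

/-- Nonnegativity of the integral of (V f - I)², where V is the total mass and I the integral of f.
-/
lemma sq_integral_le {α : Type*} [MeasurableSpace α] {μ : Measure α} [IsFiniteMeasure μ]
    {f : α → ℝ} (hf : MemLp f 2 μ) : (∫ x, f x ∂μ) ^ 2 ≤ μ.real Set.univ * ∫ x, f x ^ 2 ∂μ := by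
  set V := μ.real Set.univ
  set I := ∫ x, f x ∂μ
  have hi : Integrable f μ := hf.integrable (by norm_num)
  have hV : 0 ≤ V := measureReal_nonneg
  have key : 0 ≤ ∫ x, (V * f x - I) ^ 2 ∂μ := integral_nonneg fun x => sq_nonneg _
  have e : ∫ x, (V * f x - I) ^ 2 ∂μ = V ^ 2 * (∫ x, f x ^ 2 ∂μ) - 2 * V * I * I + V * I ^ 2 := by
    have : ∀ x, (V * f x - I) ^ 2 = V ^ 2 * f x ^ 2 - 2 * V * I * f x + I ^ 2 := fun x => by ring
    simp only [this]
    have j1 : Integrable (fun x => V ^ 2 * f x ^ 2) μ := hf.integrable_sq.const_mul _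
    have j2 : Integrable (fun x => 2 * V * I * f x) μ := hi.const_mul _
    have j3 : Integrable (fun x => V ^ 2 * f x ^ 2 - 2 * V * I * f x) μ := j1.sub j2
    rw [integral_add j3 (integrable_const _), integral_sub j1 j2, integral_const_mul,
      integral_const_mul, integral_const, smul_eq_mul]
  rw [e] at key
  rcases hV.eq_or_lt with h0 | hpos
  · have : μ = 0 := by
      have h1 : μ.real Set.univ = 0 := h0.symm
      rwa [measureReal_def, ENNReal.toReal_eq_zero_iff, or_iff_left (measure_ne_top _ _),
        Measure.measure_univ_eq_zero] at h1
    simp [I, this]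
  · have : 0 ≤ V * (V * (∫ x, f x ^ 2 ∂μ) - I ^ 2) := by nlinarith
    have := nonneg_of_mul_nonneg_right this hpos
    linarith

lemma memLp_of_continuous {K : Set (Sp d)} (hK : IsCompact K) {f : Sp d → ℝ}
    (hf : Continuous f) : MemLp f 2 (volume.restrict K) := by
  have := isFiniteMeasure_restrict hK.isBounded
  obtain ⟨C, hC⟩ := hK.exists_bound_of_continuousOn hf.continuousOn
  exact MemLp.of_bound hf.aestronglyMeasurable C
    (ae_restrict_of_forall_mem hK.measurableSet hC)

lemma ofReal_setIntegral_sq {K : Set (Sp d)} (hK : IsCompact K) {f : Sp d → ℝ}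
    (hf : Continuous f) :
    ENNReal.ofReal (∫ x in K, f x ^ 2) = ∫⁻ x in K, ENNReal.ofReal (f x ^ 2) :=
  ofReal_integral_eq_lintegral_ofReal ((hf.pow 2).continuousOn.integrableOn_compact hK)
    (Eventually.of_forall fun x => sq_nonneg (f x))

/-- Cauchy–Schwarz for f - c. On a null set the factor in front makes the left side zero, so no
positivity of the volume is needed. -/
lemma volume_mul_average_sub_sq_le {K : Set (Sp d)} (hK : IsCompact K) {f : Sp d → ℝ}
    (hf : Continuous f) (c : ℝ) :
    volume.real K * ((⨍ x in K, f x) - c) ^ 2 ≤ ∫ x in K, (f x - c) ^ 2 := by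
  have := isFiniteMeasure_restrict hK.isBounded
  have hfc : Continuous fun x => f x - c := hf.sub continuous_const
  have h1 := sq_integral_le (memLp_of_continuous hK hfc)
  have hi : Integrable f (volume.restrict K) := (memLp_of_continuous hK hf).integrable (by norm_num)
  rw [integral_sub hi (integrable_const c), integral_const, measureReal_restrict_apply_univ,
    smul_eq_mul] at h1
  rcases (measureReal_nonneg (μ := volume) (s := K)).eq_or_lt with h0 | hpos
  · rw [← h0, zero_mul]
    exact integral_nonneg fun x => sq_nonneg _
  · rw [setAverage_eq, smul_eq_mul]
    have e : volume.real K * ((volume.real K)⁻¹ * (∫ x in K, f x) - c) ^ 2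
        = (volume.real K)⁻¹ * ((∫ x in K, f x) - volume.real K * c) ^ 2 := by
      field_simp
    rw [e, inv_mul_le_iff₀ hpos]
    exact h1

lemma sq_sub_le_intervalIntegral {ψ : ℝ → ℝ} (hψ : ContDiff ℝ 1 ψ) {a b : ℝ} (hab : a ≤ b) :
    (ψ b - ψ a) ^ 2 ≤ (b - a) * ∫ t in Set.Icc a b, deriv ψ t ^ 2 := by
  have hc : Continuous (deriv ψ) := hψ.continuous_deriv le_rfl
  have h1 : ∫ t in a..b, deriv ψ t = ψ b - ψ a :=
    intervalIntegral.integral_deriv_eq_sub (fun x _ => hψ.differentiable one_ne_zero x)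
      (hc.intervalIntegrable a b)
  rw [intervalIntegral.integral_of_le hab, ← integral_Icc_eq_integral_Ioc] at h1
  rw [← h1]
  obtain ⟨C, hC⟩ := (isCompact_Icc (a := a) (b := b)).exists_bound_of_continuousOn hc.continuousOn
  have hm : MemLp (deriv ψ) 2 (volume.restrict (Set.Icc a b)) :=
    MemLp.of_bound hc.aestronglyMeasurable C (ae_restrict_of_forall_mem measurableSet_Icc hC)
  have := sq_integral_le hm
  simpa [hab] using this

/-- The fundamental theorem of calculus along a line, then Cauchy–Schwarz. The form in `ENNReal`
lets Tonelli's theorem be used later without integrability checks. -/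
lemma ofReal_sq_sub_le {φ : Sp d → ℝ} (hφ : ContDiff ℝ 1 φ) (x h : Sp d) {a b : ℝ}
    (hab : a ≤ b) :
    ENNReal.ofReal ((φ (x + b • h) - φ (x + a • h)) ^ 2) ≤ ENNReal.ofReal ((b - a) * ‖h‖ ^ 2) *
      ∫⁻ t in Set.Icc a b, ENNReal.ofReal (‖gradient φ (x + t • h)‖ ^ 2) := by
  have hl : ContDiff ℝ 1 (fun t : ℝ => x + t • h) :=
    contDiff_const.add (contDiff_id.smul contDiff_const)
  have hψ : ContDiff ℝ 1 (fun t : ℝ => φ (x + t • h)) := hφ.comp hl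
  have h1 := sq_sub_le_intervalIntegral hψ hab
  have hd : ∀ t, deriv (fun t : ℝ => φ (x + t • h)) t = fderiv ℝ φ (x + t • h) h := fun t => by
    have hd1 : HasDerivAt (fun t : ℝ => x + t • h) h t := by
      simpa using ((hasDerivAt_id t).smul_const h).const_add x
    exact ((hφ.differentiable one_ne_zero _).hasFDerivAt.comp_hasDerivAt t hd1).deriv
  have hgc : Continuous (fun t : ℝ => ‖gradient φ (x + t • h)‖ ^ 2) :=
    ((continuous_gradient hφ).comp hl.continuous).norm.pow 2
  have hint : IntegrableOn (fun t : ℝ => ‖gradient φ (x + t • h)‖ ^ 2) (Set.Icc a b) :=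
    hgc.integrableOn_Icc
  have h2 : ∫ t in Set.Icc a b, deriv (fun t : ℝ => φ (x + t • h)) t ^ 2
      ≤ ‖h‖ ^ 2 * ∫ t in Set.Icc a b, ‖gradient φ (x + t • h)‖ ^ 2 := by
    rw [← integral_const_mul]
    refine integral_mono ((hψ.continuous_deriv le_rfl).pow 2).integrableOn_Icc
      (hint.const_mul _) fun t => ?_
    simp only [hd]
    have := (fderiv ℝ φ (x + t • h)).le_opNorm h
    rw [norm_gradient, ← mul_pow, ← sq_abs, mul_comm]
    gcongr
    exact this
  have h3 : (φ (x + b • h) - φ (x + a • h)) ^ 2 ≤ ((b - a) * ‖h‖ ^ 2) *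
      ∫ t in Set.Icc a b, ‖gradient φ (x + t • h)‖ ^ 2 := by
    refine h1.trans ?_
    rw [mul_assoc]
    exact mul_le_mul_of_nonneg_left h2 (sub_nonneg.2 hab)
  refine (ENNReal.ofReal_le_ofReal h3).trans ?_
  have := sub_nonneg.2 hab
  rw [ENNReal.ofReal_mul (by positivity), ofReal_integral_eq_lintegral_ofReal hint
    (Eventually.of_forall fun t => by positivity)]

lemma lintegral_comp_add_smul {f : Sp d → ENNReal} (hf : Measurable f) (a : Sp d) {t : ℝ}
    (ht : 0 < t) :
    ∫⁻ y, f (a + t • y) = ENNReal.ofReal ((t ^ d)⁻¹) * ∫⁻ y, f y := by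
  have h1 : ∫⁻ y, f (a + t • y) = ∫⁻ z, f (a + z) ∂(Measure.map (fun y : Sp d => t • y) volume) :=
    (lintegral_map (f := fun z => f (a + z)) (hf.comp (measurable_const_add a))
      (measurable_const_smul t)).symm
  have h2 : Measure.map (fun y : Sp d => t • y) volume
      = ENNReal.ofReal (|(t ^ Module.finrank ℝ (Sp d))⁻¹|) • (volume : Measure (Sp d)) :=
    Measure.map_addHaar_smul volume ht.ne'
  rw [h1, h2, lintegral_smul_measure, lintegral_add_left_eq_self f a, finrank_euclideanSpace_fin,
    abs_of_pos (by positivity), smul_eq_mul]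

lemma ofReal_inv_pow_le {t : ℝ} (ht : 1 / 2 ≤ t) :
    ENNReal.ofReal ((t ^ d)⁻¹) ≤ ENNReal.ofReal (2 ^ d) := by
  refine ENNReal.ofReal_le_ofReal ?_
  rw [← inv_pow]
  have : t⁻¹ ≤ 2 := by rw [inv_le_comm₀ (by linarith) two_pos]; linarith
  gcongr

/-- For t ≥ 1/2, integrate in y first: the substitution has Jacobian t^d, which costs at most 2^d.
For t ≤ 1/2, exchange the roles of x and y. Splitting at 1/2 keeps the bound uniform in t, with no
singularity at either end. -/
lemma lintegral_segment_le {K : Set (Sp d)} {g : Sp d → ENNReal} (hg : Measurable g) (t : ℝ) :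
    ∫⁻ x in K, ∫⁻ y in K, g (x + t • (y - x)) ≤
      ENNReal.ofReal (2 ^ d) * volume K * ∫⁻ x, g x := by
  have hs : ∀ (s : ℝ), 1 / 2 ≤ s →
      ∫⁻ x in K, ∫⁻ y in K, g ((1 - s) • x + s • y) ≤
      ENNReal.ofReal (2 ^ d) * volume K * ∫⁻ x, g x := by
    intro s hs
    calc ∫⁻ x in K, ∫⁻ y in K, g ((1 - s) • x + s • y)
        ≤ ∫⁻ x in K, ENNReal.ofReal (2 ^ d) * ∫⁻ y, g y := by
          refine lintegral_mono fun x => ?_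
          refine (setLIntegral_le_lintegral _ _).trans ?_
          rw [lintegral_comp_add_smul hg _ (by linarith)]
          exact mul_le_mul' (ofReal_inv_pow_le hs) le_rfl
      _ = _ := by
          rw [setLIntegral_const]; ring
  rcases le_total (1 / 2) t with h | h
  · have e : ∀ x y : Sp d, x + t • (y - x) = (1 - t) • x + t • y := fun x y => by module
    simp only [e]
    exact hs t h
  · have hm : Measurable (fun p : Sp d × Sp d => g (p.1 + t • (p.2 - p.1))) :=
      hg.comp (by fun_prop)
    rw [lintegral_lintegral_swap hm.aemeasurable]
    have e : ∀ x y : Sp d, x + t • (y - x) = (1 - (1 - t)) • y + (1 - t) • x :=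
      fun x y => by module
    simp only [e]
    exact hs (1 - t) (by linarith)

/-- The Poincaré inequality on a compact convex set. -/
theorem poincare_convex {K : Set (Sp d)} (hK : IsCompact K) (hc : Convex ℝ K)
    (hpos : 0 < volume K) {δ : ℝ} (hδ : ∀ x ∈ K, ∀ y ∈ K, dist x y ≤ δ) {φ : Sp d → ℝ}
    (hφ : ContDiff ℝ 1 φ) :
    ∫ x in K, (φ x - ⨍ y in K, φ y) ^ 2 ≤ 2 ^ d * δ ^ 2 * ∫ x in K, ‖gradient φ x‖ ^ 2 := by
  have hKm := hK.measurableSet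
  set a := ⨍ y in K, φ y
  let g : Sp d → ENNReal := K.indicator fun x => ENNReal.ofReal (‖gradient φ x‖ ^ 2)
  have hg : Measurable g :=
    (((continuous_gradient hφ).norm.pow 2).measurable.ennreal_ofReal).indicator hKm
  have hIg : ∫⁻ x, g x = ENNReal.ofReal (∫ x in K, ‖gradient φ x‖ ^ 2) := by
    rw [lintegral_indicator hKm, ofReal_setIntegral_sq hK (continuous_gradient hφ).norm]
  have hφc := hφ.continuous
  have hfin : volume K ≠ ⊤ := hK.measure_lt_top.ne
  -- The deviation from the mean is bounded by the mean of pairwise differences, which are then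
  -- integrated along the segments joining the two points.
  have step1 : volume K * ENNReal.ofReal (∫ x in K, (φ x - a) ^ 2)
      ≤ ∫⁻ x in K, ∫⁻ y in K, ENNReal.ofReal ((φ y - φ x) ^ 2) := by
    have hφa : ∀ c : ℝ, Continuous fun x => φ x - c := fun c => hφc.sub continuous_const
    rw [ofReal_setIntegral_sq hK (hφa a), ← lintegral_const_mul _
      (f := fun x => ENNReal.ofReal ((φ x - a) ^ 2)) (((hφa a).pow 2).measurable.ennreal_ofReal)]
    refine lintegral_mono fun x => ?_
    rw [← ofReal_setIntegral_sq hK (hφa (φ x)), ← ENNReal.ofReal_toReal hfin,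
      ← ENNReal.ofReal_mul ENNReal.toReal_nonneg]
    refine ENNReal.ofReal_le_ofReal ?_
    have := volume_mul_average_sub_sq_le hK hφc (φ x)
    rwa [← neg_sub, neg_sq]
  have step2 : ∫⁻ x in K, ∫⁻ y in K, ENNReal.ofReal ((φ y - φ x) ^ 2)
      ≤ ∫⁻ x in K, ∫⁻ y in K, ENNReal.ofReal (δ ^ 2) *
        ∫⁻ t in Set.Icc (0 : ℝ) 1, g (x + t • (y - x)) := by
    refine setLIntegral_mono' hKm fun x hx => setLIntegral_mono' hKm fun y hy => ?_
    have h := ofReal_sq_sub_le hφ x (y - x) zero_le_one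
    simp only [one_smul, zero_smul, add_zero, sub_zero, one_mul, add_sub_cancel] at h
    refine h.trans ?_
    have hd : ‖y - x‖ ≤ δ := by rw [← dist_eq_norm]; exact hδ y hy x hx
    refine mul_le_mul' (ENNReal.ofReal_le_ofReal (by gcongr)) ?_
    refine setLIntegral_mono' measurableSet_Icc fun t ht => ?_
    -- Convexity enters here: the segment stays in `K`, so cutting the gradient off outside `K`
    -- loses nothing.
    have hmem : x + t • (y - x) ∈ K := by
      have := hc.add_smul_sub_mem hx hy ht
      exact this
    simp only [g]
    rw [Set.indicator_of_mem hmem]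
  have hm3 : Measurable (fun p : (Sp d × Sp d) × ℝ => g (p.1.1 + p.2 • (p.1.2 - p.1.1))) :=
    hg.comp (by fun_prop)
  have hm2 : ∀ x : Sp d, Measurable (fun p : Sp d × ℝ => g (x + p.2 • (p.1 - x))) := fun x =>
    hg.comp (by fun_prop)
  have step3 : ∫⁻ x in K, ∫⁻ y in K, ENNReal.ofReal (δ ^ 2) *
        ∫⁻ t in Set.Icc (0 : ℝ) 1, g (x + t • (y - x)) =
      ENNReal.ofReal (δ ^ 2) * ∫⁻ t in Set.Icc (0 : ℝ) 1, ∫⁻ x in K, ∫⁻ y in K,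
        g (x + t • (y - x)) := by
    have m1 : ∀ x : Sp d, Measurable fun y : Sp d =>
        ∫⁻ t in Set.Icc (0 : ℝ) 1, g (x + t • (y - x)) := fun x =>
      (hm2 x).lintegral_prod_right'
    have m2 : Measurable fun p : Sp d × ℝ => ∫⁻ y in K, g (p.1 + p.2 • (y - p.1)) := by
      have : Measurable (fun q : (Sp d × ℝ) × Sp d => g (q.1.1 + q.1.2 • (q.2 - q.1.1))) :=
        hg.comp (by fun_prop)
      exact this.lintegral_prod_right'
    simp_rw [fun x => lintegral_const_mul (μ := volume.restrict K) (ENNReal.ofReal (δ ^ 2)) (m1 x)]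
    rw [lintegral_const_mul]
    · congr 1
      rw [lintegral_lintegral_swap (f := fun (t : ℝ) (x : Sp d) =>
        ∫⁻ y in K, g (x + t • (y - x)))]
      · refine lintegral_congr fun x => ?_
        exact lintegral_lintegral_swap (f := fun (y : Sp d) (t : ℝ) => g (x + t • (y - x)))
          (hm2 x).aemeasurable
      · exact (m2.comp measurable_swap).aemeasurable
    · have : Measurable (fun p : Sp d × Sp d =>
          ∫⁻ t in Set.Icc (0 : ℝ) 1, g (p.1 + t • (p.2 - p.1))) := hm3.lintegral_prod_right'
      exact this.lintegral_prod_right'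
  have step4 : ∫⁻ t in Set.Icc (0 : ℝ) 1, ∫⁻ x in K, ∫⁻ y in K, g (x + t • (y - x))
      ≤ ENNReal.ofReal (2 ^ d) * volume K * ∫⁻ x, g x := by
    refine (setLIntegral_mono' (g := fun _ => ENNReal.ofReal (2 ^ d) * volume K * ∫⁻ x, g x)
      measurableSet_Icc fun t _ => lintegral_segment_le hg t).trans ?_
    rw [setLIntegral_const]
    simp
  have h5 : volume K * ENNReal.ofReal (∫ x in K, (φ x - a) ^ 2) ≤
      volume K * ENNReal.ofReal (2 ^ d * δ ^ 2 * ∫ x in K, ‖gradient φ x‖ ^ 2) := by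
    refine (step1.trans step2).trans ?_
    rw [step3]
    refine (mul_le_mul' le_rfl step4).trans (le_of_eq ?_)
    rw [hIg, ENNReal.ofReal_mul (by positivity), ENNReal.ofReal_mul (by positivity)]
    ring
  rw [ENNReal.mul_le_mul_iff_right hpos.ne' hfin] at h5
  refine (ENNReal.ofReal_le_ofReal_iff ?_).1 h5
  have : 0 ≤ ∫ x in K, ‖gradient φ x‖ ^ 2 := integral_nonneg fun x => by positivity
  positivity

/-- Moving from x along the normal by the signed distance τ lands on the disc, where φ vanishes,
because orthogonal projection does not increase the distance to f. The path stays in the ball of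
radius 2r. -/
lemma ofReal_sq_le_of_disc {φ : Sp d → ℝ} (hφ : ContDiff ℝ 1 φ) {f ν : Sp d} {r : ℝ} (hr : 0 ≤ r)
    (hν : ‖ν‖ = 1) (h0 : ∀ p : Sp d, inner ℝ ν (p - f) = 0 → dist p f ≤ r → φ p = 0)
    {x : Sp d} (hx : dist x f ≤ r) :
    ENNReal.ofReal (φ x ^ 2) ≤ ENNReal.ofReal (2 * r) * ∫⁻ t in Set.Icc (-r) r,
      (Metric.closedBall f (2 * r)).indicator (fun x => ENNReal.ofReal (‖gradient φ x‖ ^ 2))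
        (x + t • ν) := by
  set τ := inner ℝ ν (x - f) with hτdef
  have hxf : ‖x - f‖ ≤ r := by rw [← dist_eq_norm]; exact hx
  have hτ : |τ| ≤ r := by
    have := abs_real_inner_le_norm ν (x - f)
    rw [hν, one_mul] at this
    exact this.trans hxf
  have hz : φ (x + (-τ) • ν) = 0 := by
    refine h0 _ ?_ ?_
    · have : x + (-τ) • ν - f = (x - f) - τ • ν := by module
      rw [this, inner_sub_right, inner_smul_right, real_inner_self_eq_norm_sq, hν]
      simp [hτdef]
    · have : x + (-τ) • ν - f = (x - f) - τ • ν := by module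
      rw [dist_eq_norm, this]
      have h1 : ‖x - f - τ • ν‖ ^ 2 = ‖x - f‖ ^ 2 - τ ^ 2 := by
        rw [norm_sub_sq_real, inner_smul_right, norm_smul, hν, real_inner_comm, ← hτdef]
        simp
        ring
      have h2 : ‖x - f - τ • ν‖ ^ 2 ≤ r ^ 2 := by
        rw [h1]
        nlinarith [sq_nonneg τ, norm_nonneg (x - f)]
      exact le_of_sq_le_sq h2 hr
  have hmono : ∀ a b : ℝ, -r ≤ a → b ≤ r →
      ∫⁻ t in Set.Icc a b, ENNReal.ofReal (‖gradient φ (x + t • ν)‖ ^ 2)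
        ≤ ∫⁻ t in Set.Icc (-r) r, (Metric.closedBall f (2 * r)).indicator
          (fun x => ENNReal.ofReal (‖gradient φ x‖ ^ 2)) (x + t • ν) := by
    intro a b ha hb
    refine (lintegral_mono_set (Set.Icc_subset_Icc ha hb)).trans ?_
    refine setLIntegral_mono' measurableSet_Icc fun t ht => ?_
    have hmem : x + t • ν ∈ Metric.closedBall f (2 * r) := by
      rw [Metric.mem_closedBall, dist_eq_norm]
      have h1 : ‖x - f + t • ν‖ ≤ ‖x - f‖ + ‖t • ν‖ := norm_add_le _ _
      rw [norm_smul, hν, mul_one, Real.norm_eq_abs] at h1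
      have h2 : |t| ≤ r := abs_le.2 ht
      have h3 : x + t • ν - f = x - f + t • ν := by abel
      rw [h3]
      linarith
    rw [Set.indicator_of_mem hmem]
  rcases le_total τ 0 with h | h
  · have := ofReal_sq_sub_le hφ x ν (a := 0) (b := -τ) (by linarith)
    rw [hz, zero_smul, add_zero, zero_sub, neg_sq, hν] at this
    refine this.trans (mul_le_mul' (ENNReal.ofReal_le_ofReal ?_) (hmono _ _ (by linarith) ?_))
    · have := abs_le.1 hτ; linarith
    · have := abs_le.1 hτ; linarith
  · have := ofReal_sq_sub_le hφ x ν (a := -τ) (b := 0) (by linarith)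
    rw [hz, zero_smul, add_zero, sub_zero, hν] at this
    refine this.trans (mul_le_mul' (ENNReal.ofReal_le_ofReal ?_) (hmono _ _ ?_ hr))
    · have := abs_le.1 hτ; linarith
    · have := abs_le.1 hτ; linarith

/-- A Friedrichs inequality for functions that vanish on a disc of a hyperplane. -/
theorem friedrichs_disc {φ : Sp d → ℝ} (hφ : ContDiff ℝ 1 φ) {f ν : Sp d} {r : ℝ} (hr : 0 ≤ r)
    (hν : ‖ν‖ = 1) (h0 : ∀ p : Sp d, inner ℝ ν (p - f) = 0 → dist p f ≤ r → φ p = 0) :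
    ∫ x in Metric.closedBall f r, φ x ^ 2 ≤
      4 * r ^ 2 * ∫ x in Metric.closedBall f (2 * r), ‖gradient φ x‖ ^ 2 := by
  obtain ⟨B, hBdef⟩ : ∃ B, B = Metric.closedBall f r := ⟨_, rfl⟩
  obtain ⟨B2, hB2def⟩ : ∃ B, B = Metric.closedBall f (2 * r) := ⟨_, rfl⟩
  have hB : IsCompact B := hBdef ▸ isCompact_closedBall _ _
  have hB2 : IsCompact B2 := hB2def ▸ isCompact_closedBall _ _
  obtain ⟨g, hgdef⟩ : ∃ g : Sp d → ENNReal,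
    g = B2.indicator fun x => ENNReal.ofReal (‖gradient φ x‖ ^ 2) := ⟨_, rfl⟩
  have hg : Measurable g := hgdef ▸
    (((continuous_gradient hφ).norm.pow 2).measurable.ennreal_ofReal).indicator hB2.measurableSet
  have hIg : ∫⁻ x, g x = ENNReal.ofReal (∫ x in B2, ‖gradient φ x‖ ^ 2) := by
    rw [hgdef, lintegral_indicator hB2.measurableSet,
      ofReal_setIntegral_sq hB2 (continuous_gradient hφ).norm]
  have step : ∀ x ∈ B, ENNReal.ofReal (φ x ^ 2) ≤
      ENNReal.ofReal (2 * r) * ∫⁻ t in Set.Icc (-r) r, g (x + t • ν) := by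
    intro x hx
    rw [hgdef, hB2def]
    rw [hBdef] at hx
    exact ofReal_sq_le_of_disc hφ hr hν h0 hx
  rw [← hBdef, ← hB2def]
  have hm : Measurable (fun p : Sp d × ℝ => g (p.1 + p.2 • ν)) := hg.comp (by fun_prop)
  have hmain : ENNReal.ofReal (∫ x in B, φ x ^ 2) ≤
      ENNReal.ofReal (4 * r ^ 2 * ∫ x in B2, ‖gradient φ x‖ ^ 2) := by
    rw [ofReal_setIntegral_sq hB hφ.continuous]
    refine (setLIntegral_mono' hB.measurableSet step).trans ?_
    have m1 : Measurable fun x : Sp d => ∫⁻ t in Set.Icc (-r) r, g (x + t • ν) :=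
      hm.lintegral_prod_right'
    rw [lintegral_const_mul _ m1, lintegral_lintegral_swap hm.aemeasurable]
    -- Translation invariance for each fixed `t`; integrating over an interval of length 2r gives
    -- the second factor 2r of the constant 4r².
    have h6 : ∀ t : ℝ, ∫⁻ x in B, g (x + t • ν) ≤ ∫⁻ x, g x := fun t => by
      refine (setLIntegral_le_lintegral _ _).trans ?_
      rw [lintegral_add_right_eq_self g (t • ν)]
    refine (mul_le_mul' le_rfl (lintegral_mono h6)).trans ?_
    have e : ENNReal.ofReal (4 * r ^ 2) = ENNReal.ofReal (2 * r) * ENNReal.ofReal (r - -r) := by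
      rw [← ENNReal.ofReal_mul (mul_nonneg zero_le_two hr)]
      congr 1
      ring
    rw [lintegral_const, Measure.restrict_apply_univ, Real.volume_Icc, hIg,
      ENNReal.ofReal_mul (mul_nonneg zero_le_four (sq_nonneg r)), e, mul_assoc,
      mul_comm (ENNReal.ofReal (r - -r))]
  have hn : 0 ≤ ∫ x in B2, ‖gradient φ x‖ ^ 2 := integral_nonneg fun x => sq_nonneg _
  exact (ENNReal.ofReal_le_ofReal_iff (mul_nonneg (mul_nonneg zero_le_four (sq_nonneg r)) hn)).1
    hmain

end

/-! ### Local polynomial spaces: bounds for vertex values, nodal bases, facets. -/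

section

variable {d : ℕ}

/-! ### Polynomials -/

lemma pval_eq (p : MvPolynomial (Fin d) ℝ) (x : Sp d) :
    pval p x = ∑ m ∈ p.support, p.coeff m * ∏ i, x i ^ m i :=
  MvPolynomial.eval_eq' _ _

@[simp] lemma pval_C (c : ℝ) (x : Sp d) : pval (MvPolynomial.C c) x = c := by simp [pval]

@[simp] lemma pval_X (i : Fin d) (x : Sp d) : pval (MvPolynomial.X i) x = x i := by simp [pval]

@[simp] lemma pval_add (p q : MvPolynomial (Fin d) ℝ) (x : Sp d) :
    pval (p + q) x = pval p x + pval q x := by simp [pval]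

@[simp] lemma pval_sub (p q : MvPolynomial (Fin d) ℝ) (x : Sp d) :
    pval (p - q) x = pval p x - pval q x := by simp [pval]

@[simp] lemma pval_mul (p q : MvPolynomial (Fin d) ℝ) (x : Sp d) :
    pval (p * q) x = pval p x * pval q x := by simp [pval]

@[simp] lemma pval_smul (c : ℝ) (p : MvPolynomial (Fin d) ℝ) (x : Sp d) :
    pval (c • p) x = c * pval p x := by simp [pval]

@[simp] lemma pval_zero (x : Sp d) : pval (0 : MvPolynomial (Fin d) ℝ) x = 0 := by simp [pval]

lemma pval_sum {ι : Type*} (s : Finset ι) (p : ι → MvPolynomial (Fin d) ℝ) (x : Sp d) :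
    pval (∑ i ∈ s, p i) x = ∑ i ∈ s, pval (p i) x := by simp [pval]

lemma pval_prod {ι : Type*} (s : Finset ι) (p : ι → MvPolynomial (Fin d) ℝ) (x : Sp d) :
    pval (∏ i ∈ s, p i) x = ∏ i ∈ s, pval (p i) x := by simp [pval]

lemma contDiff_pval (p : MvPolynomial (Fin d) ℝ) : ContDiff ℝ 1 (pval p) := by
  have : pval p = fun x => ∑ m ∈ p.support, p.coeff m * ∏ i, x i ^ m i := funext (pval_eq p)
  rw [this]
  refine ContDiff.sum fun m _ => contDiff_const.mul (contDiff_prod fun i _ => ?_)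
  exact ((EuclideanSpace.proj (𝕜 := ℝ) i).contDiff).pow _

lemma continuous_pval (p : MvPolynomial (Fin d) ℝ) : Continuous (pval p) :=
  (contDiff_pval p).continuous

lemma totalDegree_le_of_mem_polySpace {kind : MeshKind} {p : MvPolynomial (Fin d) ℝ}
    (hp : p ∈ polySpace d kind 1) : p.totalDegree ≤ d + 1 := by
  cases kind with
  | simplicial =>
    have := (MvPolynomial.mem_restrictTotalDegree _ _ _).1 hp
    omega
  | cubic =>
    have h := (MvPolynomial.mem_restrictDegree _ _ _).1 hp
    refine Finset.sup_le fun m hm => ?_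
    rw [Finsupp.sum_fintype _ _ (by simp)]
    calc ∑ i, m i ≤ ∑ _i : Fin d, 1 := Finset.sum_le_sum fun i _ => h m hm i
      _ ≤ d + 1 := by simp

/-- Lagrange interpolation at n + 1 equispaced nodes in (0, 1], evaluated at 0. Excluding the node 0
is the point: the coefficients then bound the value at 0 by values at positive parameters. -/
lemma exists_extrapolation (n : ℕ) : ∃ c : ℕ → ℝ, ∀ q : Polynomial ℝ, q.natDegree ≤ n →
    q.eval 0 = ∑ k ∈ Finset.range (n + 1), c k * q.eval (((k : ℝ) + 1) / (n + 1)) := by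
  let t : ℕ → ℝ := fun k => ((k : ℝ) + 1) / (n + 1)
  have hinj : Set.InjOn t (Finset.range (n + 1)) := by
    intro a _ b _ hab
    have hn : (n : ℝ) + 1 ≠ 0 := by positivity
    simp only [t, div_left_inj' hn, add_left_inj, Nat.cast_inj] at hab
    exact hab
  refine ⟨fun k => (Lagrange.basis (Finset.range (n + 1)) t k).eval 0, fun q hq => ?_⟩
  have hdeg : q.degree < (Finset.range (n + 1)).card := by
    rw [Finset.card_range]
    exact (Polynomial.degree_le_natDegree).trans_lt (by exact_mod_cast Nat.lt_succ_of_le hq)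
  conv_lhs => rw [Lagrange.eq_interpolate hinj hdeg]
  rw [Lagrange.interpolate_apply, Polynomial.eval_finsetSum]
  refine Finset.sum_congr rfl fun k _ => ?_
  rw [Polynomial.eval_mul, Polynomial.eval_C, mul_comm]

/-- The restriction of a polynomial to a line. -/
lemma exists_restriction_line (p : MvPolynomial (Fin d) ℝ) (v x : Sp d) :
    ∃ q : Polynomial ℝ, q.natDegree ≤ p.totalDegree ∧ ∀ t : ℝ, q.eval t = pval p (v + t • (x - v)) := by
  refine ⟨MvPolynomial.aeval
    (fun i => Polynomial.C (x i - v i) * Polynomial.X + Polynomial.C (v i)) p, ?_, fun t => ?_⟩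
  · have := MvPolynomial.aeval_natDegree_le (m := p.totalDegree) (n := 1) p le_rfl
      (fun i => Polynomial.C (x i - v i) * Polynomial.X + Polynomial.C (v i))
      (fun i => Polynomial.natDegree_linear_le)
    simpa using this
  · rw [pval, MvPolynomial.aeval_def, ← Polynomial.coe_evalRingHom, MvPolynomial.hom_eval₂,
      MvPolynomial.eval, MvPolynomial.coe_eval₂Hom]
    congr 1
    · ext; simp
    · ext i; simp; ring

/-- On a compact convex set, the value of a polynomial at a point is controlled by its `L²` mean. -/
theorem exists_vertex_bound (d : ℕ) : ∃ C : ℝ, 0 < C ∧ ∀ (kind : MeshKind)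
    (p : MvPolynomial (Fin d) ℝ), p ∈ polySpace d kind 1 → ∀ (K : Set (Sp d)), IsCompact K →
    Convex ℝ K → ∀ v ∈ K, volume.real K * pval p v ^ 2 ≤ C * ∫ x in K, pval p x ^ 2 := by
  obtain ⟨c, hc⟩ := exists_extrapolation (d + 1)
  let t : ℕ → ℝ := fun k => ((k : ℝ) + 1) / ((d + 1 : ℕ) + 1)
  have ht0 : ∀ k, 0 < t k := fun k => by positivity
  have ht1 : ∀ k ∈ Finset.range (d + 1 + 1), t k ≤ 1 := fun k hk => by
    have : k ≤ d + 1 := by have := Finset.mem_range.1 hk; omega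
    rw [div_le_one (by positivity)]
    have : (k : ℝ) ≤ (d + 1 : ℕ) := by exact_mod_cast this
    linarith
  let S := ∑ k ∈ Finset.range (d + 1 + 1), c k ^ 2
  let R := ∑ k ∈ Finset.range (d + 1 + 1), (t k ^ d)⁻¹
  have hS : 0 ≤ S := Finset.sum_nonneg fun k _ => sq_nonneg _
  have hR : 0 ≤ R := Finset.sum_nonneg fun k _ => by have := ht0 k; positivity
  refine ⟨S * R + 1, by positivity, fun kind p hp K hK hconv v hv => ?_⟩
  have hint0 : 0 ≤ ∫ x in K, pval p x ^ 2 := integral_nonneg fun x => sq_nonneg _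
  have hcont : ∀ k, Continuous fun x => pval p (v + t k • (x - v)) := fun k =>
    (continuous_pval p).comp (by fun_prop)
  -- Extrapolate to `v` from the points at parameters `t k` on the segment from `v` to `x`. Degree d
  -- + 1 covers both kinds of local space.
  have hpt : ∀ x, pval p v ^ 2 ≤
      S * ∑ k ∈ Finset.range (d + 1 + 1), pval p (v + t k • (x - v)) ^ 2 := by
    intro x
    obtain ⟨q, hq1, hq2⟩ := exists_restriction_line p v x
    have h := hc q (hq1.trans (totalDegree_le_of_mem_polySpace hp))
    have e : pval p v = ∑ k ∈ Finset.range (d + 1 + 1), c k * pval p (v + t k • (x - v)) := by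
      have h0 := hq2 0
      rw [zero_smul, add_zero] at h0
      rw [← h0, h]
      exact Finset.sum_congr rfl fun k _ => by rw [hq2]
    rw [e]
    exact Finset.sum_mul_sq_le_sq_mul_sq _ _ _
  -- The contraction towards `v` by the factor `t k` maps the convex set `K` into itself, with
  -- Jacobian `t k ^ d`.
  have hk : ∀ k ∈ Finset.range (d + 1 + 1), ∫ x in K, pval p (v + t k • (x - v)) ^ 2 ≤
      (t k ^ d)⁻¹ * ∫ x in K, pval p x ^ 2 := by
    intro k hk
    let g : Sp d → ENNReal := K.indicator fun x => ENNReal.ofReal (pval p x ^ 2)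
    have hg : Measurable g :=
      (((continuous_pval p).pow 2).measurable.ennreal_ofReal).indicator hK.measurableSet
    have hIg : ∫⁻ x, g x = ENNReal.ofReal (∫ x in K, pval p x ^ 2) := by
      rw [lintegral_indicator hK.measurableSet, ofReal_setIntegral_sq hK (continuous_pval p)]
    have hpos : 0 ≤ (t k ^ d)⁻¹ := by have := ht0 k; positivity
    refine (ENNReal.ofReal_le_ofReal_iff (mul_nonneg hpos hint0)).1 ?_
    rw [ofReal_setIntegral_sq hK (hcont k), ENNReal.ofReal_mul hpos, ← hIg,
      ← lintegral_comp_add_smul hg ((1 - t k) • v) (ht0 k)]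
    refine le_trans (setLIntegral_mono' hK.measurableSet fun x hx => ?_)
      (setLIntegral_le_lintegral K _)
    have e : v + t k • (x - v) = (1 - t k) • v + t k • x := by module
    have hmem : (1 - t k) • v + t k • x ∈ K :=
      hconv hv hx (sub_nonneg.2 (ht1 k hk)) (ht0 k).le (by ring)
    simp only [g]
    rw [Set.indicator_of_mem hmem, e]
  have := isFiniteMeasure_restrict hK.isBounded
  have hi : ∀ k, IntegrableOn (fun x => pval p (v + t k • (x - v)) ^ 2) K := fun k =>
    ((hcont k).pow 2).continuousOn.integrableOn_compact hK
  calc volume.real K * pval p v ^ 2 = ∫ _x in K, pval p v ^ 2 := by simp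
    _ ≤ ∫ x in K, S * ∑ k ∈ Finset.range (d + 1 + 1), pval p (v + t k • (x - v)) ^ 2 :=
        integral_mono (integrable_const _)
          ((integrable_finsetSum _ fun k _ => hi k).const_mul S) hpt
    _ = S * ∑ k ∈ Finset.range (d + 1 + 1), ∫ x in K, pval p (v + t k • (x - v)) ^ 2 := by
        rw [integral_const_mul, integral_finsetSum _ fun k _ => hi k]
    _ ≤ S * ∑ k ∈ Finset.range (d + 1 + 1), (t k ^ d)⁻¹ * ∫ x in K, pval p x ^ 2 := by
        gcongr with k hk'
        exact hk k hk'
    _ = S * R * ∫ x in K, pval p x ^ 2 := by rw [← Finset.sum_mul, mul_assoc]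
    _ ≤ (S * R + 1) * ∫ x in K, pval p x ^ 2 := by gcongr; linarith

/-! ### Nodal bases -/

open Classical in
/-- The nodal basis polynomial of the vertex `v` of the element with vertex set `s`. -/
def nodal (kind : MeshKind) (s : Finset (Sp d)) (v : Sp d) : MvPolynomial (Fin d) ℝ :=
  interp kind s fun w => if v = w then 1 else 0

open Classical in
/-- `lam` is a nodal basis of the local polynomial space. -/
structure IsNodalBasis (kind : MeshKind) (s : Finset (Sp d))
    (lam : Sp d → MvPolynomial (Fin d) ℝ) : Prop where
  mem : ∀ v ∈ s, lam v ∈ polySpace d kind 1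
  delta : ∀ v ∈ s, ∀ w ∈ s, pval (lam v) w = if v = w then 1 else 0
  repro : ∀ p ∈ polySpace d kind 1, ∀ x, pval p x = ∑ v ∈ s, pval p v * pval (lam v) x

variable {kind : MeshKind} {s : Finset (Sp d)} {lam : Sp d → MvPolynomial (Fin d) ℝ}

lemma interp_spec (h : IsNodalBasis kind s lam) (f : Sp d → ℝ) :
    interp kind s f ∈ polySpace d kind 1 ∧ ∀ v ∈ s, pval (interp kind s f) v = f v := by
  classical
  refine Classical.epsilon_spec
    (p := fun p => p ∈ polySpace d kind 1 ∧ ∀ v ∈ s, pval p v = f v)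
    ⟨∑ v ∈ s, f v • lam v, Submodule.sum_mem _ fun v hv => Submodule.smul_mem _ _ (h.mem v hv),
      fun w hw => ?_⟩
  rw [pval_sum]
  simp only [pval_smul]
  rw [Finset.sum_congr rfl fun v hv => by rw [h.delta v hv w hw]]
  simp [hw]

lemma pval_interp (h : IsNodalBasis kind s lam) (f : Sp d → ℝ) (x : Sp d) :
    pval (interp kind s f) x = ∑ v ∈ s, f v * pval (lam v) x := by
  rw [h.repro _ (interp_spec h f).1]
  exact Finset.sum_congr rfl fun v hv => by rw [(interp_spec h f).2 v hv]

lemma pval_nodal (h : IsNodalBasis kind s lam) {v : Sp d} (hv : v ∈ s) (x : Sp d) :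
    pval (nodal kind s v) x = pval (lam v) x := by
  classical
  rw [nodal, pval_interp h]
  simp [hv]

lemma isNodalBasis_nodal (h : IsNodalBasis kind s lam) : IsNodalBasis kind s (nodal kind s) where
  mem v _ := (interp_spec h _).1
  delta v hv w hw := by rw [pval_nodal h hv, h.delta v hv w hw]
  repro p hp x := by
    rw [h.repro p hp]
    exact Finset.sum_congr rfl fun v hv => by rw [pval_nodal h hv]

lemma C_mem_polySpace (c : ℝ) : MvPolynomial.C c ∈ polySpace d kind 1 := by
  cases kind with
  | simplicial => exact (MvPolynomial.mem_restrictTotalDegree _ _ _).2 (by simp)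
  | cubic =>
    refine MvPolynomial.restrictTotalDegree_le_restrictDegree (σ := Fin d) (R := ℝ) (m := 1) ?_
    exact (MvPolynomial.mem_restrictTotalDegree _ _ _).2 (by simp)

lemma X_mem_polySpace (i : Fin d) : MvPolynomial.X i ∈ polySpace d kind 1 := by
  cases kind with
  | simplicial => exact (MvPolynomial.mem_restrictTotalDegree _ _ _).2 (by simp)
  | cubic =>
    refine MvPolynomial.restrictTotalDegree_le_restrictDegree (σ := Fin d) (R := ℝ) (m := 1) ?_
    exact (MvPolynomial.mem_restrictTotalDegree _ _ _).2 (by simp)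

/-- The constant 1 belongs to the local space, so it is reproduced; the same argument with the
coordinate functions gives `IsNodalBasis.sum_smul`. Where nonnegative, the nodal values are thus
weights of a convex combination of the vertices. -/
lemma IsNodalBasis.sum_eq_one (h : IsNodalBasis kind s lam) (x : Sp d) :
    ∑ v ∈ s, pval (lam v) x = 1 := by
  have := h.repro _ (C_mem_polySpace 1) x
  simp only [pval_C, one_mul] at this
  exact this.symm

lemma IsNodalBasis.sum_smul (h : IsNodalBasis kind s lam) (x : Sp d) :
    ∑ v ∈ s, pval (lam v) x • v = x := by
  ext i
  have := h.repro _ (X_mem_polySpace i) x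
  simp only [pval_X] at this
  rw [this]
  simp [mul_comm]

lemma IsNodalBasis.sum_affine (h : IsNodalBasis kind s lam) (ℓ : Sp d →ᵃ[ℝ] ℝ) (x : Sp d) :
    ∑ v ∈ s, pval (lam v) x * ℓ v = ℓ x := by
  have e : ∀ y, ℓ y = ℓ.linear y + ℓ 0 := fun y => by
    have := ℓ.linearMap_vsub y 0
    simp only [vsub_eq_sub, sub_zero] at this
    rw [this]; ring
  calc ∑ v ∈ s, pval (lam v) x * ℓ v
      = ∑ v ∈ s, (ℓ.linear (pval (lam v) x • v) + pval (lam v) x * ℓ 0) :=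
        Finset.sum_congr rfl fun v _ => by rw [e v, map_smul, smul_eq_mul, mul_add]
    _ = ℓ x := by
        rw [Finset.sum_add_distrib, ← map_sum, h.sum_smul, ← Finset.sum_mul, h.sum_eq_one,
          one_mul, ← e]

lemma mem_elem_of_nonneg (h : IsNodalBasis kind s lam) {x : Sp d}
    (hx : ∀ v ∈ s, 0 ≤ pval (lam v) x) : x ∈ elem s :=
  Finset.mem_convexHull'.2 ⟨fun v => pval (lam v) x, hx, h.sum_eq_one x, h.sum_smul x⟩

/-- A description of an element by its facets. -/
structure IsFacetSystem (kind : MeshKind) (s : Finset (Sp d)) (F : Set (Sp d →ᵃ[ℝ] ℝ)) :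
    Prop where
  finite : F.Finite
  elem_eq : elem s = {x | ∀ ℓ ∈ F, 0 ≤ ℓ x}
  exists_dir : ∀ ℓ ∈ F, ∃ a, ℓ.linear a = 1 ∧ ∀ m ∈ F, m ≠ ℓ → m.linear a ≤ 0
  exists_sep : ∀ ℓ ∈ F, ∀ m ∈ F, ℓ ≠ m → ∀ x ∈ elem s, ℓ x = 0 → m x = 0 →
    ∃ a, ℓ.linear a ≠ 0 ∧ m.linear a = 0
  nodal_pos : ∀ v ∈ s, ∀ x ∈ elem s, (∀ ℓ ∈ F, 0 < ℓ v → 0 < ℓ x) → 0 < pval (nodal kind s v) x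

/-- What is used of an element: its local basis and its facets. -/
structure IsGoodElement (kind : MeshKind) (s : Finset (Sp d)) : Prop where
  basis : IsNodalBasis kind s (nodal kind s)
  nonneg : ∀ v ∈ s, ∀ x ∈ elem s, 0 ≤ pval (nodal kind s v) x
  facets : ∃ F, IsFacetSystem kind s F

end

/-! ### Simplices and cubes: nodal bases, facets and agreement on common faces. -/

section

variable {d : ℕ} {s t : Finset (Sp d)}

/-! ### Simplices -/

/-- The polynomial of an affine function. -/
def affPoly (f : Sp d →ᵃ[ℝ] ℝ) : MvPolynomial (Fin d) ℝ :=
  MvPolynomial.C (f 0) +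
    ∑ i, f.linear (EuclideanSpace.single i 1) • MvPolynomial.X i

lemma affineMap_eq (f : Sp d →ᵃ[ℝ] ℝ) (x : Sp d) : f x = f.linear x + f 0 := by
  have := f.linearMap_vsub x 0
  simp only [vsub_eq_sub, sub_zero] at this
  rw [this]; ring

lemma pval_affPoly (f : Sp d →ᵃ[ℝ] ℝ) (x : Sp d) : pval (affPoly f) x = f x := by
  have hx : x = ∑ i, x i • EuclideanSpace.single i (1 : ℝ) := by
    ext j
    simp [Pi.single_apply]
  have : f.linear x = ∑ i, x i * f.linear (EuclideanSpace.single i 1) := by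
    conv_lhs => rw [hx]
    rw [map_sum]
    simp
  rw [affineMap_eq f x, this, affPoly, pval_add, pval_sum, pval_C, add_comm]
  congr 1
  exact Finset.sum_congr rfl fun i _ => by rw [pval_smul, pval_X, mul_comm]

lemma affPoly_mem (f : Sp d →ᵃ[ℝ] ℝ) : affPoly f ∈ polySpace d .simplicial 1 :=
  Submodule.add_mem _ (C_mem_polySpace _)
    (Submodule.sum_mem _ fun i _ => Submodule.smul_mem _ _ (X_mem_polySpace i))

/-- A monomial of total degree at most 1 is either 1 or a coordinate, and both commute with
combinations of weights summing to 1. -/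
lemma prod_pow_combination {m : Fin d →₀ ℕ} (hm : (m.sum fun _ e => e) ≤ 1) {ι : Type*}
    (I : Finset ι) (μ : ι → ℝ) (y : ι → Sp d) (h1 : ∑ i ∈ I, μ i = 1) :
    ∏ j, (∑ i ∈ I, μ i • y i) j ^ m j = ∑ i ∈ I, μ i * ∏ j, (y i) j ^ m j := by
  by_cases h0 : m = 0
  · simp [h0, h1]
  · obtain ⟨j, hj⟩ := Finsupp.ne_iff.1 h0
    rw [Finsupp.sum_fintype _ _ (by simp)] at hm
    have hjm : m j = 1 := by
      have := (Finset.single_le_sum (f := fun i => m i) (fun i _ => Nat.zero_le _)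
        (Finset.mem_univ j)).trans hm
      simp only [Finsupp.coe_zero, Pi.zero_apply, ne_eq] at hj
      omega
    have hk : ∀ k, k ≠ j → m k = 0 := by
      intro k hk
      have h2 : m k + m j ≤ ∑ i, m i := by
        rw [← Finset.sum_pair hk]
        exact Finset.sum_le_sum_of_subset (Finset.subset_univ _)
      omega
    have hp : ∀ x : Sp d, ∏ i, x i ^ m i = x j := by
      intro x
      rw [Finset.prod_eq_single j (fun k _ hkj => by simp [hk k hkj]) (by simp), hjm, pow_one]
    simp only [hp]
    simp

lemma pval_combination {p : MvPolynomial (Fin d) ℝ} (hp : p ∈ polySpace d .simplicial 1)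
    {ι : Type*} (I : Finset ι) (μ : ι → ℝ) (y : ι → Sp d) (h1 : ∑ i ∈ I, μ i = 1) :
    pval p (∑ i ∈ I, μ i • y i) = ∑ i ∈ I, μ i * pval p (y i) := by
  have hdeg := (MvPolynomial.mem_restrictTotalDegree _ _ _).1 hp
  simp only [pval_eq, Finset.mul_sum]
  rw [Finset.sum_comm]
  refine Finset.sum_congr rfl fun m hm => ?_
  rw [prod_pow_combination ((MvPolynomial.le_totalDegree hm).trans hdeg) I μ y h1, Finset.mul_sum]
  exact Finset.sum_congr rfl fun i _ => by ring

/-- The barycentric coordinate system of a simplex. -/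
def simplexBasis (hs : IsElement .simplicial s) : AffineBasis s ℝ (Sp d) :=
  ⟨fun v => v, hs.2, by
    rw [hs.2.affineSpan_eq_top_iff_card_eq_finrank_add_one]
    simp [hs.1]⟩

lemma simplexBasis_apply (hs : IsElement .simplicial s) (v : s) :
    simplexBasis hs v = (v : Sp d) := rfl

lemma range_simplexBasis (hs : IsElement .simplicial s) :
    Set.range (simplexBasis hs) = (s : Set (Sp d)) := by
  ext x
  exact ⟨fun ⟨v, hv⟩ => hv ▸ v.2, fun hx => ⟨⟨x, hx⟩, rfl⟩⟩

lemma elem_simplex (hs : IsElement .simplicial s) :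
    elem s = {x | ∀ v : s, 0 ≤ (simplexBasis hs).coord v x} := by
  rw [elem, ← range_simplexBasis hs, AffineBasis.convexHull_eq_nonneg_coord]

open Classical in
/-- The barycentric coordinates as polynomials. -/
def simplexLam (hs : IsElement .simplicial s) (v : Sp d) : MvPolynomial (Fin d) ℝ :=
  if h : v ∈ s then affPoly ((simplexBasis hs).coord ⟨v, h⟩) else 0

lemma pval_simplexLam (hs : IsElement .simplicial s) (v : s) (x : Sp d) :
    pval (simplexLam hs v) x = (simplexBasis hs).coord v x := by
  simp [simplexLam, pval_affPoly]

lemma isNodalBasis_simplex (hs : IsElement .simplicial s) :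
    IsNodalBasis .simplicial s (simplexLam hs) where
  mem v hv := by
    simp only [simplexLam, hv, dif_pos]
    exact affPoly_mem _
  delta v hv w hw := by
    classical
    have h1 := pval_simplexLam hs ⟨v, hv⟩ w
    have h2 := (simplexBasis hs).coord_apply ⟨v, hv⟩ ⟨w, hw⟩
    rw [simplexBasis_apply] at h2
    rw [h1, h2]
    simp
  repro p hp x := by
    have h1 := (simplexBasis hs).sum_coord_apply_eq_one x
    have h2 := (simplexBasis hs).linear_combination_coord_eq_self x
    conv_lhs => rw [← h2]
    rw [pval_combination hp _ _ _ h1, ← Finset.sum_coe_sort s]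
    refine Finset.sum_congr rfl fun v _ => ?_
    rw [pval_simplexLam, simplexBasis_apply, mul_comm]

/-- The barycentric coordinates serve both as nodal basis and as facet functions. The direction for
facet i is an edge vector b_i - b_k: it raises coordinate i, lowers coordinate k and leaves the
others fixed. If two facets i and j meet at x, some coordinate k of x is nonzero, hence k differs
from both, and b_i - b_k changes coordinate i but not coordinate j. -/
lemma isGoodElement_simplex (hd : 1 ≤ d) (hs : IsElement .simplicial s) :
    IsGoodElement .simplicial s := by
  classical
  let b := simplexBasis hs
  have hnod : ∀ (v : s) x, pval (nodal .simplicial s v) x = b.coord v x := fun v x => by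
    rw [pval_nodal (isNodalBasis_simplex hs) v.2, pval_simplexLam]
  have hlin : ∀ i j k : s, (b.coord i).linear (b j - b k)
      = (if i = j then 1 else 0) - (if i = k then 1 else 0) := by
    intro i j k
    rw [← b.coord_apply, ← b.coord_apply]
    exact (b.coord i).linearMap_vsub (b j) (b k)
  refine ⟨isNodalBasis_nodal (isNodalBasis_simplex hs), fun v hv x hx => ?_,
    Set.range b.coord, ?_, ?_, ?_, ?_, ?_⟩
  · rw [elem_simplex hs] at hx
    rw [hnod ⟨v, hv⟩]
    exact hx ⟨v, hv⟩
  · exact Set.finite_range _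
  · rw [elem_simplex hs]
    ext x
    exact (Set.forall_mem_range (f := b.coord) (p := fun ℓ => 0 ≤ ℓ x)).symm
  · rintro _ ⟨i, rfl⟩
    have : ∃ k : s, k ≠ i := by
      have : 1 < Fintype.card s := by rw [Fintype.card_coe, hs.1]; omega
      exact Fintype.exists_ne_of_one_lt_card this i
    obtain ⟨k, hk⟩ := this
    refine ⟨b i - b k, by rw [hlin]; simp [hk.symm], ?_⟩
    rintro _ ⟨j, rfl⟩ hj
    have hji : j ≠ i := fun h => hj (by rw [h])
    rw [hlin, if_neg hji]
    split_ifs <;> norm_num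
  · rintro _ ⟨i, rfl⟩ _ ⟨j, rfl⟩ hij x _ hi hj
    have hij' : i ≠ j := fun h => hij (by rw [h])
    obtain ⟨k, hk⟩ : ∃ k, b.coord k x ≠ 0 := by
      by_contra! h
      have := b.sum_coord_apply_eq_one x
      simp [h] at this
    have hki : i ≠ k := fun h => hk (h ▸ hi)
    have hkj : j ≠ k := fun h => hk (h ▸ hj)
    refine ⟨b i - b k, by rw [hlin]; simp [hki], by rw [hlin]; simp [hij'.symm, hkj]⟩
  · intro v hv x _ h
    rw [hnod ⟨v, hv⟩]
    refine h _ ⟨⟨v, hv⟩, rfl⟩ ?_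
    have := b.coord_apply ⟨v, hv⟩ ⟨v, hv⟩
    rw [if_pos rfl] at this
    have h2 : b ⟨v, hv⟩ = v := rfl
    rw [h2] at this
    rw [this]
    exact one_pos

/-- A point of the common face is a convex combination of common vertices, and the nodal function of
v takes there the weight of v, whichever simplex is used; the weight is zero when v is not a common
vertex. -/
lemma simplex_compat (hs : IsElement .simplicial s) (ht : IsElement .simplicial t) {x : Sp d}
    (hx : x ∈ convexHull ℝ ((s : Set (Sp d)) ∩ (t : Set (Sp d)))) {v : Sp d} (hv : v ∈ s)
    (hne : pval (nodal .simplicial s v) x ≠ 0) :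
    v ∈ t ∧ pval (nodal .simplicial t v) x = pval (nodal .simplicial s v) x := by
  classical
  rw [← Finset.coe_inter] at hx
  obtain ⟨μ, -, h1, rfl⟩ := Finset.mem_convexHull'.1 hx
  have key : ∀ r : Finset (Sp d), IsElement .simplicial r → s ∩ t ⊆ r → v ∈ r →
      pval (nodal .simplicial r v) (∑ y ∈ s ∩ t, μ y • y) = if v ∈ s ∩ t then μ v else 0 := by
    intro r hr hsub hvr
    have hB := isNodalBasis_nodal (isNodalBasis_simplex hr)
    rw [pval_combination (hB.mem v hvr) _ _ _ h1,
      Finset.sum_congr rfl fun y hy => by rw [hB.delta v hvr y (hsub hy)]]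
    simp
  have hvt : v ∈ s ∩ t := by
    by_contra h
    rw [key s hs Finset.inter_subset_left hv, if_neg h] at hne
    exact hne rfl
  have hvt' := (Finset.mem_inter.1 hvt).2
  exact ⟨hvt', by rw [key s hs Finset.inter_subset_left hv, key t ht Finset.inter_subset_right hvt']⟩

/-! ### Cubes -/

/-- `s` is the vertex set of the cube with lower corner `a` and side `h`. -/
def IsCube (s : Finset (Sp d)) (a : Sp d) (h : ℝ) : Prop :=
  0 < h ∧ ∀ x, x ∈ s ↔ ∀ i, x i = a i ∨ x i = a i + h

lemma exists_isCube (hs : IsElement .cubic s) : ∃ a h, IsCube s a h := by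
  obtain ⟨a, h, h0, he⟩ := hs
  refine ⟨a, h, h0, fun x => ?_⟩
  rw [← Finset.mem_coe, he]
  rfl

open Classical in
/-- One-dimensional factor of a nodal function of a cube. -/
def cubeFactor (a h v x : ℝ) : ℝ := if v = a then 1 - (x - a) / h else (x - a) / h

open Classical in
/-- The nodal basis of a cube. -/
def cubeLam (a : Sp d) (h : ℝ) (v : Sp d) : MvPolynomial (Fin d) ℝ :=
  ∏ i, if v i = a i then MvPolynomial.C (-h⁻¹) * MvPolynomial.X i + MvPolynomial.C (1 + a i / h)
    else MvPolynomial.C h⁻¹ * MvPolynomial.X i + MvPolynomial.C (- a i / h)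

lemma pval_cubeLam (a : Sp d) (h : ℝ) (v x : Sp d) :
    pval (cubeLam a h v) x = ∏ i, cubeFactor (a i) h (v i) (x i) := by
  rw [cubeLam, pval_prod]
  refine Finset.prod_congr rfl fun i _ => ?_
  unfold cubeFactor
  split_ifs <;> simp only [pval_add, pval_mul, pval_C, pval_X] <;> ring

lemma degreeOf_linear_le (c e : ℝ) (i j : Fin d) :
    MvPolynomial.degreeOf i (MvPolynomial.C c * MvPolynomial.X j + MvPolynomial.C e) ≤
      if i = j then 1 else 0 := by
  refine (MvPolynomial.degreeOf_add_le _ _ _).trans (max_le ?_ ?_)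
  · refine (MvPolynomial.degreeOf_C_mul_le _ _ _).trans ?_
    rw [MvPolynomial.degreeOf_X]
  · rw [MvPolynomial.degreeOf_C]
    exact Nat.zero_le _

lemma cubeLam_mem (a : Sp d) (h : ℝ) (v : Sp d) : cubeLam a h v ∈ polySpace d .cubic 1 := by
  refine (MvPolynomial.mem_restrictDegree _ _ _).2 fun m hm i => ?_
  refine MvPolynomial.degreeOf_le_iff.1 ?_ m hm
  refine (MvPolynomial.degreeOf_prod_le _ _ _).trans ?_
  refine (Finset.sum_le_sum (g := fun j => if i = j then 1 else 0) fun j _ => ?_).trans (by simp)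
  split_ifs with h1 h2 h2
  · subst h2
    exact (degreeOf_linear_le _ _ _ _).trans (by simp)
  · exact (degreeOf_linear_le _ _ _ _).trans (by simp [h2])
  · subst h2
    exact (degreeOf_linear_le _ _ _ _).trans (by simp)
  · exact (degreeOf_linear_le _ _ _ _).trans (by simp [h2])

/-- Expanding the product chooses one endpoint per coordinate, that is, a vertex. -/
lemma sum_cube {a : Sp d} {h : ℝ} (hs : IsCube s a h) (f : Fin d → ℝ → ℝ) :
    ∑ v ∈ s, ∏ i, f i (v i) = ∏ i, (f i (a i) + f i (a i + h)) := by
  classical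
  have h1 : ∏ i, (f i (a i) + f i (a i + h))
      = ∏ i, ∑ y ∈ ({a i, a i + h} : Finset ℝ), f i y := by
    refine Finset.prod_congr rfl fun i _ => ?_
    rw [Finset.sum_pair]
    have := hs.1
    intro hh; linarith
  rw [h1, Finset.prod_univ_sum]
  refine Finset.sum_bij (fun v _ => fun i => v i) ?_ ?_ ?_ ?_
  · intro v hv
    rw [Fintype.mem_piFinset]
    intro i
    simpa using (hs.2 v).1 hv i
  · intro v _ w _ hvw
    ext i
    exact congrFun hvw i
  · intro y hy
    rw [Fintype.mem_piFinset] at hy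
    refine ⟨WithLp.toLp 2 y, (hs.2 _).2 fun i => ?_, rfl⟩
    simpa using hy i
  · intro v _
    rfl

lemma isNodalBasis_cube {a : Sp d} {h : ℝ} (hs : IsCube s a h) :
    IsNodalBasis .cubic s (cubeLam a h) where
  mem v _ := cubeLam_mem a h v
  delta v hv w hw := by
    have h0 := hs.1.ne'
    rw [pval_cubeLam]
    split_ifs with hvw
    · subst hvw
      refine Finset.prod_eq_one fun i _ => ?_
      unfold cubeFactor
      rcases (hs.2 v).1 hv i with hi | hi
      · simp [hi]
      · rw [if_neg (by rw [hi]; intro hh; exact h0 (by linarith)), hi]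
        field_simp
        ring
    · obtain ⟨i, hi⟩ : ∃ i, v i ≠ w i := by
        by_contra! hh
        exact hvw (by ext i; exact hh i)
      refine Finset.prod_eq_zero (Finset.mem_univ i) ?_
      unfold cubeFactor
      rcases (hs.2 v).1 hv i with hv' | hv' <;> rcases (hs.2 w).1 hw i with hw' | hw'
      · exact absurd (hv'.trans hw'.symm) hi
      · rw [if_pos hv', hw']; field_simp; ring
      · rw [if_neg (by rw [hv']; intro hh; exact h0 (by linarith)), hw']; simp
      · exact absurd (hv'.trans hw'.symm) hi
  repro p hp x := by
    have h0 := hs.1.ne'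
    have hdeg := (MvPolynomial.mem_restrictDegree _ _ _).1 hp
    simp only [pval_cubeLam, pval_eq p, Finset.sum_mul]
    rw [Finset.sum_comm]
    refine Finset.sum_congr rfl fun m hm => ?_
    -- The vertex sum of a monomial factorizes, leaving in each variable the linear interpolation of
    -- 1 or of the coordinate, which is exact.
    have := sum_cube hs (fun i y => y ^ m i * cubeFactor (a i) h y (x i))
    simp only [mul_assoc, ← Finset.prod_mul_distrib, ← Finset.mul_sum]
    rw [this]
    congr 1
    refine Finset.prod_congr rfl fun i _ => ?_
    have hm1 := hdeg m hm i
    have hah : a i + h ≠ a i := fun hh => h0 (by linarith)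
    unfold cubeFactor
    rw [if_pos rfl, if_neg hah]
    interval_cases m i
    · field_simp; ring
    · field_simp; ring

lemma elem_cube {a : Sp d} {h : ℝ} (hs : IsCube s a h) :
    elem s = {x | ∀ i, a i ≤ x i ∧ x i ≤ a i + h} := by
  refine Set.Subset.antisymm (convexHull_min ?_ ?_) fun x hx => ?_
  · intro x hx i
    have := hs.1
    rcases (hs.2 x).1 hx i with h | h <;> rw [h] <;> constructor <;> linarith
  · have : {x : Sp d | ∀ i, a i ≤ x i ∧ x i ≤ a i + h}
        = ⋂ i, (EuclideanSpace.proj (𝕜 := ℝ) i : Sp d →L[ℝ] ℝ) ⁻¹' Set.Icc (a i) (a i + h) := by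
      ext x; simp
    rw [this]
    exact convex_iInter fun i =>
      (convex_Icc _ _).linear_preimage (EuclideanSpace.proj (𝕜 := ℝ) i).toLinearMap
  · refine mem_elem_of_nonneg (isNodalBasis_cube hs) fun v _ => ?_
    rw [pval_cubeLam]
    refine Finset.prod_nonneg fun i _ => ?_
    have h1 := hx i
    have h2 := hs.1
    unfold cubeFactor
    split_ifs
    · rw [sub_nonneg, div_le_one h2]; linarith
    · exact div_nonneg (by linarith) h2.le

/-- The affine functions whose positivity describes a cube. -/
def cubeFacet (a : Sp d) (h : ℝ) : Fin d × Bool → (Sp d →ᵃ[ℝ] ℝ)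
  | (i, false) => (EuclideanSpace.proj (𝕜 := ℝ) i).toLinearMap.toAffineMap -
      AffineMap.const ℝ (Sp d) (a i)
  | (i, true) => AffineMap.const ℝ (Sp d) (a i + h) -
      (EuclideanSpace.proj (𝕜 := ℝ) i).toLinearMap.toAffineMap

lemma cubeFacet_false (a : Sp d) (h : ℝ) (i : Fin d) (x : Sp d) :
    cubeFacet a h (i, false) x = x i - a i := by simp [cubeFacet]

lemma cubeFacet_true (a : Sp d) (h : ℝ) (i : Fin d) (x : Sp d) :
    cubeFacet a h (i, true) x = a i + h - x i := by simp [cubeFacet]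

lemma cubeFacet_linear_false (a : Sp d) (h : ℝ) (i : Fin d) (x : Sp d) :
    (cubeFacet a h (i, false)).linear x = x i := by simp [cubeFacet]

lemma cubeFacet_linear_true (a : Sp d) (h : ℝ) (i : Fin d) (x : Sp d) :
    (cubeFacet a h (i, true)).linear x = - x i := by simp [cubeFacet]

/-- The facets are the two bounds on each coordinate, with the coordinate vectors and their
negatives as directions. Opposite facets have opposite linear parts and cannot be separated by a
direction, but they never meet, which is why separation is only demanded of facets with a common
point. -/
lemma isGoodElement_cube (hs : IsElement .cubic s) : IsGoodElement .cubic s := by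
  classical
  obtain ⟨a, h, hc⟩ := exists_isCube hs
  have h0 := hc.1
  have hnod : ∀ v ∈ s, ∀ x, pval (nodal .cubic s v) x = ∏ i, cubeFactor (a i) h (v i) (x i) :=
    fun v hv x => by rw [pval_nodal (isNodalBasis_cube hc) hv, pval_cubeLam]
  refine ⟨isNodalBasis_nodal (isNodalBasis_cube hc), fun v hv x hx => ?_,
    Set.range (cubeFacet a h), Set.finite_range _, ?_, ?_, ?_, ?_⟩
  · rw [elem_cube hc] at hx
    rw [hnod v hv]
    refine Finset.prod_nonneg fun i _ => ?_
    have h1 := hx i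
    unfold cubeFactor
    split_ifs
    · rw [sub_nonneg, div_le_one h0]; linarith
    · exact div_nonneg (by linarith) h0.le
  · rw [elem_cube hc]
    ext x
    constructor
    · rintro hx _ ⟨⟨i, _ | _⟩, rfl⟩
      · rw [cubeFacet_false]; linarith [(hx i).1]
      · rw [cubeFacet_true]; linarith [(hx i).2]
    · intro hx i
      have h1 := hx _ ⟨(i, false), rfl⟩
      have h2 := hx _ ⟨(i, true), rfl⟩
      rw [cubeFacet_false] at h1
      rw [cubeFacet_true] at h2
      constructor <;> linarith
  · rintro _ ⟨⟨i, _ | _⟩, rfl⟩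
    · refine ⟨EuclideanSpace.single i 1, by simp [cubeFacet_linear_false], ?_⟩
      rintro _ ⟨⟨j, _ | _⟩, rfl⟩ hj
      · have : j ≠ i := fun hh => hj (by rw [hh])
        simp [cubeFacet_linear_false, this]
      · rw [cubeFacet_linear_true, PiLp.single_apply]; split_ifs <;> norm_num
    · refine ⟨-EuclideanSpace.single i 1, by simp [cubeFacet_linear_true], ?_⟩
      rintro _ ⟨⟨j, _ | _⟩, rfl⟩ hj
      · rw [cubeFacet_linear_false, PiLp.neg_apply, PiLp.single_apply]
        split_ifs <;> norm_num
      · have : j ≠ i := fun hh => hj (by rw [hh])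
        simp [cubeFacet_linear_true, this]
  · rintro _ ⟨⟨i, bi⟩, rfl⟩ _ ⟨⟨j, bj⟩, rfl⟩ hij x _ hi hj
    have hne : j ≠ i := by
      rintro rfl
      rcases bi with _ | _ <;> rcases bj with _ | _
      · exact hij rfl
      · rw [cubeFacet_false] at hi; rw [cubeFacet_true] at hj; linarith
      · rw [cubeFacet_true] at hi; rw [cubeFacet_false] at hj; linarith
      · exact hij rfl
    refine ⟨EuclideanSpace.single i 1, ?_, ?_⟩
    · rcases bi with _ | _
      · simp [cubeFacet_linear_false]
      · simp [cubeFacet_linear_true]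
    · rcases bj with _ | _
      · simp [cubeFacet_linear_false, hne]
      · simp [cubeFacet_linear_true, hne]
  · intro v hv x _ hpos
    rw [hnod v hv]
    refine Finset.prod_pos fun i _ => ?_
    unfold cubeFactor
    split_ifs with hvi
    · have := hpos _ ⟨(i, true), rfl⟩ (by rw [cubeFacet_true, hvi]; linarith)
      rw [cubeFacet_true] at this
      rw [sub_pos, div_lt_one h0]; linarith
    · have hv2 : v i = a i + h := ((hc.2 v).1 hv i).resolve_left hvi
      have := hpos _ ⟨(i, false), rfl⟩ (by rw [cubeFacet_false, hv2]; linarith)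
      rw [cubeFacet_false] at this
      exact div_pos this h0

lemma coord_eq_of_mem_convexHull {C : Set (Sp d)} {i : Fin d} {c : ℝ} (h : ∀ v ∈ C, v i = c)
    {x : Sp d} (hx : x ∈ convexHull ℝ C) : x i = c := by
  have h1 : convexHull ℝ C ⊆ (EuclideanSpace.proj (𝕜 := ℝ) i : Sp d →L[ℝ] ℝ) ⁻¹' {c} :=
    convexHull_min (fun v hv => by simpa using h v hv)
      ((convex_singleton c).linear_preimage (EuclideanSpace.proj (𝕜 := ℝ) i).toLinearMap)
  simpa using h1 hx

/-- Argue coordinate by coordinate. If all common vertices share their i-th coordinate, x has it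
too, and nonvanishing of the factor forces v to have it, so both factors equal 1. Otherwise two
common vertices differ in coordinate i, so both cubes have the same i-th interval and the factors
coincide. -/
lemma cube_compat (hs : IsElement .cubic s) (ht : IsElement .cubic t) {x : Sp d}
    (hx : x ∈ convexHull ℝ ((s : Set (Sp d)) ∩ (t : Set (Sp d)))) {v : Sp d} (hv : v ∈ s)
    (hne : pval (nodal .cubic s v) x ≠ 0) :
    v ∈ t ∧ pval (nodal .cubic t v) x = pval (nodal .cubic s v) x := by
  obtain ⟨a, h, hc⟩ := exists_isCube hs
  obtain ⟨b, k, hb⟩ := exists_isCube ht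
  have hh := hc.1
  have hk := hb.1
  obtain ⟨c0, hc0⟩ : ((s : Set (Sp d)) ∩ (t : Set (Sp d))).Nonempty :=
    convexHull_nonempty_iff.1 ⟨x, hx⟩
  have hc0s : c0 ∈ s := hc0.1
  have hc0t : c0 ∈ t := hc0.2
  rw [pval_nodal (isNodalBasis_cube hc) hv, pval_cubeLam] at hne ⊢
  have hfac : ∀ i, cubeFactor (a i) h (v i) (x i) ≠ 0 := fun i hi =>
    hne (Finset.prod_eq_zero (Finset.mem_univ i) hi)
  have key : ∀ i, (v i = b i ∨ v i = b i + k) ∧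
      cubeFactor (b i) k (v i) (x i) = cubeFactor (a i) h (v i) (x i) := by
    intro i
    by_cases hi : ∀ w ∈ (s : Set (Sp d)) ∩ (t : Set (Sp d)), w i = c0 i
    · have hxi := coord_eq_of_mem_convexHull hi hx
      have hca := (hc.2 c0).1 hc0s i
      have hcb := (hb.2 c0).1 hc0t i
      have hvi := (hc.2 v).1 hv i
      have f1 := hfac i
      have hvc : v i = c0 i := by
        unfold cubeFactor at f1
        rw [hxi] at f1
        rcases hvi with h1 | h1 <;> rcases hca with h2 | h2
        · rw [h1, h2]
        · rw [if_pos h1, h2] at f1; exfalso; apply f1; field_simp; ring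
        · rw [if_neg (by rw [h1]; linarith), h2] at f1; exfalso; apply f1; simp
        · rw [h1, h2]
      have one : ∀ (e l : ℝ), 0 < l → (c0 i = e ∨ c0 i = e + l) →
          cubeFactor e l (c0 i) (c0 i) = 1 := by
        intro e l hl hel
        unfold cubeFactor
        rcases hel with h1 | h1
        · simp [h1]
        · rw [if_neg (by rw [h1]; linarith), h1]; field_simp; ring
      rw [hvc, hxi, one _ _ hh hca, one _ _ hk hcb]
      exact ⟨hcb, rfl⟩
    · push Not at hi
      obtain ⟨c1, hc1, hne1⟩ := hi
      have p1 := (hc.2 c0).1 hc0s i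
      have p2 := (hb.2 c0).1 hc0t i
      have p3 := (hc.2 c1).1 hc1.1 i
      have p4 := (hb.2 c1).1 hc1.2 i
      have hab : a i = b i ∧ h = k := by
        rcases p1 with p1 | p1 <;> rcases p2 with p2 | p2 <;> rcases p3 with p3 | p3 <;>
          rcases p4 with p4 | p4 <;>
          first
          | (exfalso; apply hne1; linarith)
          | exact ⟨by linarith, by linarith⟩
      rw [← hab.1, ← hab.2]
      exact ⟨(hc.2 v).1 hv i, rfl⟩
  have hvt : v ∈ t := (hb.2 v).2 fun i => (key i).1
  refine ⟨hvt, ?_⟩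
  rw [pval_nodal (isNodalBasis_cube hb) hvt, pval_cubeLam]
  exact Finset.prod_congr rfl fun i _ => (key i).2

/-! ### Both kinds -/

theorem isGoodElement (hd : 1 ≤ d) {kind : MeshKind} (hs : IsElement kind s) :
    IsGoodElement kind s := by
  cases kind with
  | simplicial => exact isGoodElement_simplex hd hs
  | cubic => exact isGoodElement_cube hs

theorem nodal_compat {kind : MeshKind} (hs : IsElement kind s) (ht : IsElement kind t) {x : Sp d}
    (hx : x ∈ convexHull ℝ ((s : Set (Sp d)) ∩ (t : Set (Sp d)))) {v : Sp d} (hv : v ∈ s)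
    (hne : pval (nodal kind s v) x ≠ 0) :
    v ∈ t ∧ pval (nodal kind t v) x = pval (nodal kind s v) x := by
  cases kind with
  | simplicial => exact simplex_compat hs ht hx hv hne
  | cubic => exact cube_compat hs ht hx hv hne

end

/-! ### Geometry of conforming meshes and of the boundary. -/

section

variable {d : ℕ} {kind : MeshKind} {s t : Finset (Sp d)} {F : Set (Sp d →ᵃ[ℝ] ℝ)}
  {Ω : Set (Sp d)} {T : Finset (Finset (Sp d))}

/-! ### Elements and their facets -/

lemma isCompact_elem (s : Finset (Sp d)) : IsCompact (elem s) :=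
  s.finite_toSet.isCompact_convexHull ℝ

lemma convex_elem (s : Finset (Sp d)) : Convex ℝ (elem s) := convex_convexHull ℝ _

lemma mem_elem_of_mem {v : Sp d} (hv : v ∈ s) : v ∈ elem s := subset_convexHull ℝ _ hv

lemma continuous_affineMap (ℓ : Sp d →ᵃ[ℝ] ℝ) : Continuous ℓ :=
  AffineMap.continuous_of_finiteDimensional ℓ

lemma affineMap_add (ℓ : Sp d →ᵃ[ℝ] ℝ) (x y : Sp d) : ℓ (x + y) = ℓ x + ℓ.linear y := by
  rw [add_comm, ← vadd_eq_add, ℓ.map_vadd, vadd_eq_add, add_comm]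

lemma affineMap_comb (ℓ : Sp d →ᵃ[ℝ] ℝ) (x y : Sp d) (θ : ℝ) :
    ℓ ((1 - θ) • x + θ • y) = (1 - θ) * ℓ x + θ * ℓ y := by
  rw [affineMap_eq ℓ, affineMap_eq ℓ x, affineMap_eq ℓ y, map_add, map_smul, map_smul,
    smul_eq_mul, smul_eq_mul]
  ring

lemma IsFacetSystem.mem_interior (hF : IsFacetSystem kind s F) {x : Sp d}
    (hx : ∀ ℓ ∈ F, 0 < ℓ x) : x ∈ interior (elem s) := by
  rw [mem_interior_iff_mem_nhds, hF.elem_eq]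
  have : ∀ᶠ y in 𝓝 x, ∀ ℓ ∈ F, 0 < ℓ y :=
    (eventually_all_finite hF.finite).2 fun ℓ hℓ =>
      (continuous_affineMap ℓ).continuousAt.eventually (lt_mem_nhds (hx ℓ hℓ))
  filter_upwards [this] with y hy ℓ hℓ
  exact (hy ℓ hℓ).le

lemma IsFacetSystem.pos_of_mem_interior (hF : IsFacetSystem kind s F) {x : Sp d}
    (hx : x ∈ interior (elem s)) : ∀ ℓ ∈ F, 0 < ℓ x := by
  intro ℓ hℓ
  obtain ⟨a, ha, -⟩ := hF.exists_dir ℓ hℓ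
  have hc : Tendsto (fun τ : ℝ => x + (-τ) • a) (𝓝[>] 0) (𝓝 x) := by
    have : Continuous (fun τ : ℝ => x + (-τ) • a) := by fun_prop
    have h2 := this.tendsto 0
    simp only [neg_zero, zero_smul, add_zero] at h2
    exact h2.mono_left nhdsWithin_le_nhds
  have h1 := hc.eventually (mem_interior_iff_mem_nhds.1 hx)
  obtain ⟨τ, hτ, hτ0⟩ := (h1.and self_mem_nhdsWithin).exists
  have hτ' : x + (-τ) • a ∈ elem s := hτ
  rw [hF.elem_eq] at hτ'
  have h3 := hτ' ℓ hℓ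
  rw [affineMap_add, map_smul, ha, smul_eq_mul, mul_one] at h3
  have : (0 : ℝ) < τ := hτ0
  linarith

/-- Slide the inscribed ball along the direction a of the facet until its centre lies on the
hyperplane. No other facet function increases along a, so moving backwards preserves their
nonnegativity and the disc of radius r cut out there stays in the element. -/
lemma IsFacetSystem.exists_disc (hF : IsFacetSystem kind s F) {c : Sp d} {r : ℝ} (hr : 0 ≤ r)
    (hc : Metric.closedBall c r ⊆ elem s) {ℓ : Sp d →ᵃ[ℝ] ℝ} (hℓ : ℓ ∈ F) :
    ∃ f ∈ elem s, ℓ f = 0 ∧ ∀ p, ℓ p = 0 → dist p f ≤ r → p ∈ elem s := by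
  obtain ⟨a, ha, hm⟩ := hF.exists_dir ℓ hℓ
  have hc0 : c ∈ elem s := hc (Metric.mem_closedBall_self hr)
  have hℓc : 0 ≤ ℓ c := by rw [hF.elem_eq] at hc0; exact hc0 ℓ hℓ
  have key : ∀ p, ℓ p = 0 → dist p (c + (-ℓ c) • a) ≤ r → p ∈ elem s := by
    intro p hp hd
    have hq : p + ℓ c • a ∈ elem s := by
      refine hc ?_
      rw [Metric.mem_closedBall, dist_eq_norm]
      rw [dist_eq_norm] at hd
      convert hd using 2
      module
    rw [hF.elem_eq] at hq ⊢
    intro m hmF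
    by_cases h : m = ℓ
    · rw [h, hp]
    · have h1 := hq m hmF
      rw [affineMap_add, map_smul, smul_eq_mul] at h1
      have h2 := mul_nonpos_of_nonneg_of_nonpos hℓc (hm m hmF h)
      linarith
  have h0 : ℓ (c + (-ℓ c) • a) = 0 := by
    rw [affineMap_add, map_smul, ha, smul_eq_mul]; ring
  exact ⟨c + (-ℓ c) • a, key _ h0 (by simpa using hr), h0, key⟩

lemma volume_zeroSet_affineMap {f : Sp d →ᵃ[ℝ] ℝ} {a : Sp d} (ha : f.linear a ≠ 0) :
    volume {x | f x = 0} = 0 := by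
  let S : AffineSubspace ℝ (Sp d) := (AffineSubspace.mk' (0 : ℝ) ⊥).comap f
  have hS : (S : Set (Sp d)) = {x | f x = 0} := by
    ext x
    simp [S]
  have hne : S ≠ ⊤ := by
    intro h
    have h1 : ∀ x, f x = 0 := fun x => by
      have : x ∈ (S : Set (Sp d)) := by rw [h]; trivial
      rwa [hS] at this
    have := affineMap_add f 0 a
    rw [h1, h1] at this
    exact ha (by linarith)
  rw [← hS]
  exact Measure.addHaar_affineSubspace volume S hne

/-- The union of the translates along a line of the intersection of two facets is a null set. -/
lemma IsFacetSystem.volume_shadow (hF : IsFacetSystem kind s F) {ℓ m : Sp d →ᵃ[ℝ] ℝ} (hℓ : ℓ ∈ F)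
    (hm : m ∈ F) (hne : ℓ ≠ m) (n : Sp d) :
    volume {p : Sp d | ∃ τ : ℝ, p + τ • n ∈ elem s ∧ ℓ (p + τ • n) = 0 ∧ m (p + τ • n) = 0} = 0 := by
  rcases Set.eq_empty_or_nonempty
    {p : Sp d | ∃ τ : ℝ, p + τ • n ∈ elem s ∧ ℓ (p + τ • n) = 0 ∧ m (p + τ • n) = 0} with h | h
  · rw [h, measure_empty]
  obtain ⟨p0, τ0, h1, h2, h3⟩ := h
  obtain ⟨a, ha1, ha2⟩ := hF.exists_sep ℓ hℓ m hm hne _ h1 h2 h3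
  obtain ⟨b, hb1, hb2⟩ := hF.exists_sep m hm ℓ hℓ hne.symm _ h1 h3 h2
  by_cases hn : ℓ.linear n = 0
  · refine measure_mono_null ?_ (volume_zeroSet_affineMap ha1)
    rintro p ⟨τ, -, h4, -⟩
    rw [affineMap_add, map_smul, hn] at h4
    simpa using h4
  -- Eliminating τ from the two affine equations leaves a single one in `p`; it is nondegenerate
  -- because `b` changes `m` but not `ℓ`.
  · let f : Sp d →ᵃ[ℝ] ℝ := m.linear n • ℓ - ℓ.linear n • m
    have hf : f.linear b ≠ 0 := by
      simp [f, hb2, hn, hb1]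
    refine measure_mono_null ?_ (volume_zeroSet_affineMap hf)
    rintro p ⟨τ, -, h4, h5⟩
    rw [affineMap_add, map_smul, smul_eq_mul] at h4 h5
    have e : f p = m.linear n * ℓ p - ℓ.linear n * m p := by simp [f]
    rw [Set.mem_ofPred_eq, e, eq_neg_of_add_eq_zero_left h4, eq_neg_of_add_eq_zero_left h5]
    ring

/-! ### Meshes -/

/-- A Lipschitz domain lies on one side of its boundary, so there are no slits: just below the graph
a boundary point has a neighbourhood free of Ω. -/
lemma interior_closure_eq (hL : IsLipschitzDomain Ω) : interior (closure Ω) = Ω := by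
  refine Set.Subset.antisymm (fun x hx => ?_) (interior_maximal subset_closure hL.isOpen)
  by_contra hxΩ
  have hfr : x ∈ frontier Ω := by
    rw [hL.isOpen.frontier_eq]
    exact ⟨interior_subset hx, hxΩ⟩
  obtain ⟨r, n, L, g, hr, hn, hg, hgraph⟩ := hL.lipschitz_boundary x hfr
  let π : Sp d → Sp d := fun y => y - (inner ℝ n y : ℝ) • n
  have hx0 : inner ℝ n x ≤ g (π x) := by
    by_contra! h
    exact hxΩ ((hgraph x (Metric.mem_ball_self hr)).2 h)
  have hc : Tendsto (fun τ : ℝ => x + (-τ) • n) (𝓝[>] 0) (𝓝 x) := by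
    have : Continuous (fun τ : ℝ => x + (-τ) • n) := by fun_prop
    have h2 := this.tendsto 0
    simp only [neg_zero, zero_smul, add_zero] at h2
    exact h2.mono_left nhdsWithin_le_nhds
  obtain ⟨τ, ⟨hτ1, hτ2⟩, hτ0⟩ := ((hc.eventually ((mem_interior_iff_mem_nhds.1 hx))).and
    (hc.eventually (Metric.ball_mem_nhds x hr))|>.and self_mem_nhdsWithin).exists
  have hτ0' : (0 : ℝ) < τ := hτ0
  have hnn : (inner ℝ n n : ℝ) = 1 := by rw [real_inner_self_eq_norm_sq, hn]; norm_num
  have hπ : π (x + (-τ) • n) = π x := by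
    simp only [π, inner_add_right, inner_smul_right, hnn]
    module
  have hlt : inner ℝ n (x + (-τ) • n) < g (π (x + (-τ) • n)) := by
    rw [hπ, inner_add_right, inner_smul_right, hnn]
    linarith
  have hcont1 : Continuous fun y : Sp d => (inner ℝ n y : ℝ) := by fun_prop
  have hcont2 : Continuous fun y : Sp d => g (π y) := hg.continuous.comp (by fun_prop)
  have hopen : IsOpen {y : Sp d | (inner ℝ n y : ℝ) < g (π y)} := isOpen_lt hcont1 hcont2
  obtain ⟨z, hz, hzΩ⟩ := mem_closure_iff.1 hτ1 _ (hopen.inter Metric.isOpen_ball) ⟨hlt, hτ2⟩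
  have := (hgraph z hz.2).1 hzΩ
  have h2 : (inner ℝ n z : ℝ) < g (π z) := hz.1
  exact lt_asymm this h2

lemma IsMesh.elem_subset (hM : IsMesh kind Ω T) (hs : s ∈ T) : elem s ⊆ closure Ω := by
  rw [← hM.cover]
  exact Set.subset_biUnion_of_mem (u := fun s => elem s) hs

lemma IsMesh.exists_mem (hM : IsMesh kind Ω T) {x : Sp d} (hx : x ∈ closure Ω) :
    ∃ s ∈ T, x ∈ elem s := by
  rw [← hM.cover] at hx
  simpa using hx

lemma IsMesh.good (hM : IsMesh kind Ω T) (hd : 1 ≤ d) (hs : s ∈ T) : IsGoodElement kind s :=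
  isGoodElement hd (hM.isElement s hs)

lemma IsMesh.compat (hM : IsMesh kind Ω T) (hs : s ∈ T) (ht : t ∈ T) {x v : Sp d}
    (hxs : x ∈ elem s) (hxt : x ∈ elem t) (hv : v ∈ s) (hne : pval (nodal kind s v) x ≠ 0) :
    v ∈ t ∧ pval (nodal kind t v) x = pval (nodal kind s v) x :=
  nodal_compat (hM.isElement s hs) (hM.isElement t ht)
    (by rw [← hM.conforming s hs t ht]; exact ⟨hxs, hxt⟩) hv hne

/-- All nodal functions of s are positive at an interior point, so compatibility makes every vertex
of s a vertex of t. -/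
lemma IsMesh.subset_of_interior (hM : IsMesh kind Ω T) (hd : 1 ≤ d) (hs : s ∈ T) (ht : t ∈ T)
    {x : Sp d} (hxs : x ∈ interior (elem s)) (hxt : x ∈ elem t) : s ⊆ t := by
  intro v hv
  obtain ⟨F, hF⟩ := (hM.good hd hs).facets
  have hpos := hF.nodal_pos v hv x (interior_subset hxs)
    fun ℓ hℓ _ => hF.pos_of_mem_interior hxs ℓ hℓ
  exact (hM.compat hs ht (interior_subset hxs) hxt hv hpos.ne').1

/-- A point interior to both elements would make the vertex sets equal. The overlap therefore lies
in the frontiers, which are null sets for convex sets. -/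
lemma IsMesh.volume_inter (hM : IsMesh kind Ω T) (hd : 1 ≤ d) (hs : s ∈ T) (ht : t ∈ T)
    (hne : s ≠ t) : volume (elem s ∩ elem t) = 0 := by
  have : elem s ∩ elem t ⊆ frontier (elem s) ∪ frontier (elem t) := by
    rintro x ⟨hxs, hxt⟩
    rw [(isCompact_elem s).isClosed.frontier_eq, (isCompact_elem t).isClosed.frontier_eq]
    by_contra h
    simp only [Set.mem_union, Set.mem_sdiff, hxs, hxt, true_and, not_or, not_not] at h
    exact hne (Finset.Subset.antisymm (hM.subset_of_interior hd hs ht h.1 hxt)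
      (hM.subset_of_interior hd ht hs h.2 hxs))
  refine measure_mono_null this (measure_union_null ?_ ?_)
  · exact (convex_elem s).addHaar_frontier volume
  · exact (convex_elem t).addHaar_frontier volume

lemma IsMesh.interior_elem_subset (hM : IsMesh kind Ω T) (hL : IsLipschitzDomain Ω) (hs : s ∈ T) :
    interior (elem s) ⊆ Ω := by
  rw [← interior_closure_eq hL]
  exact interior_mono (hM.elem_subset hs)

/-- Interiors of elements lie in Ω, so passing from Ω to its closure adds only parts of element
frontiers, a null set; overlaps are null sets too. -/
lemma IsMesh.restrict_eq (hM : IsMesh kind Ω T) (hd : 1 ≤ d) (hL : IsLipschitzDomain Ω) :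
    (volume.restrict Ω : Measure (Sp d)) = ∑ s ∈ T, volume.restrict (elem s) := by
  have h1 : Ω =ᵐ[volume] closure Ω := by
    refine (ae_le_set.2 ?_).antisymm (ae_le_set.2 ?_)
    · rw [Set.sdiff_eq_empty.2 subset_closure, measure_empty]
    · have : closure Ω \ Ω ⊆ ⋃ s ∈ T, frontier (elem s) := by
        rintro x ⟨hx, hxΩ⟩
        obtain ⟨s, hs, hxs⟩ := hM.exists_mem hx
        refine Set.mem_biUnion hs ?_
        rw [(isCompact_elem s).isClosed.frontier_eq]
        exact ⟨hxs, fun h => hxΩ (hM.interior_elem_subset hL hs h)⟩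
      refine measure_mono_null this ?_
      refine (measure_biUnion_null_iff T.countable_toSet).2 ?_
      exact fun s _ => (convex_elem s).addHaar_frontier volume
  rw [Measure.restrict_congr_set h1, ← hM.cover]
  have h2 : (⋃ s ∈ T, elem s) = ⋃ s : T, elem (s : Finset (Sp d)) := by
    ext x; simp
  rw [h2, Measure.restrict_iUnion_ae, Measure.sum_fintype,
    Finset.sum_coe_sort T fun s => volume.restrict (elem s)]
  · intro a b hab
    exact hM.volume_inter hd a.2 b.2 fun h => hab (Subtype.ext h)
  · exact fun a => (isCompact_elem _).measurableSet.nullMeasurableSet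

/-- Near every boundary point there is a boundary point in the relative interior of a facet. -/
lemma IsMesh.exists_simple_point (hM : IsMesh kind Ω T) (hL : IsLipschitzDomain Ω)
    {F : Finset (Sp d) → Set (Sp d →ᵃ[ℝ] ℝ)} (hF : ∀ s ∈ T, IsFacetSystem kind s (F s))
    {y : Sp d} (hy : y ∈ closure Ω) (hyΩ : y ∉ Ω) {ε : ℝ} (hε : 0 < ε) :
    ∃ x, dist x y < ε ∧ x ∉ Ω ∧ ∃ s ∈ T, x ∈ elem s ∧ ∃ ℓ ∈ F s, ℓ x = 0 ∧
      ∀ m ∈ F s, m ≠ ℓ → 0 < m x := by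
  by_contra! hcon
  obtain ⟨q, hqb, hqΩ⟩ := mem_closure_iff.1 hy _ Metric.isOpen_ball (Metric.mem_ball_self hε)
  obtain ⟨p, hpb, hpΩ⟩ : ∃ p ∈ Metric.ball y ε, p ∉ closure Ω := by
    by_contra! h
    refine hyΩ ?_
    rw [← interior_closure_eq hL]
    exact mem_interior.2 ⟨_, h, Metric.isOpen_ball, Metric.mem_ball_self hε⟩
  let n := q - p
  -- Starting points whose line in direction `n` meets two facets of one element at once. A generic
  -- line from the exterior into Ω avoids such points.
  let Bad : Set (Sp d) := ⋃ s ∈ T, ⋃ ℓ ∈ F s, ⋃ m ∈ {m | m ∈ F s ∧ ℓ ≠ m},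
    {p' : Sp d | ∃ τ : ℝ, p' + τ • n ∈ elem s ∧ ℓ (p' + τ • n) = 0 ∧ m (p' + τ • n) = 0}
  have hBad : volume Bad = 0 := by
    refine (measure_biUnion_null_iff T.countable_toSet).2 fun s hs => ?_
    refine (measure_biUnion_null_iff (hF s hs).finite.countable).2 fun ℓ hℓ => ?_
    refine (measure_biUnion_null_iff
      (((hF s hs).finite.subset fun m hm => hm.1).countable)).2 fun m hm => ?_
    exact (hF s hs).volume_shadow hℓ hm.1 hm.2 n
  -- The segments starting near `p` all lead from outside the closure into Ω. These starting points
  -- form a nonempty open set, which cannot be contained in a null set.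
  have hopen : IsOpen ({p' : Sp d | p' ∈ Metric.ball y ε ∧ p' ∉ closure Ω} ∩
      {p' | p' + n ∈ Metric.ball y ε ∧ p' + n ∈ Ω}) := by
    refine IsOpen.inter (Metric.isOpen_ball.inter isClosed_closure.isOpen_compl) ?_
    exact (Metric.isOpen_ball.inter hL.isOpen).preimage (continuous_add_const n)
  have hpn : p + n = q := by simp [n]
  have hpmem : p ∈ ({p' : Sp d | p' ∈ Metric.ball y ε ∧ p' ∉ closure Ω} ∩
      {p' | p' + n ∈ Metric.ball y ε ∧ p' + n ∈ Ω}) := by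
    refine ⟨⟨hpb, hpΩ⟩, ?_⟩
    rw [Set.mem_ofPred_eq, hpn]
    exact ⟨hqb, hqΩ⟩
  refine (hopen.measure_pos volume ⟨p, hpmem⟩).ne' (measure_mono_null ?_ hBad)
  rintro p' ⟨⟨hp1, hp2⟩, hp3, hp4⟩
  have hseg : Continuous fun τ : ℝ => p' + τ • n := by fun_prop
  have hcpt : IsCompact (Set.Icc (0 : ℝ) 1 ∩ (fun τ : ℝ => p' + τ • n) ⁻¹' closure Ω) :=
    isCompact_Icc.inter_right (isClosed_closure.preimage hseg)
  -- The first point of the closure on the segment: it is not in the open set Ω, since otherwise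
  -- earlier points would be, and so it lies on some facet.
  obtain ⟨τ, ⟨hτI, hτc⟩, hleast⟩ := hcpt.exists_isLeast
    ⟨1, ⟨zero_le_one, le_rfl⟩, by
      rw [Set.mem_preimage, one_smul]; exact subset_closure hp4⟩
  have hτc' : p' + τ • n ∈ closure Ω := hτc
  have hτpos : 0 < τ := by
    rcases hτI.1.eq_or_lt with h | h
    · exfalso
      rw [← h, zero_smul, add_zero] at hτc'
      exact hp2 hτc'
    · exact h
  have hxΩ : p' + τ • n ∉ Ω := by
    intro hx
    have h1 : ∀ᶠ σ in 𝓝[<] τ, p' + σ • n ∈ Ω :=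
      (hseg.continuousAt.eventually (hL.isOpen.mem_nhds hx)).filter_mono nhdsWithin_le_nhds
    have h2 : ∀ᶠ σ in 𝓝[<] τ, 0 < σ := (lt_mem_nhds hτpos).filter_mono nhdsWithin_le_nhds
    obtain ⟨σ, ⟨h3, h4⟩, h5⟩ := ((h1.and h2).and self_mem_nhdsWithin).exists
    have h5' : σ < τ := h5
    have := hleast ⟨⟨h4.le, (h5'.le.trans hτI.2)⟩, subset_closure h3⟩
    linarith
  have hxb : p' + τ • n ∈ Metric.ball y ε := by
    have := (convex_ball y ε) hp1 hp3 (sub_nonneg.2 hτI.2) hτI.1 (by ring)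
    convert this using 1
    module
  obtain ⟨s, hs, hxs⟩ := hM.exists_mem hτc'
  have hℓex : ∃ ℓ ∈ F s, ℓ (p' + τ • n) = 0 := by
    by_contra! h
    refine hxΩ (hM.interior_elem_subset hL hs ((hF s hs).mem_interior fun ℓ hℓ => ?_))
    have h1 := hxs
    rw [(hF s hs).elem_eq] at h1
    exact lt_of_le_of_ne (h1 ℓ hℓ) (h ℓ hℓ).symm
  obtain ⟨ℓ, hℓ, hℓ0⟩ := hℓex
  obtain ⟨m, hm, hmne, hmle⟩ := hcon _ hxb hxΩ s hs hxs ℓ hℓ hℓ0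
  have h1 := hxs
  rw [(hF s hs).elem_eq] at h1
  have hm0 : m (p' + τ • n) = 0 := le_antisymm hmle (h1 m hm)
  simp only [Bad, Set.mem_iUnion]
  exact ⟨s, hs, ℓ, hℓ, m, ⟨hm, hmne.symm⟩, τ, hxs, hℓ0, hm0⟩

/-- A facet whose relative interior meets the boundary does not meet the domain. -/
lemma IsMesh.facet_notMem (hM : IsMesh kind Ω T) (hd : 1 ≤ d) (hL : IsLipschitzDomain Ω)
    (hs : s ∈ T) (hF : IsFacetSystem kind s F) {x : Sp d} (hxs : x ∈ elem s) (hxΩ : x ∉ Ω)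
    {ℓ : Sp d →ᵃ[ℝ] ℝ} (hℓ : ℓ ∈ F) (hℓx : ℓ x = 0) (hmx : ∀ m ∈ F, m ≠ ℓ → 0 < m x)
    {p : Sp d} (hps : p ∈ elem s) (hℓp : ℓ p = 0) : p ∉ Ω := by
  intro hpΩ
  have hG := hM.good hd hs
  -- a point of the domain in the relative interior of the facet
  obtain ⟨x', hx'Ω, hx's, hx'0, hx'm⟩ : ∃ x' ∈ Ω, x' ∈ elem s ∧ ℓ x' = 0 ∧
      ∀ m ∈ F, m ≠ ℓ → 0 < m x' := by
    have hc : Continuous fun θ : ℝ => (1 - θ) • p + θ • x := by fun_prop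
    have h1 : ∀ᶠ θ in 𝓝[>] (0 : ℝ), (1 - θ) • p + θ • x ∈ Ω := by
      refine (hc.continuousAt.eventually (hL.isOpen.mem_nhds ?_)).filter_mono nhdsWithin_le_nhds
      simpa using hpΩ
    have h2 : ∀ᶠ θ in 𝓝[>] (0 : ℝ), θ < 1 := (gt_mem_nhds one_pos).filter_mono nhdsWithin_le_nhds
    obtain ⟨θ, ⟨h3, h4⟩, h5⟩ := ((h1.and h2).and self_mem_nhdsWithin).exists
    have h5' : (0 : ℝ) < θ := h5
    refine ⟨_, h3, convex_elem s hps hxs (sub_nonneg.2 h4.le) h5'.le (by ring), ?_, ?_⟩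
    · rw [affineMap_comb, hℓp, hℓx]; ring
    · intro m hm hne
      rw [affineMap_comb]
      have h6 : 0 ≤ m p := by rw [hF.elem_eq] at hps; exact hps m hm
      have h7 := mul_nonneg (sub_nonneg.2 h4.le) h6
      have h8 := mul_pos h5' (hmx m hm hne)
      linarith
  -- an element on the other side
  obtain ⟨a, ha, -⟩ := hF.exists_dir ℓ hℓ
  obtain ⟨t, ht, hx't, q, hqt, hq⟩ : ∃ t ∈ T, x' ∈ elem t ∧ ∃ q ∈ elem t, ℓ q < 0 := by
    have hc : Continuous fun τ : ℝ => x' + (-τ) • a := by fun_prop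
    have h1 : ∀ᶠ z in 𝓝 x', ∀ t ∈ T, x' ∉ elem t → z ∉ elem t := by
      rw [eventually_all_finset]
      intro t _
      by_cases h : x' ∈ elem t
      · exact Eventually.of_forall fun z hz => absurd h hz
      · filter_upwards [(isCompact_elem t).isClosed.isOpen_compl.mem_nhds h] with z hz _
        exact hz
    have h2 : Tendsto (fun τ : ℝ => x' + (-τ) • a) (𝓝[>] 0) (𝓝 x') := by
      have h2 := hc.tendsto 0
      simp only [neg_zero, zero_smul, add_zero] at h2
      exact h2.mono_left nhdsWithin_le_nhds
    obtain ⟨τ, ⟨h3, h4⟩, h5⟩ := (((h2.eventually h1).and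
      (h2.eventually (hL.isOpen.mem_nhds hx'Ω))).and self_mem_nhdsWithin).exists
    have h5' : (0 : ℝ) < τ := h5
    obtain ⟨t, ht, hmem⟩ := hM.exists_mem (subset_closure h4)
    refine ⟨t, ht, ?_, _, hmem, ?_⟩
    · by_contra h
      exact h3 t ht h hmem
    · rw [affineMap_add, map_smul, ha, hx'0, smul_eq_mul]; linarith
  -- it contains the whole facet
  have hvt : ∀ v ∈ s, ℓ v = 0 → v ∈ t := by
    intro v hv hv0
    have hpos : 0 < pval (nodal kind s v) x' := hF.nodal_pos v hv x' hx's fun m hm hmv =>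
      hx'm m hm fun h => by rw [h, hv0] at hmv; exact lt_irrefl _ hmv
    exact (hM.compat hs ht hx's hx't hv hpos.ne').1
  have hfacet : ∀ f ∈ elem s, ℓ f = 0 → f ∈ elem t := by
    intro f hf hf0
    have hsum := hG.basis.sum_affine ℓ f
    rw [hf0] at hsum
    have hℓv : ∀ v ∈ s, 0 ≤ ℓ v := fun v hv => by
      have := mem_elem_of_mem hv
      rw [hF.elem_eq] at this
      exact this ℓ hℓ
    have hz := (Finset.sum_eq_zero_iff_of_nonneg fun v hv =>
      mul_nonneg (hG.nonneg v hv f hf) (hℓv v hv)).1 hsum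
    rw [← hG.basis.sum_smul f]
    rw [← Finset.sum_filter_of_ne (p := fun v => ℓ v = 0) (fun v hv hne => by
      rcases mul_eq_zero.1 (hz v hv) with h | h
      · rw [h, zero_smul] at hne; exact absurd rfl hne
      · exact h)]
    have hone : ∑ v ∈ s with ℓ v = 0, pval (nodal kind s v) f = 1 := by
      rw [← hG.basis.sum_eq_one f, Finset.sum_filter_of_ne]
      intro v hv hne
      exact (mul_eq_zero.1 (hz v hv)).resolve_left hne
    refine (convex_elem t).sum_mem (fun v hv => hG.nonneg v (Finset.mem_filter.1 hv).1 f hf) hone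
      fun v hv => ?_
    exact mem_elem_of_mem (hvt v (Finset.mem_filter.1 hv).1 (Finset.mem_filter.1 hv).2)
  -- so that `x` is an interior point
  refine hxΩ ?_
  rw [← interior_closure_eq hL, mem_interior_iff_mem_nhds]
  let θ : Sp d → ℝ := fun w => ℓ w / ℓ q
  have hθc : Continuous θ := (continuous_affineMap ℓ).div_const _
  have hθx : θ x = 0 := by simp [θ, hℓx]
  -- Where the line through `q` and `w` crosses the hyperplane of the facet. For `w` near `x` this
  -- point lies in the facet, hence in `t`, so a `w` on the far side lies on a segment inside `t`.
  let f : Sp d → Sp d := fun w => (1 - θ w)⁻¹ • (w - θ w • q)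
  have hfc : ContinuousAt f x := by
    refine ContinuousAt.smul (f := fun w => (1 - θ w)⁻¹) (ContinuousAt.inv₀ ?_ ?_) ?_
    · exact (continuous_const.sub hθc).continuousAt
    · simp [hθx]
    · exact (continuous_id.sub (hθc.smul continuous_const)).continuousAt
  have hfx : f x = x := by simp [f, hθx]
  have e1 : ∀ᶠ w in 𝓝 x, ∀ m ∈ F, m ≠ ℓ → 0 < m w := by
    rw [eventually_all_finite hF.finite]
    intro m hm
    by_cases h : m = ℓ
    · exact Eventually.of_forall fun w hw => absurd h hw
    · filter_upwards [(continuous_affineMap m).continuousAt.eventually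
        (lt_mem_nhds (hmx m hm h))] with w hw _
      exact hw
  have e2 : ∀ᶠ w in 𝓝 x, ∀ m ∈ F, m ≠ ℓ → 0 < m (f w) := by
    have := hfc.tendsto
    rw [hfx] at this
    exact this.eventually e1
  have e3 : ∀ᶠ w in 𝓝 x, θ w < 1 :=
    hθc.continuousAt.eventually (gt_mem_nhds (by rw [hθx]; exact one_pos))
  filter_upwards [e1, e2, e3] with w h1 h2 h3
  rcases le_or_gt 0 (ℓ w) with h | h
  · refine hM.elem_subset hs ?_
    rw [hF.elem_eq]
    intro m hm
    by_cases hmℓ : m = ℓ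
    · rw [hmℓ]; exact h
    · exact (h1 m hm hmℓ).le
  · have hθ0 : 0 ≤ θ w := (div_pos_of_neg_of_neg h hq).le
    have h1θ : (1 - θ w) ≠ 0 := by linarith
    have hw : w = (1 - θ w) • f w + θ w • q := by
      simp only [f]
      rw [smul_inv_smul₀ h1θ]
      abel
    have hℓf : ℓ (f w) = 0 := by
      have h4 : ℓ w = (1 - θ w) * ℓ (f w) + θ w * ℓ q := by
        conv_lhs => rw [hw]
        rw [affineMap_comb]
      have h5 : θ w * ℓ q = ℓ w := div_mul_cancel₀ _ hq.ne
      rw [h5] at h4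
      have h6 : (1 - θ w) * ℓ (f w) = 0 := by linarith
      exact (mul_eq_zero.1 h6).resolve_left h1θ
    have hfs : f w ∈ elem s := by
      rw [hF.elem_eq]
      intro m hm
      by_cases hmℓ : m = ℓ
      · rw [hmℓ, hℓf]
      · exact (h2 m hm hmℓ).le
    refine hM.elem_subset ht ?_
    rw [hw]
    exact convex_elem t (hfacet _ hfs hℓf) hqt (sub_nonneg.2 h3.le) hθ0 (by ring)

/-- Near every boundary point there is a flat disc of prescribed radius outside the domain. -/
lemma IsMesh.exists_exterior_disc (hM : IsMesh kind Ω T) (hd : 1 ≤ d) (hL : IsLipschitzDomain Ω)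
    {r : ℝ} (hr : 0 ≤ r) (hball : ∀ s ∈ T, ∃ c, Metric.closedBall c r ⊆ elem s)
    {y : Sp d} (hy : y ∈ closure Ω) (hyΩ : y ∉ Ω) {ε : ℝ} (hε : 0 < ε) :
    ∃ s ∈ T, ∃ x ∈ elem s, dist x y < ε ∧ ∃ f ∈ elem s, ∃ ν : Sp d, ‖ν‖ = 1 ∧
      ∀ p, inner ℝ ν (p - f) = 0 → dist p f ≤ r → p ∉ Ω := by
  choose! F hF using fun s (hs : s ∈ T) => (hM.good hd hs).facets
  obtain ⟨x, hxy, hxΩ, s, hs, hxs, ℓ, hℓ, hℓx, hmx⟩ := hM.exists_simple_point hL hF hy hyΩ hε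
  obtain ⟨c, hc⟩ := hball s hs
  obtain ⟨f, hf, hf0, hdisc⟩ := (hF s hs).exists_disc hr hc hℓ
  refine ⟨s, hs, x, hxs, hxy, f, hf, ?_⟩
  -- The Riesz representative of the facet function, nonzero because of the direction `a`;
  -- normalized, it is the unit normal of the disc.
  let g : Sp d := (InnerProductSpace.toDual ℝ (Sp d)).symm (LinearMap.toContinuousLinearMap ℓ.linear)
  have hg : ∀ z, inner ℝ g z = ℓ.linear z := fun z => by simp [g]
  obtain ⟨a, ha, -⟩ := (hF s hs).exists_dir ℓ hℓ
  have hg0 : g ≠ 0 := by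
    intro h
    have := hg a
    rw [h, inner_zero_left, ha] at this
    exact zero_ne_one this
  have hgn : ‖g‖ ≠ 0 := norm_ne_zero_iff.2 hg0
  refine ⟨‖g‖⁻¹ • g, ?_, fun p hp hpd => ?_⟩
  · rw [norm_smul, norm_inv, norm_norm, inv_mul_cancel₀ hgn]
  · rw [inner_smul_left, mul_eq_zero] at hp
    have hp' : inner ℝ g (p - f) = 0 := hp.resolve_left (by simpa using hg0)
    rw [hg] at hp'
    have hℓp : ℓ p = 0 := by
      have := affineMap_add ℓ f (p - f)
      rwa [add_sub_cancel, hf0, hp', add_zero] at this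
    exact hM.facet_notMem hd hL hs (hF s hs) hxs hxΩ hℓ hℓx hmx (hdisc p hℓp hpd) hℓp

/-- Only boundedly many elements are close to a point. -/
lemma IsMesh.sum_integral_le (hM : IsMesh kind Ω T) (hd : 1 ≤ d) {r R H : ℝ} (hr : 0 < r)
    (hR : 0 ≤ R) (hH : 0 ≤ H)
    (hball : ∀ s ∈ T, ∃ c, Metric.closedBall c r ⊆ elem s)
    (hdiam : ∀ s ∈ T, ∀ x ∈ elem s, ∀ y ∈ elem s, dist x y ≤ H)
    {z : Finset (Sp d) → Sp d} (hz : ∀ s ∈ T, z s ∈ elem s)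
    {g : Sp d → ℝ} (hg : Integrable g) (hg0 : ∀ x, 0 ≤ g x) :
    ∑ s ∈ T, ∫ x in Metric.closedBall (z s) R, g x ≤ ((R + H) / r) ^ d * ∫ x, g x := by
  classical
  let B : Finset (Sp d) → Set (Sp d) := fun s => Metric.closedBall (z s) R
  have hBm : ∀ s, MeasurableSet (B s) := fun s => Metric.isClosed_closedBall.measurableSet
  -- Volume packing: the elements counted here lie in a ball of radius R + H around `x`, overlap in
  -- null sets, and each contains a ball of radius `r`.
  have hcount : ∀ x, ((T.filter fun s => x ∈ B s).card : ℝ) ≤ ((R + H) / r) ^ d := by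
    intro x
    let S := T.filter fun s => x ∈ B s
    have hST : ∀ s ∈ S, s ∈ T := fun s hs => (Finset.mem_filter.1 hs).1
    have hV : 0 < volume (Metric.ball (0 : Sp d) 1) := Metric.measure_ball_pos _ _ one_pos
    have hVf : volume (Metric.ball (0 : Sp d) 1) ≠ ⊤ := measure_ball_lt_top.ne
    have h1 : ∀ s ∈ S, ENNReal.ofReal (r ^ d) * volume (Metric.ball (0 : Sp d) 1)
        ≤ volume (elem s) := by
      intro s hs
      obtain ⟨c, hc⟩ := hball s (hST s hs)
      refine le_trans (le_of_eq ?_) (measure_mono hc)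
      rw [Measure.addHaar_closedBall volume c hr.le, finrank_euclideanSpace_fin]
    have h2 : ∑ s ∈ S, volume (elem s) ≤ volume (Metric.closedBall x (R + H)) := by
      rw [← measure_biUnion_finset₀ (fun a ha b hb hab =>
        hM.volume_inter hd (hST a ha) (hST b hb) hab)
        (fun s _ => (isCompact_elem s).measurableSet.nullMeasurableSet)]
      refine measure_mono (Set.iUnion₂_subset fun s hs y hy => ?_)
      have hxs : dist x (z s) ≤ R := (Finset.mem_filter.1 hs).2
      have h3 := hdiam s (hST s hs) y hy (z s) (hz s (hST s hs))
      have h4 := dist_triangle_right y x (z s)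
      rw [Metric.mem_closedBall]
      linarith
    have h3 : (S.card : ENNReal) * (ENNReal.ofReal (r ^ d) * volume (Metric.ball (0 : Sp d) 1))
        ≤ ENNReal.ofReal ((R + H) ^ d) * volume (Metric.ball (0 : Sp d) 1) := by
      rw [← nsmul_eq_mul, ← Finset.sum_const]
      refine (Finset.sum_le_sum h1).trans (h2.trans (le_of_eq ?_))
      rw [Measure.addHaar_closedBall volume x (by linarith), finrank_euclideanSpace_fin]
    rw [← mul_assoc, ENNReal.mul_le_mul_iff_left hV.ne' hVf, ← ENNReal.ofReal_natCast,
      ← ENNReal.ofReal_mul (by positivity)] at h3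
    have h4 := (ENNReal.ofReal_le_ofReal_iff (by positivity)).1 h3
    rw [div_pow, le_div_iff₀ (by positivity)]
    exact h4
  have hi : ∀ s, Integrable ((B s).indicator g) := fun s => hg.indicator (hBm s)
  calc ∑ s ∈ T, ∫ x in B s, g x = ∫ x, ∑ s ∈ T, (B s).indicator g x := by
        rw [integral_finsetSum _ fun s _ => hi s]
        exact Finset.sum_congr rfl fun s _ => (integral_indicator (hBm s)).symm
    _ ≤ ∫ x, ((R + H) / r) ^ d * g x := by
        refine integral_mono (integrable_finsetSum _ fun s _ => hi s) (hg.const_mul _) fun x => ?_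
        have : ∑ s ∈ T, (B s).indicator g x = (T.filter fun s => x ∈ B s).card * g x := by
          simp only [Set.indicator_apply]
          rw [← Finset.sum_filter, Finset.sum_const, nsmul_eq_mul]
        simp only [this]
        exact mul_le_mul_of_nonneg_right (hcount x) (hg0 x)
    _ = _ := integral_const_mul _ _

end

/-! ### Quasi-interpolation into U_H with zero boundary values. -/

section

variable {d : ℕ} {kind : MeshKind} {s t : Finset (Sp d)}
  {Ω : Set (Sp d)} {T : Finset (Finset (Sp d))}

/-! ### Continuous piecewise polynomial functions -/

/-- A uniform local Lipschitz bound is a global one. -/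
lemma lipschitzWith_of_local {v : Sp d → ℝ} {L : NNReal}
    (h : ∀ x, ∀ᶠ z in 𝓝 x, |v z - v x| ≤ L * dist z x) : LipschitzWith L v := by
  have hcont : Continuous v := by
    refine continuous_iff_continuousAt.2 fun x => ?_
    rw [ContinuousAt, tendsto_iff_norm_sub_tendsto_zero]
    have h1 : Tendsto (fun z => (L : ℝ) * dist z x) (𝓝 x) (𝓝 0) := by
      have : Continuous fun z => (L : ℝ) * dist z x := by fun_prop
      simpa using this.tendsto x
    exact squeeze_zero' (Eventually.of_forall fun z => norm_nonneg _) (h x) h1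
  refine LipschitzWith.of_dist_le_mul fun y x => ?_
  let γ : ℝ → Sp d := fun t => x + t • (y - x)
  have hγ : Continuous γ := by fun_prop
  have hγd : ∀ t t', dist (γ t) (γ t') = |t - t'| * dist y x := by
    intro t t'
    have : γ t - γ t' = (t - t') • (y - x) := by simp only [γ]; module
    rw [dist_eq_norm, this, norm_smul, Real.norm_eq_abs, dist_eq_norm]
  let S : Set ℝ := {t | |v (γ t) - v x| ≤ L * dist y x * t}
  have hS : IsClosed S := by
    refine isClosed_le ?_ (by fun_prop)
    exact ((hcont.comp hγ).sub continuous_const).abs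
  have h0 : (0 : ℝ) ∈ S := by simp [S, γ]
  have hsub : Set.Icc (0 : ℝ) 1 ⊆ S := by
    refine (hS.inter isClosed_Icc).Icc_subset_of_forall_mem_nhdsWithin h0 ?_
    rintro t ⟨ht, -⟩
    have h1 : ∀ᶠ t' in 𝓝[>] t, |v (γ t') - v (γ t)| ≤ L * dist (γ t') (γ t) :=
      (hγ.continuousAt.eventually (h (γ t))).filter_mono nhdsWithin_le_nhds
    filter_upwards [h1, self_mem_nhdsWithin] with t' h2 h3
    have h3' : t < t' := h3
    rw [hγd, abs_of_pos (sub_pos.2 h3')] at h2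
    have h4 : |v (γ t) - v x| ≤ L * dist y x * t := ht
    have h5 := abs_sub_le (v (γ t')) (v (γ t)) (v x)
    change |v (γ t') - v x| ≤ L * dist y x * t'
    nlinarith
  have h1 : |v (γ 1) - v x| ≤ L * dist y x * 1 := hsub ⟨zero_le_one, le_rfl⟩
  simpa [γ, Real.dist_eq] using h1

open Classical in
/-- The piecewise polynomial function with nodal values `val`. -/
def pwFun (kind : MeshKind) (T : Finset (Finset (Sp d))) (val : Sp d → ℝ) (x : Sp d) : ℝ :=
  if h : ∃ s ∈ T, x ∈ elem s then ∑ z ∈ h.choose, val z * pval (nodal kind h.choose z) x else 0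

/-- The value does not depend on the chosen element: at a common point, nodal functions of unshared
vertices vanish and those of shared vertices agree. -/
lemma pwFun_eq (hM : IsMesh kind Ω T) (val : Sp d → ℝ) (hs : s ∈ T) {x : Sp d} (hx : x ∈ elem s) :
    pwFun kind T val x = ∑ z ∈ s, val z * pval (nodal kind s z) x := by
  classical
  have h : ∃ s ∈ T, x ∈ elem s := ⟨s, hs, hx⟩
  rw [pwFun, dif_pos h]
  obtain ⟨ht, hxt⟩ := h.choose_spec
  set t := h.choose
  have key : ∀ {s t : Finset (Sp d)}, s ∈ T → t ∈ T → x ∈ elem s → x ∈ elem t →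
      ∑ z ∈ s, val z * pval (nodal kind s z) x
        = ∑ z ∈ s ∩ t, val z * pval (nodal kind s z) x := by
    intro s t hs ht hxs hxt
    refine (Finset.sum_subset Finset.inter_subset_left fun z hz hzt => ?_).symm
    have : pval (nodal kind s z) x = 0 := by
      by_contra hne
      exact hzt (Finset.mem_inter.2 ⟨hz, (hM.compat hs ht hxs hxt hz hne).1⟩)
    rw [this, mul_zero]
  rw [key hs ht hx hxt, key ht hs hxt hx, Finset.inter_comm]
  refine Finset.sum_congr rfl fun z hz => ?_
  obtain ⟨hzs, hzt⟩ := Finset.mem_inter.1 hz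
  congr 1
  by_cases hne : pval (nodal kind s z) x = 0
  · by_contra h2
    rw [hne] at h2
    exact h2 ((hM.compat ht hs hxt hx hzt h2).2.symm.trans hne)
  · exact (hM.compat hs ht hx hxt hzs hne).2

lemma pwFun_eq_pval (hM : IsMesh kind Ω T) (val : Sp d → ℝ) (hs : s ∈ T) {x : Sp d}
    (hx : x ∈ elem s) :
    pwFun kind T val x = pval (∑ z ∈ s, val z • nodal kind s z) x := by
  rw [pwFun_eq hM val hs hx, pval_sum]
  simp

/-- A point of Ω close to x lies in an element that also contains x, where a polynomial Lipschitz
bound applies. A nearby point outside Ω forces x outside Ω, because Ω is open, and both values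
vanish. These local bounds are uniform. -/
lemma exists_lipschitzWith_pwFun (hM : IsMesh kind Ω T) (hΩ : IsOpen Ω) {val : Sp d → ℝ}
    (h0 : ∀ x ∉ Ω, pwFun kind T val x = 0) : ∃ L, LipschitzWith L (pwFun kind T val) := by
  have h1 : ∀ s : Finset (Sp d), ∃ L : NNReal,
      LipschitzOnWith L (pval (∑ z ∈ s, val z • nodal kind s z)) (elem s) := fun s =>
    LocallyLipschitzOn.exists_lipschitzOnWith_of_compact (isCompact_elem s)
      (contDiff_pval _).locallyLipschitz.locallyLipschitzOn
  choose L hL using h1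
  refine ⟨∑ s ∈ T, L s, lipschitzWith_of_local fun x => ?_⟩
  have hle : ∀ s ∈ T, (L s : ℝ) ≤ (∑ s ∈ T, L s : NNReal) := fun s hs => by
    exact_mod_cast Finset.single_le_sum (f := L) (fun i _ => zero_le) hs
  have e1 : ∀ᶠ z in 𝓝 x, ∀ t ∈ T, x ∉ elem t → z ∉ elem t := by
    rw [eventually_all_finset]
    intro t _
    by_cases h : x ∈ elem t
    · exact Eventually.of_forall fun z hz => absurd h hz
    · filter_upwards [(isCompact_elem t).isClosed.isOpen_compl.mem_nhds h] with z hz _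
      exact hz
  have e2 : ∀ᶠ z in 𝓝 x, x ∈ Ω → z ∈ Ω := by
    by_cases h : x ∈ Ω
    · filter_upwards [hΩ.mem_nhds h] with z hz _ using hz
    · exact Eventually.of_forall fun z hz => absurd hz h
  filter_upwards [e1, e2] with z h1 h2
  by_cases hz : z ∈ Ω
  · obtain ⟨s, hs, hzs⟩ := hM.exists_mem (subset_closure hz)
    have hxs : x ∈ elem s := by
      by_contra h
      exact h1 s hs h hzs
    rw [pwFun_eq_pval hM val hs hzs, pwFun_eq_pval hM val hs hxs, ← Real.dist_eq]
    refine ((hL s).dist_le_mul z hzs x hxs).trans ?_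
    gcongr
    exact_mod_cast hle s hs
  · have hx : x ∉ Ω := fun h => hz (h2 h)
    rw [h0 z hz, h0 x hx, sub_zero, abs_zero]
    positivity

lemma pwFun_mem_UH (hM : IsMesh kind Ω T) (hd : 1 ≤ d) (hL : IsLipschitzDomain Ω)
    {val : Sp d → ℝ} (hval : ∀ z, val z ≠ 0 → ∀ s ∈ T, z ∈ s → ∀ y ∈ elem s, y ∉ Ω →
      pval (nodal kind s z) y = 0) : pwFun kind T val ∈ UH kind Ω T := by
  have h0 : ∀ x ∉ Ω, pwFun kind T val x = 0 := by
    intro x hx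
    by_cases h : ∃ s ∈ T, x ∈ elem s
    · obtain ⟨s, hs, hxs⟩ := h
      rw [pwFun_eq hM val hs hxs]
      refine Finset.sum_eq_zero fun z hz => ?_
      by_cases hz0 : val z = 0
      · rw [hz0, zero_mul]
      · rw [hval z hz0 s hs hz x hxs hx, mul_zero]
    · rw [pwFun, dif_neg h]
  obtain ⟨L, hLip⟩ := exists_lipschitzWith_pwFun hM hL.isOpen h0
  refine ⟨⟨memLp_of_lipschitz hL.isOpen hL.isBounded hLip, fun s hs =>
    ⟨∑ z ∈ s, val z • nodal kind s z, ?_, ?_⟩⟩,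
    memH10_of_lipschitz hL.isOpen hL.isBounded hLip h0⟩
  · exact Submodule.sum_mem _ fun z hz => Submodule.smul_mem _ _ ((hM.good hd hs).basis.mem z hz)
  · exact ae_restrict_of_forall_mem (isCompact_elem s).measurableSet fun x hx =>
      pwFun_eq_pval hM val hs hx

/-! ### Geometric constants of a mesh -/

lemma IsMesh.nonempty (hM : IsMesh kind Ω T) (hL : IsLipschitzDomain Ω) : T.Nonempty := by
  obtain ⟨x, hx⟩ := hL.isConnected.nonempty
  obtain ⟨s, hs, -⟩ := hM.exists_mem (subset_closure hx)
  exact ⟨s, hs⟩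

lemma dist_le_elemDiam {x y : Sp d} (hx : x ∈ elem s) (hy : y ∈ elem s) :
    dist x y ≤ elemDiam s :=
  Metric.dist_le_diam_of_mem (isCompact_elem s).isBounded hx hy

lemma elemDiam_le_meshWidth (hs : s ∈ T) : elemDiam s ≤ meshWidth T :=
  le_csSup (T.finite_toSet.image _).bddAbove ⟨s, hs, rfl⟩

lemma exists_two_vertices (hd : 1 ≤ d) (hG : IsGoodElement kind s) :
    ∃ v ∈ s, ∃ w ∈ s, v ≠ w := by
  by_contra! h
  obtain ⟨v, hv⟩ : s.Nonempty := by
    by_contra! h0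
    have := hG.basis.sum_eq_one 0
    rw [h0] at this
    simp at this
  have key : ∀ x : Sp d, x = v := fun x => by
    calc x = ∑ w ∈ s, pval (nodal kind s w) x • w := (hG.basis.sum_smul x).symm
      _ = ∑ w ∈ s, pval (nodal kind s w) x • v :=
          Finset.sum_congr rfl fun w hw => congrArg (pval (nodal kind s w) x • ·)
            (h v hv w hw).symm
      _ = v := by rw [← Finset.sum_smul, hG.basis.sum_eq_one, one_smul]
  have h1 := congrFun (congrArg (fun x : Sp d => (x : Fin d → ℝ))
    ((key (EuclideanSpace.single ⟨0, hd⟩ 1)).trans (key 0).symm)) ⟨0, hd⟩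
  simp at h1

lemma elemDiam_pos (hd : 1 ≤ d) (hG : IsGoodElement kind s) : 0 < elemDiam s := by
  obtain ⟨v, hv, w, hw, hvw⟩ := exists_two_vertices hd hG
  exact (dist_pos.2 hvw).trans_le (dist_le_elemDiam (mem_elem_of_mem hv) (mem_elem_of_mem hw))

lemma IsMesh.meshWidth_pos (hM : IsMesh kind Ω T) (hd : 1 ≤ d) (hL : IsLipschitzDomain Ω) :
    0 < meshWidth T := by
  obtain ⟨s, hs⟩ := hM.nonempty hL
  exact (elemDiam_pos hd (hM.good hd hs)).trans_le (elemDiam_le_meshWidth hs)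

/-- Regularity gives H ≤ κγρ. The supremum ρ need not be known to be attained, so a ball of diameter
above ρ/2 is taken; its radius exceeds ρ/4, whence the 4. -/
lemma IsMesh.exists_ball (hM : IsMesh kind Ω T) (hd : 1 ≤ d) {κ γ : ℝ}
    (hκ : 0 < κ) (hγ : 0 < γ) (hreg : IsRegularMesh κ γ T) (hs : s ∈ T) :
    ∃ c, Metric.closedBall c (1 / (4 * κ * γ) * meshWidth T) ⊆ elem s := by
  have h1 : meshWidth T ≤ κ * elemDiam s := by
    refine csSup_le ⟨_, s, hs, rfl⟩ ?_
    rintro _ ⟨t, ht, rfl⟩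
    exact hreg.1 t ht s hs
  have h2 := hreg.2 s hs
  have h3 := elemDiam_pos hd (hM.good hd hs)
  have h4 : 0 < elemInDiam s := by
    by_contra! h
    nlinarith
  obtain ⟨v, hv, -⟩ := exists_two_vertices hd (hM.good hd hs)
  have hne : {δ : ℝ | 0 ≤ δ ∧ ∃ x, Metric.closedBall x (δ / 2) ⊆ elem s}.Nonempty :=
    ⟨0, le_rfl, v, by simpa using mem_elem_of_mem hv⟩
  obtain ⟨δ, ⟨hδ0, c, hc⟩, hδ⟩ := exists_lt_of_lt_csSup hne (half_lt_self h4)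
  refine ⟨c, (Metric.closedBall_subset_closedBall ?_).trans hc⟩
  have h5 : meshWidth T ≤ κ * (γ * elemInDiam s) := h1.trans (by gcongr)
  have h6 : elemInDiam s / 2 < δ := hδ
  rw [one_div_mul_eq_div, div_le_iff₀ (by positivity)]
  have h7 : κ * γ * (elemInDiam s / 2) ≤ κ * γ * δ := by gcongr
  linarith

lemma volume_real_closedBall (x : Sp d) {r : ℝ} (hr : 0 ≤ r) :
    volume.real (Metric.closedBall x r) = r ^ d * volume.real (Metric.ball (0 : Sp d) 1) := by
  rw [measureReal_def, Measure.addHaar_closedBall volume x hr, finrank_euclideanSpace_fin,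
    ENNReal.toReal_mul, ENNReal.toReal_ofReal (by positivity), measureReal_def]

/-! ### Approximation of smooth functions -/

lemma poincare_closedBall (x : Sp d) {R : ℝ} (hR : 0 < R) {φ : Sp d → ℝ} (hφ : ContDiff ℝ 1 φ) :
    ∫ y in Metric.closedBall x R, (φ y - ⨍ z in Metric.closedBall x R, φ z) ^ 2 ≤
      2 ^ d * (2 * R) ^ 2 * ∫ y in Metric.closedBall x R, ‖gradient φ y‖ ^ 2 := by
  refine poincare_convex (isCompact_closedBall _ _) (convex_closedBall _ _)
    (Metric.measure_closedBall_pos _ _ hR) (fun a ha b hb => ?_) hφ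
  have := dist_triangle_right a b x
  have h1 : dist a x ≤ R := ha
  have h2 : dist b x ≤ R := hb
  linarith

lemma setIntegral_le_of_subset {A B : Set (Sp d)} (hB : IsCompact B) (hAB : A ⊆ B)
    {f : Sp d → ℝ} (hf : Continuous f) (h0 : ∀ x, 0 ≤ f x) :
    ∫ x in A, f x ≤ ∫ x in B, f x :=
  setIntegral_mono_set (hf.continuousOn.integrableOn_compact hB) (Eventually.of_forall h0)
    hAB.eventuallyLE

lemma setIntegral_sq_add_le {K : Set (Sp d)} (hK : IsCompact K) {f g : Sp d → ℝ}
    (hf : Continuous f) (hg : Continuous g) :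
    ∫ x in K, (f x + g x) ^ 2 ≤ 2 * (∫ x in K, f x ^ 2) + 2 * ∫ x in K, g x ^ 2 := by
  have i1 : IntegrableOn (fun x => f x ^ 2) K := (hf.pow 2).continuousOn.integrableOn_compact hK
  have i2 : IntegrableOn (fun x => g x ^ 2) K := (hg.pow 2).continuousOn.integrableOn_compact hK
  have i3 : IntegrableOn (fun x => (f x + g x) ^ 2) K :=
    ((hf.add hg).pow 2).continuousOn.integrableOn_compact hK
  rw [← integral_const_mul, ← integral_const_mul, ← integral_add (i1.const_mul 2) (i2.const_mul 2)]
  refine integral_mono i3 ((i1.const_mul 2).add (i2.const_mul 2)) fun x => ?_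
  simp only
  nlinarith [sq_nonneg (f x - g x)]

open Classical in
/-- Nodal values of the quasi-interpolant: averages over balls, and zero at those vertices whose
nodal function does not vanish on the boundary. -/
def quasiVal (kind : MeshKind) (Ω : Set (Sp d)) (T : Finset (Finset (Sp d))) (φ : Sp d → ℝ)
    (z : Sp d) : ℝ :=
  if ∀ s ∈ T, z ∈ s → ∀ y ∈ elem s, y ∉ Ω → pval (nodal kind s z) y = 0 then
    ⨍ x in Metric.closedBall z (meshWidth T), φ x else 0

lemma pwFun_quasiVal_mem (hM : IsMesh kind Ω T) (hd : 1 ≤ d) (hL : IsLipschitzDomain Ω)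
    (φ : Sp d → ℝ) : pwFun kind T (quasiVal kind Ω T φ) ∈ UH kind Ω T := by
  refine pwFun_mem_UH hM hd hL fun z hz => ?_
  by_contra h
  exact hz (by rw [quasiVal, if_neg h])

set_option maxHeartbeats 800000 in
/-- The error of the quasi-interpolant at a vertex. -/
lemma quasiVal_error (hM : IsMesh kind Ω T) (hd : 1 ≤ d) (hL : IsLipschitzDomain Ω)
    {c : ℝ} (hc0 : 0 < c) (hc1 : c ≤ 1)
    (hball : ∀ s ∈ T, ∃ x, Metric.closedBall x (c * meshWidth T) ⊆ elem s)
    {φ : Sp d → ℝ} (hφ : IsTestFun Ω φ) (hs : s ∈ T) {z₀ z : Sp d} (hz₀ : z₀ ∈ elem s)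
    (hz : z ∈ s) :
    (c * meshWidth T) ^ d * volume.real (Metric.ball (0 : Sp d) 1) *
      (quasiVal kind Ω T φ z - ⨍ x in Metric.closedBall z₀ (6 * meshWidth T), φ x) ^ 2 ≤
      (2 * (2 ^ d * 144) + 8) * meshWidth T ^ 2 *
        ∫ x in Metric.closedBall z₀ (6 * meshWidth T), ‖gradient φ x‖ ^ 2 := by
  have hH := hM.meshWidth_pos hd hL
  set H := meshWidth T
  set B := Metric.closedBall z₀ (6 * H) with hBdef
  set a := ⨍ x in B, φ x
  set G := ∫ x in B, ‖gradient φ x‖ ^ 2 with hGdef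
  set ω := volume.real (Metric.ball (0 : Sp d) 1)
  have hω : 0 ≤ ω := measureReal_nonneg
  have hG : 0 ≤ G := integral_nonneg fun x => sq_nonneg _
  have hBc : IsCompact B := isCompact_closedBall _ _
  -- The ball has diameter 12H, and 144 = 12². Radius 6H is large enough to contain every ball used
  -- below.
  have hP : ∫ x in B, (φ x - a) ^ 2 ≤ 2 ^ d * 144 * H ^ 2 * G := by
    have := poincare_closedBall z₀ (R := 6 * H) (by positivity) hφ.contDiff_one
    refine this.trans (le_of_eq ?_)
    ring
  have hP0 : 0 ≤ 2 ^ d * 144 * H ^ 2 * G := by positivity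
  have hφc : Continuous φ := hφ.contDiff_one.continuous
  have hφa : Continuous fun x => φ x - a := hφc.sub continuous_const
  have hdist : ∀ r ∈ T, ∀ x ∈ elem r, ∀ y ∈ elem r, dist x y ≤ H := fun r hr x hx y hy =>
    (dist_le_elemDiam hx hy).trans (elemDiam_le_meshWidth hr)
  have hzz₀ := hdist s hs z (mem_elem_of_mem hz) z₀ hz₀
  have hcH : c * H ≤ H := by nlinarith
  by_cases hN : ∀ s ∈ T, z ∈ s → ∀ y ∈ elem s, y ∉ Ω → pval (nodal kind s z) y = 0
  · have e : quasiVal kind Ω T φ z = ⨍ x in Metric.closedBall z H, φ x := by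
      rw [quasiVal, if_pos hN]
    rw [e]
    have h1 := volume_mul_average_sub_sq_le (isCompact_closedBall z H) hφc a
    have h2 : ∫ x in Metric.closedBall z H, (φ x - a) ^ 2 ≤ ∫ x in B, (φ x - a) ^ 2 := by
      refine setIntegral_le_of_subset hBc ?_ (hφa.pow 2) fun x => sq_nonneg _
      refine Metric.closedBall_subset_closedBall' ?_
      linarith
    rw [volume_real_closedBall z hH.le] at h1
    have h3 : (c * H) ^ d * ω ≤ H ^ d * ω := by gcongr
    have h4 := mul_le_mul_of_nonneg_right h3
      (sq_nonneg ((⨍ x in Metric.closedBall z H, φ x) - a))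
    have h5 : 0 ≤ H ^ 2 * G := by positivity
    nlinarith
  · have e : quasiVal kind Ω T φ z = 0 := by rw [quasiVal, if_neg hN]
    rw [e, zero_sub, neg_sq]
    push Not at hN
    obtain ⟨t, ht, hzt, y, hyt, hyΩ, -⟩ := hN
    -- The nodal function of `z` is nonzero at a point `y` outside Ω, so an exterior disc is nearby.
    -- Its centre is within 4H of `z₀`, through `x`, `y` and `z`, each step costing at most H.
    obtain ⟨r, hr, x, hxr, hxy, f, hfr, ν, hν, hdisc⟩ := hM.exists_exterior_disc hd hL
      (r := c * H) (by positivity) hball (hM.elem_subset ht hyt) hyΩ hH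
    have d1 := hdist t ht y hyt z (mem_elem_of_mem hzt)
    have d2 := hdist r hr f hfr x hxr
    have d3 : dist f z₀ ≤ 4 * H := by
      have t1 := dist_triangle f x z₀
      have t2 := dist_triangle x y z₀
      have t3 := dist_triangle y z z₀
      linarith
    have h1 := friedrichs_disc hφ.contDiff_one (f := f) (ν := ν) (r := c * H) (by positivity) hν
      fun p hp hpd => hφ.eq_zero (hdisc p hp hpd)
    have h2 : ∫ x in Metric.closedBall f (2 * (c * H)), ‖gradient φ x‖ ^ 2 ≤ G := by
      refine setIntegral_le_of_subset hBc ?_ ((continuous_gradient hφ.contDiff_one).norm.pow 2)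
        fun x => sq_nonneg _
      refine Metric.closedBall_subset_closedBall' ?_
      linarith
    have h3 : ∫ x in Metric.closedBall f (c * H), (φ x - a) ^ 2 ≤ ∫ x in B, (φ x - a) ^ 2 := by
      refine setIntegral_le_of_subset hBc ?_ (hφa.pow 2) fun x => sq_nonneg _
      refine Metric.closedBall_subset_closedBall' ?_
      linarith
    have h4 : (c * H) ^ d * ω * a ^ 2 = ∫ _x in Metric.closedBall f (c * H), a ^ 2 := by
      rw [setIntegral_const, volume_real_closedBall f (by positivity), smul_eq_mul]
    have hna : Continuous fun x => -(φ x - a) := hφa.neg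
    -- Write the constant `a` as -(φ - a) + φ: the first part is bounded by Poincaré, the second by
    -- Friedrichs on the disc. The latter contributes 2 · 4 = 8.
    have h5 := setIntegral_sq_add_le (isCompact_closedBall f (c * H)) hna hφc
    have e2 : ∀ x, (-(φ x - a) + φ x) ^ 2 = a ^ 2 := fun x => by ring
    simp only [e2, neg_sq] at h5
    rw [h4]
    have h6 : 4 * (c * H) ^ 2 * (∫ x in Metric.closedBall f (2 * (c * H)), ‖gradient φ x‖ ^ 2)
        ≤ 4 * H ^ 2 * G := by
      have : (c * H) ^ 2 ≤ H ^ 2 := by gcongr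
      have h0 : 0 ≤ ∫ x in Metric.closedBall f (2 * (c * H)), ‖gradient φ x‖ ^ 2 :=
        integral_nonneg fun x => sq_nonneg _
      exact mul_le_mul (by linarith) h2 h0 (by positivity)
    linarith

/-- The error of the quasi-interpolant on an element. -/
lemma quasi_error_elem (hM : IsMesh kind Ω T) (hd : 1 ≤ d) (hL : IsLipschitzDomain Ω)
    {c : ℝ} (hc0 : 0 < c) (hc1 : c ≤ 1)
    (hball : ∀ s ∈ T, ∃ x, Metric.closedBall x (c * meshWidth T) ⊆ elem s)
    {φ : Sp d → ℝ} (hφ : IsTestFun Ω φ) (hs : s ∈ T) {z₀ : Sp d} (hz₀ : z₀ ∈ elem s) :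
    ∫ x in elem s, (φ x - pwFun kind T (quasiVal kind Ω T φ) x) ^ 2 ≤
      (2 * (2 ^ d * 144) + 2 * ((2 * (2 ^ d * 144) + 8) / c ^ d)) * meshWidth T ^ 2 *
        ∫ x in Metric.closedBall z₀ (6 * meshWidth T), ‖gradient φ x‖ ^ 2 := by
  have hH := hM.meshWidth_pos hd hL
  have hGE := hM.good hd hs
  have herr := fun z hz => quasiVal_error hM hd hL hc0 hc1 hball hφ hs (z₀ := z₀) (z := z) hz₀ hz
  set H := meshWidth T
  set B := Metric.closedBall z₀ (6 * H) with hBdef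
  set a := ⨍ x in B, φ x
  set G := ∫ x in B, ‖gradient φ x‖ ^ 2 with hGdef
  set ω := volume.real (Metric.ball (0 : Sp d) 1)
  set Q := 2 * (2 ^ d * 144 : ℝ) + 8
  have hω : 0 < ω := by
    refine ENNReal.toReal_pos (Metric.measure_ball_pos _ _ one_pos).ne' measure_ball_lt_top.ne
  have hG : 0 ≤ G := integral_nonneg fun x => sq_nonneg _
  have hBc : IsCompact B := isCompact_closedBall _ _
  have hP : ∫ x in B, (φ x - a) ^ 2 ≤ 2 ^ d * 144 * H ^ 2 * G := by
    have := poincare_closedBall z₀ (R := 6 * H) (by positivity) hφ.contDiff_one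
    refine this.trans (le_of_eq ?_)
    ring
  have hφc : Continuous φ := hφ.contDiff_one.continuous
  have hφa : Continuous fun x => φ x - a := hφc.sub continuous_const
  have hsub1 : elem s ⊆ Metric.closedBall z₀ H := fun x hx =>
    (dist_le_elemDiam hx hz₀).trans (elemDiam_le_meshWidth hs)
  have hsub : elem s ⊆ B := hsub1.trans (Metric.closedBall_subset_closedBall (by linarith))
  let val := quasiVal kind Ω T φ
  let p := ∑ z ∈ s, val z • nodal kind s z
  have hp : ∀ x ∈ elem s, pwFun kind T val x = pval p x := fun x hx => pwFun_eq_pval hM val hs hx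
  have hA : 0 < (c * H) ^ d * ω := by positivity
  let M := Q * H ^ 2 * G / ((c * H) ^ d * ω)
  have hval : ∀ z ∈ s, |val z - a| ≤ √M := fun z hz => by
    refine Real.abs_le_sqrt ?_
    rw [le_div_iff₀ hA, mul_comm]
    exact herr z hz
  have hM0 : 0 ≤ M := by positivity
  -- The nodal functions are nonnegative and sum to 1, so the uniform bound on the nodal errors
  -- carries over to the whole element.
  have hpa : ∀ x ∈ elem s, (a - pval p x) ^ 2 ≤ M := by
    intro x hx
    have e : pval p x - a = ∑ z ∈ s, (val z - a) * pval (nodal kind s z) x := by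
      simp only [p, pval_sum, pval_smul, sub_mul, Finset.sum_sub_distrib, ← Finset.mul_sum,
        hGE.basis.sum_eq_one, mul_one]
    have h1 : |pval p x - a| ≤ √M := by
      rw [e]
      calc |∑ z ∈ s, (val z - a) * pval (nodal kind s z) x|
          ≤ ∑ z ∈ s, √M * pval (nodal kind s z) x := by
            refine (Finset.abs_sum_le_sum_abs _ _).trans (Finset.sum_le_sum fun z hz => ?_)
            rw [abs_mul, abs_of_nonneg (hGE.nonneg z hz x hx)]
            exact mul_le_mul_of_nonneg_right (hval z hz) (hGE.nonneg z hz x hx)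
        _ = √M := by rw [← Finset.mul_sum, hGE.basis.sum_eq_one, mul_one]
    have h2 := sq_le_sq' (abs_le.1 h1).1 (abs_le.1 h1).2
    rw [Real.sq_sqrt hM0] at h2
    nlinarith
  have hpc : Continuous fun x => a - pval p x := continuous_const.sub (continuous_pval p)
  have step1 : ∫ x in elem s, (φ x - pwFun kind T val x) ^ 2
      ≤ 2 * (∫ x in elem s, (φ x - a) ^ 2) + 2 * ∫ x in elem s, (a - pval p x) ^ 2 := by
    have h1 := setIntegral_sq_add_le (isCompact_elem s) hφa hpc
    refine le_trans (le_of_eq ?_) h1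
    refine setIntegral_congr_fun (isCompact_elem s).measurableSet fun x hx => ?_
    simp only [hp x hx]
    ring
  have step2 : ∫ x in elem s, (φ x - a) ^ 2 ≤ 2 ^ d * 144 * H ^ 2 * G :=
    (setIntegral_le_of_subset hBc hsub (hφa.pow 2) fun x => sq_nonneg _).trans hP
  have step3 : ∫ x in elem s, (a - pval p x) ^ 2 ≤ H ^ d * ω * M := by
    have h1 : ∫ x in elem s, (a - pval p x) ^ 2 ≤ ∫ _x in elem s, M :=
      setIntegral_mono_on ((hpc.pow 2).continuousOn.integrableOn_compact (isCompact_elem s))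
        (integrableOn_const (isCompact_elem s).measure_lt_top.ne)
        (isCompact_elem s).measurableSet hpa
    refine h1.trans ?_
    rw [setIntegral_const, smul_eq_mul, ← volume_real_closedBall z₀ hH.le]
    refine mul_le_mul_of_nonneg_right ?_ hM0
    exact measureReal_mono hsub1 (isCompact_closedBall _ _).measure_lt_top.ne
  have step4 : H ^ d * ω * M = Q / c ^ d * H ^ 2 * G := by
    simp only [M]
    rw [mul_pow]
    field_simp
  rw [step4] at step3
  have : (2 * (2 ^ d * 144) + 2 * (Q / c ^ d)) * H ^ 2 * G
      = 2 * (2 ^ d * 144 * H ^ 2 * G) + 2 * (Q / c ^ d * H ^ 2 * G) := by ring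
  rw [this]
  linarith

/-- Global error of the quasi-interpolant. -/
lemma quasi_error (hM : IsMesh kind Ω T) (hd : 1 ≤ d) (hL : IsLipschitzDomain Ω)
    {c : ℝ} (hc0 : 0 < c) (hc1 : c ≤ 1)
    (hball : ∀ s ∈ T, ∃ x, Metric.closedBall x (c * meshWidth T) ⊆ elem s)
    {φ : Sp d → ℝ} (hφ : IsTestFun Ω φ) :
    ∫ x in Ω, (φ x - pwFun kind T (quasiVal kind Ω T φ) x) ^ 2 ≤
      (2 * (2 ^ d * 144) + 2 * ((2 * (2 ^ d * 144) + 8) / c ^ d)) * (7 / c) ^ d *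
        meshWidth T ^ 2 * ∫ x in Ω, ‖gradient φ x‖ ^ 2 := by
  have hH := hM.meshWidth_pos hd hL
  have hz : ∀ s ∈ T, ∃ z, z ∈ elem s := fun s hs => by
    obtain ⟨v, hv, -⟩ := exists_two_vertices hd (hM.good hd hs)
    exact ⟨v, mem_elem_of_mem hv⟩
  choose! z hz using hz
  have hmem := pwFun_quasiVal_mem hM hd hL φ
  set v := pwFun kind T (quasiVal kind Ω T φ)
  set K := 2 * (2 ^ d * 144 : ℝ) + 2 * ((2 * (2 ^ d * 144) + 8) / c ^ d)
  have hK : 0 ≤ K := by positivity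
  have hint : Integrable (fun x => (φ x - v x) ^ 2) (volume.restrict Ω) :=
    ((hφ.memLp _).sub hmem.1.1).integrable_sq
  have hgi : Integrable (fun x => ‖gradient φ x‖ ^ 2) :=
    (hφ.memLp_gradient volume).norm.integrable_sq
  have hgΩ : ∫ x, ‖gradient φ x‖ ^ 2 = ∫ x in Ω, ‖gradient φ x‖ ^ 2 :=
    (setIntegral_eq_integral_of_forall_compl_eq_zero fun x hx => by
      rw [hφ.gradient_eq_zero hx]; simp).symm
  have hle : ∀ s ∈ T, (volume.restrict (elem s) : Measure (Sp d)) ≤ volume.restrict Ω := by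
    intro s hs
    rw [hM.restrict_eq hd hL]
    exact Finset.single_le_sum (f := fun s => (volume.restrict (elem s) : Measure (Sp d)))
      (fun _ _ => Measure.zero_le _) hs
  have hsum := hM.sum_integral_le hd (r := c * meshWidth T) (R := 6 * meshWidth T)
    (H := meshWidth T) (by positivity) (by positivity) hH.le hball
    (fun s hs x hx y hy => (dist_le_elemDiam hx hy).trans (elemDiam_le_meshWidth hs)) hz hgi
    (fun x => sq_nonneg _)
  -- The overlap number of the balls of radius 6H, by the packing bound with inscribed radius cH.
  have e7 : (6 * meshWidth T + meshWidth T) / (c * meshWidth T) = 7 / c := by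
    field_simp; norm_num
  rw [e7, hgΩ] at hsum
  calc ∫ x in Ω, (φ x - v x) ^ 2 = ∑ s ∈ T, ∫ x in elem s, (φ x - v x) ^ 2 := by
        rw [hM.restrict_eq hd hL, integral_finsetSum_measure]
        exact fun s hs => hint.mono_measure (hle s hs)
    _ ≤ ∑ s ∈ T, K * meshWidth T ^ 2 *
          ∫ x in Metric.closedBall (z s) (6 * meshWidth T), ‖gradient φ x‖ ^ 2 :=
        Finset.sum_le_sum fun s hs => quasi_error_elem hM hd hL hc0 hc1 hball hφ hs (hz s hs)
    _ ≤ K * meshWidth T ^ 2 * ((7 / c) ^ d * ∫ x in Ω, ‖gradient φ x‖ ^ 2) := by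
        rw [← Finset.mul_sum]
        exact mul_le_mul_of_nonneg_left hsum (by positivity)
    _ = _ := by ring

end

/-! ### Positive semidefinite forms -/

section Form

variable {X : Type*} [AddCommGroup X] [Module ℝ X]

/-- `B` is a symmetric positive semidefinite bilinear form on the subspace `V`. -/
structure IsPSDForm (V : Submodule ℝ X) (B : X → X → ℝ) : Prop where
  symm : ∀ f g, B f g = B g f
  add : ∀ f ∈ V, ∀ g ∈ V, ∀ h ∈ V, B (f + g) h = B f h + B g h
  smul : ∀ c : ℝ, ∀ f ∈ V, ∀ g ∈ V, B (c • f) g = c * B f g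
  nonneg : ∀ f ∈ V, 0 ≤ B f f

variable {V W U : Submodule ℝ X} {B B' : X → X → ℝ}

lemma IsPSDForm.sub (h : IsPSDForm V B) {f g k : X} (hf : f ∈ V) (hg : g ∈ V) (hk : k ∈ V) :
    B (f - g) k = B f k - B g k := by
  have h1 : f - g = f + (-1 : ℝ) • g := by module
  rw [h1, h.add f hf _ (V.smul_mem _ hg) k hk, h.smul _ g hg k hk]
  ring

lemma IsPSDForm.sub_right (h : IsPSDForm V B) {f g k : X} (hf : f ∈ V) (hg : g ∈ V) (hk : k ∈ V) :
    B k (f - g) = B k f - B k g := by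
  rw [h.symm, h.sub hf hg hk, h.symm f, h.symm g]

lemma IsPSDForm.sub_sub (h : IsPSDForm V B) {f g k l : X} (hf : f ∈ V) (hg : g ∈ V) (hk : k ∈ V)
    (hl : l ∈ V) : B (f - g) (k - l) = B f k - B f l - B g k + B g l := by
  rw [h.sub hf hg (V.sub_mem hk hl), h.sub_right hk hl hf, h.sub_right hk hl hg]
  ring

/-- The Cauchy–Schwarz inequality. -/
lemma IsPSDForm.sq_le (h : IsPSDForm V B) {f g : X} (hf : f ∈ V) (hg : g ∈ V) :
    B f g ^ 2 ≤ B f f * B g g := by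
  have key : ∀ t : ℝ, 0 ≤ B g g * (t * t) + (-2 * B f g) * t + B f f := by
    intro t
    have h1 := h.nonneg (f - t • g) (V.sub_mem hf (V.smul_mem t hg))
    rw [h.sub_sub hf (V.smul_mem t hg) hf (V.smul_mem t hg), h.symm f (t • g),
      h.smul t g hg f hf, h.smul t g hg _ (V.smul_mem t hg), h.symm g (t • g),
      h.smul t g hg g hg, h.symm g f] at h1
    linarith
  have := discrim_le_zero key
  rw [discrim] at this
  linarith

lemma IsPSDForm.abs_le (h : IsPSDForm V B) {f g : X} (hf : f ∈ V) (hg : g ∈ V) {K a b : ℝ}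
    (hK : 0 ≤ K) (ha : 0 ≤ a) (hb : 0 ≤ b) (h1 : B f f ≤ K * a ^ 2) (h2 : B g g ≤ K * b ^ 2) :
    |B f g| ≤ K * (a * b) := by
  refine abs_le_of_sq_le_sq ((h.sq_le hf hg).trans ?_) (by positivity)
  calc B f f * B g g ≤ (K * a ^ 2) * (K * b ^ 2) :=
        mul_le_mul h1 h2 (h.nonneg g hg) (by positivity)
    _ = (K * (a * b)) ^ 2 := by ring

lemma IsPSDForm.mono (h : IsPSDForm V B) (hW : W ≤ V) : IsPSDForm W B where
  symm := h.symm
  add f hf g hg k hk := h.add f (hW hf) g (hW hg) k (hW hk)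
  smul c f hf g hg := h.smul c f (hW hf) g (hW hg)
  nonneg f hf := h.nonneg f (hW hf)

/-- Existence of the orthogonal projection onto a subspace that is finite-dimensional modulo the
radical of the form. -/
lemma IsPSDForm.exists_proj (h : IsPSDForm V B) (hW : W ≤ V) {ι : Type*} [Finite ι]
    (Φ : W →ₗ[ℝ] (ι → ℝ)) (hΦ : ∀ w : W, Φ w = 0 → B w w = 0) {u : X} (hu : u ∈ V) :
    ∃ v ∈ W, ∀ w ∈ W, B v w = B u w := by
  -- By Cauchy–Schwarz, an element of zero norm lies in the radical.
  have hzero : ∀ x ∈ W, B x x = 0 → ∀ y ∈ V, B y x = 0 := by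
    intro x hx h0 y hy
    have := h.sq_le hy (hW hx)
    rw [h0, mul_zero] at this
    exact pow_eq_zero_iff (two_ne_zero) |>.1 (le_antisymm this (sq_nonneg _))
  let F : V →ₗ[ℝ] Module.Dual ℝ W := LinearMap.mk₂ ℝ (fun (v : V) (w : W) => B v w)
    (fun a b c => h.add a a.2 b b.2 c (hW c.2))
    (fun c a b => h.smul c a a.2 b (hW b.2))
    (fun a b c => by
      rw [h.symm, Submodule.coe_add, h.add b (hW b.2) c (hW c.2) a a.2, h.symm b, h.symm c])
    (fun c a b => by
      rw [h.symm, Submodule.coe_smul, h.smul c b (hW b.2) a a.2, h.symm b]; rfl)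
  let f : W →ₗ[ℝ] Module.Dual ℝ W := F ∘ₗ Submodule.inclusion hW
  have hf : ∀ v w : W, f v w = B v w := fun v w => rfl
  have hker : LinearMap.ker Φ ≤ LinearMap.ker f := by
    intro w hw
    refine LinearMap.mem_ker.2 (LinearMap.ext fun x => ?_)
    rw [hf, h.symm]
    exact hzero w w.2 (hΦ w hw) x (hW x.2)
  have fin1 : Module.Finite ℝ (W ⧸ LinearMap.ker Φ) :=
    Module.Finite.equiv Φ.quotKerEquivRange.symm
  have fin2 : Module.Finite ℝ (W ⧸ LinearMap.ker f) :=
    Module.Finite.of_surjective (Submodule.factor hker) (Submodule.factor_surjective hker)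
  have fin3 : FiniteDimensional ℝ (LinearMap.range f) := Module.Finite.equiv f.quotKerEquivRange
  -- The range is finite-dimensional, hence equal to its double annihilator. Any `x` killed by the
  -- range has B x x = 0, so it lies in the radical and is killed by the functional of `u`.
  have hmem : F ⟨u, hu⟩ ∈ LinearMap.range f := by
    rw [← Subspace.dualCoannihilator_dualAnnihilator_eq (W := LinearMap.range f)]
    refine (Submodule.mem_dualAnnihilator _).2 fun x hx => ?_
    rw [Submodule.mem_dualCoannihilator] at hx
    exact hzero x x.2 (hx _ ⟨x, rfl⟩) u hu
  obtain ⟨v, hv⟩ := hmem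
  exact ⟨v, v.2, fun w hw => congrArg (fun ℓ : Module.Dual ℝ W => ℓ ⟨w, hw⟩) hv⟩

/-- Pythagoras' theorem for an orthogonal projection. -/
lemma IsPSDForm.pythagoras (h : IsPSDForm V B) (hW : W ≤ V) {u v c : X} (hu : u ∈ V) (hv : v ∈ W)
    (hc : c ∈ W) (hproj : ∀ w ∈ W, B v w = B u w) :
    B (u - c) (u - c) = B (u - v) (u - v) + B (v - c) (v - c) := by
  rw [h.sub_sub hu (hW hc) hu (hW hc), h.sub_sub hu (hW hv) hu (hW hv),
    h.sub_sub (hW hv) (hW hc) (hW hv) (hW hc), h.symm c u, h.symm v u, h.symm c v,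
    ← hproj v hv, ← hproj c hc]
  ring

lemma IsPSDForm.proj_error_le (h : IsPSDForm V B) (hW : W ≤ V) {u v c : X} (hu : u ∈ V)
    (hv : v ∈ W) (hc : c ∈ W) (hproj : ∀ w ∈ W, B v w = B u w) :
    B (u - v) (u - v) ≤ B (u - c) (u - c) := by
  have := h.pythagoras hW hu hv hc hproj
  have := h.nonneg (v - c) (V.sub_mem (hW hv) (hW hc))
  linarith

lemma IsPSDForm.proj_sub_le (h : IsPSDForm V B) (hW : W ≤ V) {u v c : X} (hu : u ∈ V)
    (hv : v ∈ W) (hc : c ∈ W) (hproj : ∀ w ∈ W, B v w = B u w) :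
    B (v - c) (v - c) ≤ B (u - c) (u - c) := by
  have := h.pythagoras hW hu hv hc hproj
  have := h.nonneg (u - v) (V.sub_mem hu (hW hv))
  linarith

/-- The consistency error of an inexact form `B'`, composed with two projections, is of second
order when `B` and `B'` agree on a set of good approximations. -/
theorem consistency_error_le (hB : IsPSDForm V B) (hW : W ≤ V) (hB' : IsPSDForm W B') (hU : U ≤ W)
    {K : ℝ} (hK : 0 ≤ K) (hle : ∀ f ∈ W, B' f f ≤ K * B f f)
    {u₁ u₂ p₁ p₂ a₁ a₂ c₁ c₂ v₁ v₂ : X} (hu₁ : u₁ ∈ V) (hu₂ : u₂ ∈ V)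
    (hp₁ : p₁ ∈ W) (hp₂ : p₂ ∈ W) (hP₁ : ∀ w ∈ W, B p₁ w = B u₁ w) (hP₂ : ∀ w ∈ W, B p₂ w = B u₂ w)
    (ha₁ : a₁ ∈ U) (ha₂ : a₂ ∈ U) (hA₁ : ∀ w ∈ U, B' a₁ w = B' p₁ w)
    (hA₂ : ∀ w ∈ U, B' a₂ w = B' p₂ w)
    (hc₁ : c₁ ∈ W) (hc₂ : c₂ ∈ W) (hC₁ : ∀ w ∈ W, B c₁ w = B' c₁ w) (hC₂ : ∀ w ∈ W, B c₂ w = B' c₂ w)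
    (hv₁ : v₁ ∈ U) (hv₂ : v₂ ∈ U) {e₁ e₂ : ℝ} (he₁ : 0 ≤ e₁) (he₂ : 0 ≤ e₂)
    (hce₁ : B (u₁ - c₁) (u₁ - c₁) ≤ e₁ ^ 2) (hce₂ : B (u₂ - c₂) (u₂ - c₂) ≤ e₂ ^ 2)
    (hve₁ : B (u₁ - v₁) (u₁ - v₁) ≤ e₁ ^ 2) (hve₂ : B (u₂ - v₂) (u₂ - v₂) ≤ e₂ ^ 2) :
    |B u₁ u₂ - B' a₁ a₂| ≤ (2 + 2 * K) * (e₁ * e₂) := by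
  have b1 : |B (u₁ - p₁) (u₂ - p₂)| ≤ 1 * (e₁ * e₂) :=
    hB.abs_le (V.sub_mem hu₁ (hW hp₁)) (V.sub_mem hu₂ (hW hp₂)) zero_le_one he₁ he₂
      (by linarith [hB.proj_error_le hW hu₁ hp₁ hc₁ hP₁])
      (by linarith [hB.proj_error_le hW hu₂ hp₂ hc₂ hP₂])
  have q1 := hB.proj_sub_le hW hu₁ hp₁ hc₁ hP₁
  have q2 := hB.proj_sub_le hW hu₂ hp₂ hc₂ hP₂
  have m1 := W.sub_mem hp₁ hc₁
  have m2 := W.sub_mem hp₂ hc₂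
  have b2 : |B (p₁ - c₁) (p₂ - c₂)| ≤ 1 * (e₁ * e₂) :=
    hB.abs_le (hW m1) (hW m2) zero_le_one he₁ he₂ (by linarith) (by linarith)
  have b3 : |B' (p₁ - c₁) (p₂ - c₂)| ≤ K * (e₁ * e₂) :=
    hB'.abs_le m1 m2 hK he₁ he₂
      ((hle _ m1).trans (mul_le_mul_of_nonneg_left (by linarith) hK))
      ((hle _ m2).trans (mul_le_mul_of_nonneg_left (by linarith) hK))
  have n1 := W.sub_mem hp₁ (hU hv₁)
  have n2 := W.sub_mem hp₂ (hU hv₂)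
  have r1 := hB.proj_sub_le hW hu₁ hp₁ (hU hv₁) hP₁
  have r2 := hB.proj_sub_le hW hu₂ hp₂ (hU hv₂) hP₂
  have b4 : |B' (p₁ - a₁) (p₂ - a₂)| ≤ K * (e₁ * e₂) :=
    hB'.abs_le (W.sub_mem hp₁ (hU ha₁)) (W.sub_mem hp₂ (hU ha₂)) hK he₁ he₂
      ((hB'.proj_error_le hU hp₁ ha₁ hv₁ hA₁).trans
        ((hle _ n1).trans (mul_le_mul_of_nonneg_left (by linarith) hK)))
      ((hB'.proj_error_le hU hp₂ ha₂ hv₂ hA₂).trans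
        ((hle _ n2).trans (mul_le_mul_of_nonneg_left (by linarith) hK)))
  have e1 : B u₁ u₂ = B (u₁ - p₁) (u₂ - p₂) + B p₁ p₂ := by
    rw [hB.sub_sub hu₁ (hW hp₁) hu₂ (hW hp₂), ← hP₁ p₂ hp₂, hB.symm p₁ u₂, ← hP₂ p₁ hp₁,
      hB.symm p₂ p₁]
    ring
  have e2 : B' p₁ p₂ = B' (p₁ - a₁) (p₂ - a₂) + B' a₁ a₂ := by
    rw [hB'.sub_sub hp₁ (hU ha₁) hp₂ (hU ha₂), ← hA₁ a₂ ha₂, hB'.symm a₁ p₂, ← hA₂ a₁ ha₁,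
      hB'.symm a₂ a₁]
    ring
  -- Subtracting good approximations changes nothing, since the two forms agree whenever one
  -- argument is `c₁` or `c₂`; this makes the quadrature error quadratic.
  have e3 : B p₁ p₂ - B' p₁ p₂ = B (p₁ - c₁) (p₂ - c₂) - B' (p₁ - c₁) (p₂ - c₂) := by
    rw [(hB.mono hW).sub_sub hp₁ hc₁ hp₂ hc₂, hB'.sub_sub hp₁ hc₁ hp₂ hc₂, hC₁ p₂ hp₂,
      hC₁ c₂ hc₂, hB.symm p₁ c₂, hC₂ p₁ hp₁, hB'.symm p₁ c₂]
    ring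
  have e4 : B u₁ u₂ - B' a₁ a₂ = B (u₁ - p₁) (u₂ - p₂) + B (p₁ - c₁) (p₂ - c₂)
      - B' (p₁ - c₁) (p₂ - c₂) + B' (p₁ - a₁) (p₂ - a₂) := by linarith
  rw [e4]
  rw [abs_le] at *
  constructor <;> linarith [b1.1, b1.2, b2.1, b2.2, b3.1, b3.2, b4.1, b4.2]

end Form

/-! ### The exact and lumped forms, and existence of the projections. -/

section

variable {d : ℕ} {kind : MeshKind} {s t : Finset (Sp d)}
  {Ω : Set (Sp d)} {T : Finset (Finset (Sp d))} {β : Sp d → ℝ} {m M : ℝ}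

/-! ### Polynomials on an element -/

/-- The vertex bound for p - q, whose L² norm is zero, gives equality at the vertices. Positive
volume is essential: it makes the polynomial representing a function on an element well defined. -/
lemma pval_eq_of_ae (hG : IsGoodElement kind s) (hv : 0 < volume (elem s))
    {p q : MvPolynomial (Fin d) ℝ} (hp : p ∈ polySpace d kind 1) (hq : q ∈ polySpace d kind 1)
    (h : pval p =ᵐ[volume.restrict (elem s)] pval q) (x : Sp d) : pval p x = pval q x := by
  obtain ⟨C, hC, hb⟩ := exists_vertex_bound d
  have hvr : 0 < volume.real (elem s) :=
    ENNReal.toReal_pos hv.ne' (isCompact_elem s).measure_lt_top.ne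
  have hz : ∀ v ∈ s, pval p v = pval q v := by
    intro v hvs
    have h1 := hb kind (p - q) (Submodule.sub_mem _ hp hq) (elem s) (isCompact_elem s)
      (convex_elem s) v (mem_elem_of_mem hvs)
    have h2 : ∫ x in elem s, pval (p - q) x ^ 2 = 0 := by
      refine integral_eq_zero_of_ae (h.mono fun x hx => ?_)
      simp [hx]
    rw [h2, mul_zero, pval_sub] at h1
    have h3 : (pval p v - pval q v) ^ 2 ≤ 0 := nonpos_of_mul_nonpos_right h1 hvr
    nlinarith [pow_eq_zero_iff (two_ne_zero) |>.1 (le_antisymm h3 (sq_nonneg _))]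
  rw [hG.basis.repro p hp, hG.basis.repro q hq]
  exact Finset.sum_congr rfl fun v hv => by rw [hz v hv]

lemma elemPoly_spec {u : Sp d → ℝ} (hu : u ∈ UD kind Ω T 1) (hs : s ∈ T) :
    elemPoly kind s u ∈ polySpace d kind 1 ∧
      u =ᵐ[volume.restrict (elem s)] pval (elemPoly kind s u) :=
  Classical.epsilon_spec
    (p := fun p => p ∈ polySpace d kind 1 ∧ u =ᵐ[volume.restrict (elem s)] pval p) (hu.2 s hs)

lemma pval_elemPoly (hG : IsGoodElement kind s) (hv : 0 < volume (elem s)) {u : Sp d → ℝ}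
    {p : MvPolynomial (Fin d) ℝ} (hp : p ∈ polySpace d kind 1)
    (h : u =ᵐ[volume.restrict (elem s)] pval p) (x : Sp d) :
    pval (elemPoly kind s u) x = pval p x := by
  have h1 := Classical.epsilon_spec
    (p := fun p => p ∈ polySpace d kind 1 ∧ u =ᵐ[volume.restrict (elem s)] pval p) ⟨p, hp, h⟩
  exact pval_eq_of_ae hG hv h1.1 hp (h1.2.symm.trans h) x

/-! ### The function spaces as subspaces -/

/-- `L²(Ω)` as a space of functions. -/
def L2Space (Ω : Set (Sp d)) : Submodule ℝ (Sp d → ℝ) where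
  carrier := {u | MemLp u 2 (volume.restrict Ω)}
  add_mem' ha hb := MemLp.add ha hb
  zero_mem' := MemLp.zero
  smul_mem' c _ h := MemLp.const_smul h c

/-- `U^D_{H,1}` as a subspace. -/
def UDSpace (kind : MeshKind) (Ω : Set (Sp d)) (T : Finset (Finset (Sp d))) :
    Submodule ℝ (Sp d → ℝ) where
  carrier := UD kind Ω T 1
  add_mem' := by
    rintro u w ⟨hu, hu'⟩ ⟨hw, hw'⟩
    refine ⟨hu.add hw, fun s hs => ?_⟩
    obtain ⟨p, hp, hup⟩ := hu' s hs
    obtain ⟨q, hq, hwq⟩ := hw' s hs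
    refine ⟨p + q, Submodule.add_mem _ hp hq, ?_⟩
    filter_upwards [hup, hwq] with x h1 h2
    simp [h1, h2]
  zero_mem' := ⟨MemLp.zero, fun s _ => ⟨0, Submodule.zero_mem _, ae_of_all _ fun x => by simp⟩⟩
  smul_mem' := by
    rintro c u ⟨hu, hu'⟩
    refine ⟨hu.const_smul c, fun s hs => ?_⟩
    obtain ⟨p, hp, hup⟩ := hu' s hs
    refine ⟨c • p, Submodule.smul_mem _ c hp, ?_⟩
    filter_upwards [hup] with x h1
    simp [h1]

/-- `U_H` as a subspace. -/
def UHSpace (kind : MeshKind) (hΩ : IsOpen Ω) (T : Finset (Finset (Sp d))) :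
    Submodule ℝ (Sp d → ℝ) :=
  UDSpace kind Ω T ⊓ H10 hΩ

lemma UDSpace_le : UDSpace kind Ω T ≤ L2Space Ω := fun _ h => h.1

lemma UHSpace_le (hΩ : IsOpen Ω) : UHSpace kind hΩ T ≤ UDSpace kind Ω T := inf_le_left

/-- A mesh of a Lipschitz domain by elements of positive volume, and a coefficient between two
positive constants. -/
structure IsSetting (kind : MeshKind) (Ω : Set (Sp d)) (T : Finset (Finset (Sp d)))
    (β : Sp d → ℝ) (m M : ℝ) : Prop where
  dim : 1 ≤ d
  domain : IsLipschitzDomain Ω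
  mesh : IsMesh kind Ω T
  volume_pos : ∀ s ∈ T, 0 < volume (elem s)
  meas : AEMeasurable β (volume.restrict Ω)
  bound : ∀ᵐ x ∂(volume.restrict Ω), m ≤ β x ∧ β x ≤ M
  pos : 0 < m

namespace IsSetting

variable (S : IsSetting kind Ω T β m M)
include S

lemma restrict_le (hs : s ∈ T) : (volume.restrict (elem s) : Measure (Sp d)) ≤ volume.restrict Ω := by
  rw [S.mesh.restrict_eq S.dim S.domain]
  exact Finset.single_le_sum (f := fun s => (volume.restrict (elem s) : Measure (Sp d)))
    (fun _ _ => Measure.zero_le _) hs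

lemma ae_elem (hs : s ∈ T) {P : Sp d → Prop} (h : ∀ᵐ x ∂(volume.restrict Ω), P x) :
    ∀ᵐ x ∂(volume.restrict (elem s)), P x :=
  h.filter_mono (ae_mono (S.restrict_le hs))

lemma integral_eq {f : Sp d → ℝ} (hf : Integrable f (volume.restrict Ω)) :
    ∫ x in Ω, f x = ∑ s ∈ T, ∫ x in elem s, f x := by
  rw [S.mesh.restrict_eq S.dim S.domain, integral_finsetSum_measure]
  exact fun s hs => hf.mono_measure (S.restrict_le hs)

lemma norm_bound : ∀ᵐ x ∂(volume.restrict Ω), ‖β x‖ ≤ M :=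
  S.bound.mono fun x hx => by
    rw [Real.norm_eq_abs, abs_of_nonneg (S.pos.le.trans hx.1)]
    exact hx.2

lemma integrable_mul {f : Sp d → ℝ} (hf : Integrable f (volume.restrict Ω)) :
    Integrable (fun x => β x * f x) (volume.restrict Ω) :=
  hf.bdd_mul S.meas.aestronglyMeasurable S.norm_bound

lemma integrable_mul_elem (hs : s ∈ T) {f : Sp d → ℝ} (hf : Continuous f) :
    Integrable (fun x => β x * f x) (volume.restrict (elem s)) :=
  Integrable.bdd_mul (hf.continuousOn.integrableOn_compact (isCompact_elem s))
    (S.meas.mono_measure (S.restrict_le hs)).aestronglyMeasurable (S.ae_elem hs S.norm_bound)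

/-! ### The form `b` -/

lemma isPSDForm_bform : IsPSDForm (L2Space Ω) (bform Ω β) where
  symm f g := by simp only [bform, mul_comm (f _)]
  add f hf g hg k hk := by
    rw [bform, bform, bform, ← integral_add (S.integrable_mul (integrable_mul_of_memLp hf hk))
      (S.integrable_mul (integrable_mul_of_memLp hg hk))]
    exact integral_congr_ae (ae_of_all _ fun x => by simp only [Pi.add_apply]; ring)
  smul c f hf g hg := by
    rw [bform, bform, ← integral_const_mul]
    exact integral_congr_ae (ae_of_all _ fun x => by
      simp only [Pi.smul_apply, smul_eq_mul]; ring)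
  nonneg f hf := integral_nonneg_of_ae (S.bound.mono fun x hx =>
    mul_nonneg (S.pos.le.trans hx.1) (mul_self_nonneg _))

lemma bform_self_le {f : Sp d → ℝ} (hf : MemLp f 2 (volume.restrict Ω)) :
    bform Ω β f f ≤ M * ∫ x in Ω, f x ^ 2 := by
  rw [bform, ← integral_const_mul]
  refine integral_mono_ae (S.integrable_mul (integrable_mul_of_memLp hf hf))
    (hf.integrable_sq.const_mul M) (S.bound.mono fun x hx => ?_)
  simp only [← sq]
  exact mul_le_mul_of_nonneg_right hx.2 (sq_nonneg _)

lemma le_bform_self {f : Sp d → ℝ} (hf : MemLp f 2 (volume.restrict Ω)) :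
    m * ∫ x in Ω, f x ^ 2 ≤ bform Ω β f f := by
  rw [bform, ← integral_const_mul]
  refine integral_mono_ae (hf.integrable_sq.const_mul m)
    (S.integrable_mul (integrable_mul_of_memLp hf hf)) (S.bound.mono fun x hx => ?_)
  simp only [← sq]
  exact mul_le_mul_of_nonneg_right hx.1 (sq_nonneg _)

/-! ### The lumped form -/

lemma pval_elemPoly_add {u w : Sp d → ℝ} (hu : u ∈ UDSpace kind Ω T) (hw : w ∈ UDSpace kind Ω T)
    (hs : s ∈ T) (x : Sp d) : pval (elemPoly kind s (u + w)) x =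
      pval (elemPoly kind s u) x + pval (elemPoly kind s w) x := by
  have h1 := elemPoly_spec hu hs
  have h2 := elemPoly_spec hw hs
  rw [← pval_add]
  refine pval_elemPoly (S.mesh.good S.dim hs) (S.volume_pos s hs) (Submodule.add_mem _ h1.1 h2.1)
    ?_ x
  filter_upwards [h1.2, h2.2] with y e1 e2
  simp only [Pi.add_apply, pval_add, ← e1, ← e2]

lemma pval_elemPoly_smul (c : ℝ) {u : Sp d → ℝ} (hu : u ∈ UDSpace kind Ω T)
    (hs : s ∈ T) (x : Sp d) : pval (elemPoly kind s (c • u)) x =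
      c * pval (elemPoly kind s u) x := by
  have h1 := elemPoly_spec hu hs
  rw [← pval_smul]
  refine pval_elemPoly (S.mesh.good S.dim hs) (S.volume_pos s hs) (Submodule.smul_mem _ c h1.1)
    ?_ x
  filter_upwards [h1.2] with y e1
  simp only [Pi.smul_apply, smul_eq_mul, pval_smul, ← e1]

lemma integral_interp (hs : s ∈ T) (f : Sp d → ℝ) :
    ∫ x in elem s, β x * pval (interp kind s f) x =
      ∑ v ∈ s, (∫ x in elem s, β x * pval (nodal kind s v) x) * f v := by
  have e : ∀ x, β x * pval (interp kind s f) x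
      = ∑ v ∈ s, β x * pval (nodal kind s v) x * f v := fun x => by
    rw [pval_interp (S.mesh.good S.dim hs).basis, Finset.mul_sum]
    exact Finset.sum_congr rfl fun v _ => by ring
  simp only [e]
  rw [integral_finsetSum _ fun v _ =>
    (S.integrable_mul_elem hs (continuous_pval _)).mul_const (f v)]
  exact Finset.sum_congr rfl fun v _ => integral_mul_const _ _

/-- Lumping is a quadrature rule: the form is diagonal in the vertex values on each element, and its
weights are nonnegative because nodal functions are nonnegative there (`mass_nonneg`). -/
lemma bH_eq (u w : Sp d → ℝ) : bH kind T β u w =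
    ∑ s ∈ T, ∑ v ∈ s, (∫ x in elem s, β x * pval (nodal kind s v) x) *
      (pval (elemPoly kind s u) v * pval (elemPoly kind s w) v) :=
  Finset.sum_congr rfl fun _ hs => S.integral_interp hs _

lemma mass_nonneg (hs : s ∈ T) {v : Sp d} (hv : v ∈ s) :
    0 ≤ ∫ x in elem s, β x * pval (nodal kind s v) x := by
  refine integral_nonneg_of_ae ?_
  filter_upwards [S.ae_elem hs S.bound, ae_restrict_mem (isCompact_elem s).measurableSet]
    with x h1 h2
  exact mul_nonneg (S.pos.le.trans h1.1) ((S.mesh.good S.dim hs).nonneg v hv x h2)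

lemma isPSDForm_bH : IsPSDForm (UDSpace kind Ω T) (bH kind T β) where
  symm f g := by
    rw [S.bH_eq, S.bH_eq]
    simp only [mul_comm (pval (elemPoly kind _ f) _)]
  add f hf g hg k hk := by
    rw [S.bH_eq, S.bH_eq, S.bH_eq, ← Finset.sum_add_distrib]
    refine Finset.sum_congr rfl fun s hs => ?_
    rw [← Finset.sum_add_distrib]
    refine Finset.sum_congr rfl fun v _ => ?_
    rw [S.pval_elemPoly_add hf hg hs]
    ring
  smul c f hf g hg := by
    rw [S.bH_eq, S.bH_eq, Finset.mul_sum]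
    refine Finset.sum_congr rfl fun s hs => ?_
    rw [Finset.mul_sum]
    refine Finset.sum_congr rfl fun v _ => ?_
    rw [S.pval_elemPoly_smul c hf hs]
    ring
  nonneg f hf := by
    rw [S.bH_eq]
    exact Finset.sum_nonneg fun s hs => Finset.sum_nonneg fun v hv =>
      mul_nonneg (S.mass_nonneg hs hv) (mul_self_nonneg _)

lemma sum_mass (hs : s ∈ T) :
    ∑ v ∈ s, ∫ x in elem s, β x * pval (nodal kind s v) x = ∫ x in elem s, β x := by
  rw [← integral_finsetSum _ fun v _ => S.integrable_mul_elem hs (continuous_pval _)]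
  simp only [← Finset.mul_sum, (S.mesh.good S.dim hs).basis.sum_eq_one, mul_one]

/-- The lumped form is bounded by the exact one. -/
lemma bH_self_le {C : ℝ} (hC : 0 < C)
    (hb : ∀ (kind : MeshKind) (p : MvPolynomial (Fin d) ℝ), p ∈ polySpace d kind 1 →
      ∀ K : Set (Sp d), IsCompact K → Convex ℝ K → ∀ v ∈ K,
        volume.real K * pval p v ^ 2 ≤ C * ∫ x in K, pval p x ^ 2)
    {f : Sp d → ℝ} (hf : f ∈ UDSpace kind Ω T) :
    bH kind T β f f ≤ M * C / m * bform Ω β f f := by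
  have hfL : MemLp f 2 (volume.restrict Ω) := hf.1
  obtain ⟨s₀, hs₀⟩ := S.mesh.nonempty S.domain
  -- Almost everywhere on an element of positive volume β lies between `m` and `M`, so the interval
  -- is nonempty.
  have hM : 0 < M := by
    have hne : (ae (volume.restrict (elem s₀) : Measure (Sp d))).NeBot := by
      rw [ae_neBot]
      intro h
      rw [Measure.restrict_eq_zero] at h
      exact (S.volume_pos s₀ hs₀).ne' h
    obtain ⟨x, hx⟩ := (S.ae_elem hs₀ S.bound).exists
    exact S.pos.trans_le (hx.1.trans hx.2)
  have step : ∀ s ∈ T, ∑ v ∈ s, (∫ x in elem s, β x * pval (nodal kind s v) x) *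
      (pval (elemPoly kind s f) v * pval (elemPoly kind s f) v)
      ≤ M * C * ∫ x in elem s, f x ^ 2 := by
    intro s hs
    have hvr : 0 < volume.real (elem s) :=
      ENNReal.toReal_pos (S.volume_pos s hs).ne' (isCompact_elem s).measure_lt_top.ne
    obtain ⟨hp, hfp⟩ := elemPoly_spec hf hs
    set p := elemPoly kind s f
    have e1 : ∫ x in elem s, f x ^ 2 = ∫ x in elem s, pval p x ^ 2 :=
      integral_congr_ae (hfp.mono fun x hx => by simp only [hx])
    rw [e1]
    set I := ∫ x in elem s, pval p x ^ 2
    have hI : 0 ≤ I := integral_nonneg fun x => sq_nonneg _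
    have hβ : ∫ x in elem s, β x ≤ M * volume.real (elem s) := by
      have h1 : ∫ x in elem s, β x ≤ ∫ _x in elem s, M := by
        refine integral_mono_ae ?_ (integrableOn_const (isCompact_elem s).measure_lt_top.ne)
          ((S.ae_elem hs S.bound).mono fun x hx => hx.2)
        simpa using S.integrable_mul_elem hs (f := fun _ => 1) continuous_const
      refine h1.trans (le_of_eq ?_)
      rw [setIntegral_const, smul_eq_mul, mul_comm]
    calc ∑ v ∈ s, (∫ x in elem s, β x * pval (nodal kind s v) x) * (pval p v * pval p v)
        ≤ ∑ v ∈ s, (∫ x in elem s, β x * pval (nodal kind s v) x)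
            * (C * I / volume.real (elem s)) := by
          refine Finset.sum_le_sum fun v hv => mul_le_mul_of_nonneg_left ?_ (S.mass_nonneg hs hv)
          rw [le_div_iff₀ hvr, ← sq, mul_comm]
          exact hb kind p hp _ (isCompact_elem s) (convex_elem s) v (mem_elem_of_mem hv)
      _ ≤ M * volume.real (elem s) * (C * I / volume.real (elem s)) := by
          rw [← Finset.sum_mul, S.sum_mass hs]
          exact mul_le_mul_of_nonneg_right hβ (by positivity)
      _ = M * C * I := by field_simp
  calc bH kind T β f f ≤ ∑ s ∈ T, M * C * ∫ x in elem s, f x ^ 2 := by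
        rw [S.bH_eq]
        exact Finset.sum_le_sum step
    _ = M * C / m * (m * ∫ x in Ω, f x ^ 2) := by
        rw [← Finset.mul_sum, ← S.integral_eq hfL.integrable_sq]
        have := S.pos.ne'
        field_simp
    _ ≤ _ := mul_le_mul_of_nonneg_left (S.le_bform_self hfL)
        (div_nonneg (by positivity) S.pos.le)

/-- The forms agree when one argument is constant on every element. -/
lemma bform_eq_bH_of_const {c q : Sp d → ℝ} (hc : c ∈ UDSpace kind Ω T) {a : Finset (Sp d) → ℝ}
    (hca : ∀ s ∈ T, c =ᵐ[volume.restrict (elem s)] fun _ => a s) (hq : q ∈ UDSpace kind Ω T) :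
    bform Ω β c q = bH kind T β c q := by
  rw [bform, S.integral_eq (S.integrable_mul (integrable_mul_of_memLp hc.1 hq.1)), bH]
  refine Finset.sum_congr rfl fun s hs => ?_
  have hG := S.mesh.good S.dim hs
  obtain ⟨hp, hqp⟩ := elemPoly_spec hq hs
  have h1 : ∀ x, pval (elemPoly kind s c) x = a s := fun x => by
    rw [pval_elemPoly hG (S.volume_pos s hs) (C_mem_polySpace (a s))
      ((hca s hs).trans (ae_of_all _ fun y => by simp)), pval_C]
  refine integral_congr_ae ?_
  filter_upwards [hca s hs, hqp] with x e1 e2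
  -- A constant times a function of the local space is again in the local space, so its
  -- interpolation is exact.
  rw [pval_interp hG.basis, e1, e2, hG.basis.repro _ hp x, Finset.mul_sum]
  simp only [h1, mul_assoc]

/-! ### The projections -/

/-- The values of an element of `U^D_{H,1}` at the vertices of all elements. -/
def vertexValues : UDSpace kind Ω T →ₗ[ℝ] ({i // i ∈ T.sigma fun s => s} → ℝ) where
  toFun u i := pval (elemPoly kind i.1.1 (u : Sp d → ℝ)) i.1.2
  map_add' u w := by
    funext i
    exact S.pval_elemPoly_add u.2 w.2 (Finset.mem_sigma.1 i.2).1 i.1.2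
  map_smul' c u := by
    funext i
    exact S.pval_elemPoly_smul c u.2 (Finset.mem_sigma.1 i.2).1 i.1.2

lemma vertex_eq_zero {u : UDSpace kind Ω T} (h : S.vertexValues u = 0) (hs : s ∈ T)
    {v : Sp d} (hv : v ∈ s) : pval (elemPoly kind s (u : Sp d → ℝ)) v = 0 :=
  congrFun h ⟨⟨s, v⟩, Finset.mem_sigma.2 ⟨hs, hv⟩⟩

/-- Shows that the choice in `PiD` does satisfy its defining property. A function whose vertex
values all vanish is zero a.e., so the space is finite-dimensional modulo the radical of b. -/
lemma PiD_spec {u : Sp d → ℝ} (hu : u ∈ L2Space Ω) :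
    PiD kind Ω T β 1 u ∈ UDSpace kind Ω T ∧
      ∀ w ∈ UDSpace kind Ω T, bform Ω β (PiD kind Ω T β 1 u) w = bform Ω β u w := by
  refine Classical.epsilon_spec (p := fun v => v ∈ UD kind Ω T 1 ∧
    ∀ w ∈ UD kind Ω T 1, bform Ω β v w = bform Ω β u w) ?_
  refine S.isPSDForm_bform.exists_proj UDSpace_le S.vertexValues (fun w hw => ?_) hu
  rw [bform, S.integral_eq (S.integrable_mul (integrable_mul_of_memLp w.2.1 w.2.1))]
  refine Finset.sum_eq_zero fun s hs => integral_eq_zero_of_ae ?_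
  obtain ⟨hp, hwp⟩ := elemPoly_spec w.2 hs
  filter_upwards [hwp] with x hx
  have : pval (elemPoly kind s (w : Sp d → ℝ)) x = 0 := by
    rw [(S.mesh.good S.dim hs).basis.repro _ hp]
    exact Finset.sum_eq_zero fun v hv => by rw [S.vertex_eq_zero hw hs hv, zero_mul]
  simp [hx, this]

/-- The same for `PiAv`: zero vertex values annihilate every summand of the diagonal form. -/
lemma PiAv_spec {u : Sp d → ℝ} (hu : u ∈ UDSpace kind Ω T) :
    PiAv kind Ω T β u ∈ UHSpace kind S.domain.isOpen T ∧
      ∀ w ∈ UHSpace kind S.domain.isOpen T, bH kind T β (PiAv kind Ω T β u) w = bH kind T β u w := by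
  refine Classical.epsilon_spec (p := fun v => v ∈ UH kind Ω T ∧
    ∀ w ∈ UH kind Ω T, bH kind T β v w = bH kind T β u w) ?_
  refine S.isPSDForm_bH.exists_proj (UHSpace_le S.domain.isOpen)
    (S.vertexValues ∘ₗ Submodule.inclusion (UHSpace_le S.domain.isOpen)) (fun w hw => ?_) hu
  rw [S.bH_eq]
  refine Finset.sum_eq_zero fun s hs => Finset.sum_eq_zero fun v hv => ?_
  have : pval (elemPoly kind s (w : Sp d → ℝ)) v = 0 :=
    S.vertex_eq_zero (u := Submodule.inclusion (UHSpace_le S.domain.isOpen) w) hw hs hv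
  rw [this, mul_zero, mul_zero]

end IsSetting

end

/-! ### Approximation of H¹₀ functions and the consistency estimate. -/

section

variable {d : ℕ} {kind : MeshKind} {s t : Finset (Sp d)}
  {Ω : Set (Sp d)} {T : Finset (Finset (Sp d))} {β : Sp d → ℝ} {m M : ℝ}

/-! ### Piecewise constant functions -/

/-- The function with the constant value `a s` on every element `s` (up to null sets). -/
def pwConst (T : Finset (Finset (Sp d))) (a : Finset (Sp d) → ℝ) (x : Sp d) : ℝ :=
  ∑ s ∈ T, (elem s).indicator (fun _ => a s) x

lemma IsMesh.pwConst_ae_eq (hM : IsMesh kind Ω T) (hd : 1 ≤ d) (a : Finset (Sp d) → ℝ)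
    (hs : s ∈ T) : pwConst T a =ᵐ[volume.restrict (elem s)] fun _ => a s := by
  have h1 : ∀ t ∈ T, t ≠ s → ∀ᵐ x ∂(volume.restrict (elem s)), x ∉ elem t := by
    intro t ht hne
    rw [ae_iff, Measure.restrict_apply' (isCompact_elem s).measurableSet]
    simp only [not_not]
    exact hM.volume_inter hd ht hs hne
  have h2 : ∀ᵐ x ∂(volume.restrict (elem s)), ∀ t ∈ T, t ≠ s → x ∉ elem t := by
    rw [eventually_all_finset]
    intro t ht
    by_cases hne : t = s
    · exact ae_of_all _ fun x h => absurd hne h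
    · filter_upwards [h1 t ht hne] with x hx _ using hx
  filter_upwards [h2, ae_restrict_mem (isCompact_elem s).measurableSet] with x hx hxs
  rw [pwConst, Finset.sum_eq_single_of_mem s hs fun t ht hne =>
    Set.indicator_of_notMem (hx t ht hne) _]
  exact Set.indicator_of_mem hxs _

lemma pwConst_memLp (hb : Bornology.IsBounded Ω) (a : Finset (Sp d) → ℝ) :
    MemLp (pwConst T a) 2 (volume.restrict Ω) := by
  have := isFiniteMeasure_restrict hb
  exact memLp_finsetSum T fun s _ => (memLp_const (a s)).indicator (isCompact_elem s).measurableSet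

namespace IsSetting

variable (S : IsSetting kind Ω T β m M)
include S

lemma pwConst_mem (a : Finset (Sp d) → ℝ) : pwConst T a ∈ UDSpace kind Ω T :=
  ⟨pwConst_memLp S.domain.isBounded a, fun s hs => ⟨MvPolynomial.C (a s), C_mem_polySpace _,
    (S.mesh.pwConst_ae_eq S.dim a hs).trans (ae_of_all _ fun x => by simp)⟩⟩

/-- The error of the piecewise averages of a smooth function. -/
lemma pwConst_error {φ : Sp d → ℝ} (hφ : IsTestFun Ω φ) :
    ∫ x in Ω, (φ x - pwConst T (fun s => ⨍ y in elem s, φ y) x) ^ 2 ≤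
      2 ^ d * meshWidth T ^ 2 * ∫ x in Ω, ‖gradient φ x‖ ^ 2 := by
  have hint : Integrable (fun x => (φ x - pwConst T (fun s => ⨍ y in elem s, φ y) x) ^ 2)
      (volume.restrict Ω) :=
    ((hφ.memLp _).sub (pwConst_memLp S.domain.isBounded _)).integrable_sq
  rw [S.integral_eq hint, S.integral_eq (hφ.memLp_gradient _).norm.integrable_sq, Finset.mul_sum]
  refine Finset.sum_le_sum fun s hs => ?_
  refine le_trans (le_of_eq ?_) (poincare_convex (isCompact_elem s) (convex_elem s)
    (S.volume_pos s hs) (fun x hx y hy => (dist_le_elemDiam hx hy).trans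
      (elemDiam_le_meshWidth hs)) hφ.contDiff_one)
  refine integral_congr_ae ?_
  filter_upwards [S.mesh.pwConst_ae_eq S.dim (fun s => ⨍ y in elem s, φ y) hs] with x hx
  rw [hx]

end IsSetting

/-! ### Approximation in `H¹₀` -/

lemma setIntegral_sub_sq_le {f g k : Sp d → ℝ} (hf : MemLp f 2 (volume.restrict Ω))
    (hg : MemLp g 2 (volume.restrict Ω)) (hk : MemLp k 2 (volume.restrict Ω)) :
    ∫ x in Ω, (f x - k x) ^ 2 ≤ 2 * (∫ x in Ω, (f x - g x) ^ 2) + 2 * ∫ x in Ω, (g x - k x) ^ 2 := by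
  have i1 : Integrable (fun x => (f x - g x) ^ 2) (volume.restrict Ω) := (hf.sub hg).integrable_sq
  have i2 : Integrable (fun x => (g x - k x) ^ 2) (volume.restrict Ω) := (hg.sub hk).integrable_sq
  rw [← integral_const_mul, ← integral_const_mul, ← integral_add (i1.const_mul 2) (i2.const_mul 2)]
  refine integral_mono (hf.sub hk).integrable_sq ((i1.const_mul 2).add (i2.const_mul 2))
    fun x => ?_
  simp only
  nlinarith [sq_nonneg ((f x - g x) - (g x - k x))]

/-- Density of test functions, arranged so that the L² error is as small as desired while the
gradient stays bounded by the H¹ norm of u. Estimates for smooth functions can then be transferred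
to u. -/
lemma MemH10.exists_testFun {u : Sp d → ℝ} (hu : MemH10 Ω u) {δ : ℝ} (hδ : 0 < δ) :
    ∃ φ, IsTestFun Ω φ ∧ ∫ x in Ω, (u x - φ x) ^ 2 ≤ δ ∧
      ∫ x in Ω, ‖gradient φ x‖ ^ 2 ≤ 2 * normH1 Ω u ^ 2 + 2 * δ := by
  obtain ⟨φ, hφ, h⟩ := hu.2 δ hδ
  have hG : MemLp (weakGrad Ω u) 2 (volume.restrict Ω) := hu.1.hasWeakGrad.1
  have hg := hφ.memLp_gradient (volume.restrict Ω)
  have h0 : 0 ≤ ∫ x in Ω, (u x - φ x) ^ 2 := integral_nonneg fun x => sq_nonneg _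
  have h1 : 0 ≤ ∫ x in Ω, ‖weakGrad Ω u x - gradient φ x‖ ^ 2 :=
    integral_nonneg fun x => sq_nonneg _
  have h2 : 0 ≤ ∫ x in Ω, u x ^ 2 := integral_nonneg fun x => sq_nonneg _
  have h3 : 0 ≤ ∫ x in Ω, ‖weakGrad Ω u x‖ ^ 2 := integral_nonneg fun x => sq_nonneg _
  have hN : normH1 Ω u ^ 2 = (∫ x in Ω, u x ^ 2) + ∫ x in Ω, ‖weakGrad Ω u x‖ ^ 2 :=
    Real.sq_sqrt (by positivity)
  refine ⟨φ, hφ, by linarith, ?_⟩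
  have i1 := hG.norm.integrable_sq
  have i2 : Integrable (fun x => ‖weakGrad Ω u x - gradient φ x‖ ^ 2) (volume.restrict Ω) :=
    (hG.sub hg).norm.integrable_sq
  have key : ∫ x in Ω, ‖gradient φ x‖ ^ 2 ≤ 2 * (∫ x in Ω, ‖weakGrad Ω u x‖ ^ 2)
      + 2 * ∫ x in Ω, ‖weakGrad Ω u x - gradient φ x‖ ^ 2 := by
    rw [← integral_const_mul, ← integral_const_mul, ← integral_add (i1.const_mul 2)
      (i2.const_mul 2)]
    refine integral_mono hg.norm.integrable_sq ((i1.const_mul 2).add (i2.const_mul 2)) fun x => ?_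
    have h4 : ‖gradient φ x‖ ≤ ‖weakGrad Ω u x‖ + ‖weakGrad Ω u x - gradient φ x‖ := by
      have := norm_sub_le (weakGrad Ω u x) (weakGrad Ω u x - gradient φ x)
      rwa [sub_sub_cancel] at this
    simp only
    nlinarith [sq_nonneg (‖weakGrad Ω u x‖ - ‖weakGrad Ω u x - gradient φ x‖),
      norm_nonneg (gradient φ x)]
  linarith

/-- The constant in the quasi-interpolation estimate. -/
def quasiConst (d : ℕ) (c : ℝ) : ℝ :=
  (2 * (2 ^ d * 144) + 2 * ((2 * (2 ^ d * 144) + 8) / c ^ d)) * (7 / c) ^ d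

namespace IsSetting

variable (S : IsSetting kind Ω T β m M)
include S

/-- Simultaneous approximation by piecewise constants and in `U_H`. -/
lemma exists_approx {c : ℝ} (hc0 : 0 < c) (hc1 : c ≤ 1)
    (hball : ∀ s ∈ T, ∃ x, Metric.closedBall x (c * meshWidth T) ⊆ elem s)
    {u : Sp d → ℝ} (hu : MemH10 Ω u) {η : ℝ} (hη : 0 < η) :
    ∃ a : Finset (Sp d) → ℝ, ∃ v ∈ UHSpace kind S.domain.isOpen T,
      ∫ x in Ω, (u x - pwConst T a x) ^ 2 ≤
        4 * (quasiConst d c + 2 ^ d) * meshWidth T ^ 2 * normH1 Ω u ^ 2 + η ∧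
      ∫ x in Ω, (u x - v x) ^ 2 ≤
        4 * (quasiConst d c + 2 ^ d) * meshWidth T ^ 2 * normH1 Ω u ^ 2 + η := by
  set H := meshWidth T
  set N := normH1 Ω u
  have hQ : 0 ≤ quasiConst d c := by unfold quasiConst; positivity
  set A := (quasiConst d c + 2 ^ d) * H ^ 2 with hA
  have hA0 : 0 ≤ A := by positivity
  -- The total error is at most 2δ + 2A(2N² + 2δ) = 4AN² + (2 + 4A)δ, which dictates this δ.
  obtain ⟨φ, hφ, h1, h2⟩ := hu.exists_testFun (δ := η / (2 + 4 * A)) (by positivity)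
  have hδ : (2 + 4 * A) * (η / (2 + 4 * A)) = η := by field_simp
  set δ := η / (2 + 4 * A)
  have hg0 : 0 ≤ ∫ x in Ω, ‖gradient φ x‖ ^ 2 := integral_nonneg fun x => sq_nonneg _
  have key : ∀ k : Sp d → ℝ, MemLp k 2 (volume.restrict Ω) → ∀ B ≤ A,
      ∫ x in Ω, (φ x - k x) ^ 2 ≤ B * ∫ x in Ω, ‖gradient φ x‖ ^ 2 →
      ∫ x in Ω, (u x - k x) ^ 2 ≤ 4 * (quasiConst d c + 2 ^ d) * H ^ 2 * N ^ 2 + η := by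
    intro k hk B hB h
    have h3 := setIntegral_sub_sq_le hu.1.1 (hφ.memLp _) hk
    have h4 := mul_le_mul_of_nonneg_right hB hg0
    have h5 := mul_le_mul_of_nonneg_left h2 hA0
    have h6 : 4 * (quasiConst d c + 2 ^ d) * H ^ 2 * N ^ 2 = 4 * A * N ^ 2 := by rw [hA]; ring
    rw [h6]
    nlinarith
  refine ⟨fun s => ⨍ y in elem s, φ y, pwFun kind T (quasiVal kind Ω T φ),
    pwFun_quasiVal_mem S.mesh S.dim S.domain φ, ?_, ?_⟩
  · refine key _ (pwConst_memLp S.domain.isBounded _) (2 ^ d * H ^ 2) ?_ (S.pwConst_error hφ)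
    rw [hA]
    gcongr
    linarith
  · refine key _ (pwFun_quasiVal_mem S.mesh S.dim S.domain φ).1.1 (quasiConst d c * H ^ 2) ?_
      (quasi_error S.mesh S.dim S.domain hc0 hc1 hball hφ)
    rw [hA]
    gcongr
    have : (0 : ℝ) < 2 ^ d := by positivity
    linarith

/-- The consistency error of the lumped scheme. -/
theorem abs_rH_le (hM : 0 < M) {C : ℝ} (hC : 0 < C)
    (hb : ∀ (kind : MeshKind) (p : MvPolynomial (Fin d) ℝ), p ∈ polySpace d kind 1 →
      ∀ K : Set (Sp d), IsCompact K → Convex ℝ K → ∀ v ∈ K,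
        volume.real K * pval p v ^ 2 ≤ C * ∫ x in K, pval p x ^ 2)
    {c : ℝ} (hc0 : 0 < c) (hc1 : c ≤ 1)
    (hball : ∀ s ∈ T, ∃ x, Metric.closedBall x (c * meshWidth T) ⊆ elem s)
    {u w : Sp d → ℝ} (hu : MemH10 Ω u) (hw : MemH10 Ω w) :
    |rH kind Ω T β u w| ≤ (2 + 2 * (M * C / m)) * (M * (4 * (quasiConst d c + 2 ^ d))) *
      meshWidth T ^ 2 * normH1 Ω u * normH1 Ω w := by
  have hH := (S.mesh.meshWidth_pos S.dim S.domain).le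
  set H := meshWidth T
  have hQ : 0 ≤ quasiConst d c := by unfold quasiConst; positivity
  set A := 4 * (quasiConst d c + 2 ^ d) with hA
  have hA0 : 0 ≤ A := by positivity
  have hK : 0 ≤ M * C / m := div_nonneg (by positivity) S.pos.le
  set K := M * C / m
  have happ : ∀ u, MemH10 Ω u → ∀ η : ℝ, 0 < η → ∃ a : Finset (Sp d) → ℝ,
      ∃ v ∈ UHSpace kind S.domain.isOpen T,
        bform Ω β (u - pwConst T a) (u - pwConst T a) ≤ (√(M * A) * H * normH1 Ω u + η) ^ 2 ∧
        bform Ω β (u - v) (u - v) ≤ (√(M * A) * H * normH1 Ω u + η) ^ 2 := by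
    intro u hu η hη
    -- The tolerance η²/M becomes η² after multiplication by the bound `M` of β, so it is absorbed
    -- in the square of a sum with summand η.
    obtain ⟨a, v, hv, h1, h2⟩ := S.exists_approx hc0 hc1 hball hu (η := η ^ 2 / M) (by positivity)
    have hN : 0 ≤ normH1 Ω u := Real.sqrt_nonneg _
    have e : M * (A * H ^ 2 * normH1 Ω u ^ 2 + η ^ 2 / M)
        ≤ (√(M * A) * H * normH1 Ω u + η) ^ 2 := by
      have h3 : M * (A * H ^ 2 * normH1 Ω u ^ 2 + η ^ 2 / M)
          = √(M * A) ^ 2 * H ^ 2 * normH1 Ω u ^ 2 + η ^ 2 := by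
        rw [Real.sq_sqrt (by positivity)]
        field_simp
      rw [h3]
      have h4 : 0 ≤ √(M * A) * H * normH1 Ω u * η := by positivity
      nlinarith
    refine ⟨a, v, hv, ?_, ?_⟩
    · exact (S.bform_self_le (hu.1.1.sub (pwConst_memLp S.domain.isBounded a))).trans
        ((mul_le_mul_of_nonneg_left h1 hM.le).trans e)
    · exact (S.bform_self_le (hu.1.1.sub hv.1.1)).trans
        ((mul_le_mul_of_nonneg_left h2 hM.le).trans e)
  have main : ∀ η : ℝ, 0 < η → |rH kind Ω T β u w| ≤ (2 + 2 * K) *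
      ((√(M * A) * H * normH1 Ω u + η) * (√(M * A) * H * normH1 Ω w + η)) := by
    intro η hη
    obtain ⟨a₁, v₁, hv₁, hce₁, hve₁⟩ := happ u hu η hη
    obtain ⟨a₂, v₂, hv₂, hce₂, hve₂⟩ := happ w hw η hη
    have hNu : 0 ≤ normH1 Ω u := Real.sqrt_nonneg _
    have hNw : 0 ≤ normH1 Ω w := Real.sqrt_nonneg _
    obtain ⟨hp₁, hP₁⟩ := S.PiD_spec (u := u) hu.1.1
    obtain ⟨hp₂, hP₂⟩ := S.PiD_spec (u := w) hw.1.1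
    obtain ⟨hq₁, hQ₁⟩ := S.PiAv_spec hp₁
    obtain ⟨hq₂, hQ₂⟩ := S.PiAv_spec hp₂
    exact consistency_error_le S.isPSDForm_bform UDSpace_le S.isPSDForm_bH
      (UHSpace_le S.domain.isOpen) hK (fun f hf => S.bH_self_le hC hb hf) hu.1.1 hw.1.1
      hp₁ hp₂ hP₁ hP₂ hq₁ hq₂ hQ₁ hQ₂ (S.pwConst_mem a₁) (S.pwConst_mem a₂)
      (fun q hq => S.bform_eq_bH_of_const (S.pwConst_mem a₁)
        (fun s hs => S.mesh.pwConst_ae_eq S.dim a₁ hs) hq)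
      (fun q hq => S.bform_eq_bH_of_const (S.pwConst_mem a₂)
        (fun s hs => S.mesh.pwConst_ae_eq S.dim a₂ hs) hq)
      hv₁ hv₂ (by positivity) (by positivity) hce₁ hce₂ hve₁ hve₂
  have hlim : Tendsto (fun η : ℝ => (2 + 2 * K) *
      ((√(M * A) * H * normH1 Ω u + η) * (√(M * A) * H * normH1 Ω w + η))) (𝓝[>] 0)
      (𝓝 ((2 + 2 * K) * ((√(M * A) * H * normH1 Ω u + 0) * (√(M * A) * H * normH1 Ω w + 0)))) :=
    (Continuous.tendsto (by fun_prop) 0).mono_left nhdsWithin_le_nhds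
  -- The left side does not depend on η, so the density error is removed by letting η tend to 0.
  have hfin := ge_of_tendsto hlim (eventually_mem_nhdsWithin.mono fun η hη => main η hη)
  refine hfin.trans (le_of_eq ?_)
  have hsq : √(M * A) * √(M * A) = M * A := Real.mul_self_sqrt (by positivity)
  linear_combination (2 + 2 * K) * H ^ 2 * normH1 Ω u * normH1 Ω w * hsq

end IsSetting

lemma elemDiam_nonneg (s : Finset (Sp d)) : 0 ≤ elemDiam s := Metric.diam_nonneg

lemma elemInDiam_nonneg (s : Finset (Sp d)) : 0 ≤ elemInDiam s :=
  Real.sSup_nonneg fun _ h => h.1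

lemma IsRegularMesh.mono {κ γ κ' γ' : ℝ} (h : IsRegularMesh κ γ T) (hκ : κ ≤ κ') (hγ : γ ≤ γ') :
    IsRegularMesh κ' γ' T :=
  ⟨fun s hs t ht => (h.1 s hs t ht).trans (mul_le_mul_of_nonneg_right hκ (elemDiam_nonneg t)),
    fun s hs => (h.2 s hs).trans (mul_le_mul_of_nonneg_right hγ (elemInDiam_nonneg s))⟩

end

end MassLump

end

theorem lemma4p9 (d : ℕ) (hd : 1 ≤ d) (D βmin βmax κ γ : ℝ) (hβmin : 0 < βmin) :
    ∃ C : ℝ, 0 < C ∧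
      ∀ (kind : MeshKind) (Ω : Set (Sp d)) (T : Finset (Finset (Sp d))) (β : Sp d → ℝ),
        IsLipschitzDomain Ω → Metric.diam Ω ≤ D →
        IsMesh kind Ω T → IsRegularMesh κ γ T →
        AEMeasurable β (volume.restrict Ω) →
        (∀ᵐ x ∂(volume.restrict Ω), βmin ≤ β x ∧ β x ≤ βmax) →
        ∀ u w : Sp d → ℝ, MemH10 Ω u → MemH10 Ω w →
          |rH kind Ω T β u w| ≤ C * meshWidth T ^ 2 * normH1 Ω u * normH1 Ω w := by
  obtain ⟨C, hC, hb⟩ := exists_vertex_bound d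
  -- The maxima here and below keep the constants positive and c ≤ 1, without sign conditions on the
  -- parameters; enlarging the bounds only weakens the assumptions on β and the mesh.
  set M := max βmin βmax
  have hM : 0 < M := lt_max_of_lt_left hβmin
  have hκ : 1 ≤ max κ 1 := le_max_right _ _
  have hγ : 1 ≤ max γ 1 := le_max_right _ _
  set κ' := max κ 1
  set γ' := max γ 1
  set c := 1 / (4 * κ' * γ') with hc
  have hc0 : 0 < c := by positivity
  have hc1 : c ≤ 1 := by
    rw [hc, div_le_one (by positivity)]
    nlinarith
  have hQ : 0 ≤ quasiConst d c := by unfold quasiConst; positivity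
  refine ⟨(2 + 2 * (M * C / βmin)) * (M * (4 * (quasiConst d c + 2 ^ d))), by positivity, ?_⟩
  intro kind Ω T β hL _ hmesh hreg hmeas hbound u w hu hw
  have hball : ∀ s ∈ T, ∃ x, Metric.closedBall x (c * meshWidth T) ⊆ elem s := fun s hs =>
    hmesh.exists_ball hd (by linarith) (by linarith)
      (hreg.mono (le_max_left κ 1) (le_max_left γ 1)) hs
  have hH := hmesh.meshWidth_pos hd hL
  have S : IsSetting kind Ω T β βmin M :=
    { dim := hd
      domain := hL
      mesh := hmesh
      -- Each element contains a ball of radius cH > 0.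
      volume_pos := fun s hs => by
        obtain ⟨x, hx⟩ := hball s hs
        exact (Metric.measure_closedBall_pos volume x (mul_pos hc0 hH)).trans_le
          (measure_mono hx)
      meas := hmeas
      bound := hbound.mono fun x hx => ⟨hx.1, hx.2.trans (le_max_right _ _)⟩
      pos := hβmin }
  exact S.abs_rH_le hM hC hb hc0 hc1 hball hu hw
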